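/- **Setting.** For $\alpha,t_c>0$ and an interval $I\subset\mathbb R$ (possibly a single point), $F_{\alpha,t_c}(I)$ is the set of $f\in C^\infty(I)$ (smooth in a neighbourhood of each point of $I$) with $$\sup_{t\in I}\sup_{k\ge0}|f^{(k)}(t)|\,\frac{t_c^{\alpha+k}}{\Gamma(\alpha+k)}<\infty .$$ *Assumption XZ.* $X,Z$ are meromorphic in an open set $U\subset\mathbb C$ containing the real point $s_r$, are real on $U\cap\mathbb R$, and $\rho^2:=X^2+Z^2\ge c>0$ on $U\cap\mathbb R$. The critical points of $\rho^2$ are its zeros and the poles of $X$ and $Z$ (even where the singularity of $\rho^2$ is removable); they have no accumulation point in $U$, and near each critical point $s_0$ $$X(s)=(s-s_0)^mf(s-s_0)\,[1+(s-s_0)^ng_X(s-s_0)],\qquad Z(s)=\pm i\,(s-s_0)^mf(s-s_0)\,[1+(s-s_0)^ng_Z(s-s_0)],$$ where $n\in\mathbb N$, $n>0$, $m\in\mathbb Z$, $\frac{2m+n}2>-1$, the functions $f,g_X,g_Z$ are analytic near $0$, and $f(0)^2(g_X(0)-g_Z(0))\neq0$ ($m,n,f,g_X,g_Z$ and the sign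 may depend on $s_0$). Let $\tilde\theta$ be a continuous real function on $U\cap\mathbb R$ with $Z=\rho\cos\tilde\theta$, $X=\rho\sin\tilde\theta$, $\rho=\sqrt{\rho^2}>0$. Let the natural time be $\tau(s)=2\int_{s_r}^s\sqrt{\rho^2(u)}\,du$; put $t_r=\tau(s_r)=0$ and $\theta=\tilde\theta\circ\tau^{-1}$. Choose branch cuts attached to the critical points, closed in $U$, not containing $s_r$, and such that every critical point $s_0$ has arbitrarily small neighbourhoods that remain connected when the critical points and the cuts are removed (as is the case for a cut along a simple arc starting at $s_0$). Let $U_0$ be the connected component containing $s_r$ of $U$ without the critical points and the cuts; the cuts are such that $U_0$ is open and $\tau$ continues to a single-valued analytic function on $U_0$. Let $C_{r,0}$ be the connected component containing $s_r$ of $\{s\in U_0:|\tau(s)-\tau(s_r)|<r\}$, and let $R=\sup\{r>0:\overline{C_{r,0}}\subset U_0\}$, assumed finite. *Assumption R2.* $C_{R,0}$ is bounded and $\partial C_{R,0}\cap\partial U_0$ is a finite set of critical points. *Assumption R1* (at a critical point $s_0$). A level line of $\operatorname{Re}\tau$ in $U_0$ emanating from $s_0$ reaches the real axis at $s_r$,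 $C_{R,0}$ is bounded, and $\partial C_{R,0}\cap\partial U_0=\{s_0,\overline{s_0}\}$. **Theorem.** Let $X,Z$ satisfy Assumption XZ. (i) If Assumption R2 holds, then $\theta$ is smooth near $t_r$ and $\theta'\in F_{1,R}(\{t_r\})$. (Thus, at $t_r$, the condition "$\theta'\in F_{1,\tau_*}(J)$ for some $\tau_*\ge t_c$" holds with $J=\{t_r\}$ and $\tau_*=t_c=R$: Assumption 2.) (ii) If Assumption R1 holds at $s_0$, and $X,Z$ have the form above at $s_0$ with $m,n$ and the sign $\pm$, then $t_0=\tau(s_0):=\lim_{U_0\ni s\to s_0}\tau(s)$ exists and, with $\gamma=\frac{\pm n}{2m+n+2}$, there is a compact interval $I$ containing $t_r$ in its interior on which $\theta$ is smooth and $$\theta'(t)=i\gamma\Big(\frac1{t-t_0}-\frac1{t-\overline{t_0}}\Big)+\Delta\theta'(t),$$ where $\Delta\theta'\in F_{\alpha,R}(I)$ for every $\alpha\in(0,1)$ with $\alpha\ge\frac{2m+n}{2m+n+2}$. Moreover, in that case, $I\subset[t_r-R,t_r+R]$ and, for some $\gamma_*\in\mathbb R$ and $\alpha\in(0,1)$,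 $$\theta'(t)-i\gamma_*\Big(\frac1{t-t_r+iR}-\frac1{t-t_r-iR}\Big)\in F_{\alpha,R}(I)$$ (Assumption 1 on $I$ with $t_c=R$). -/

import Mathlib

open Set Filter Topology MeasureTheory
open scoped ENNReal ContDiff

noncomputable section

namespace SuperAdiabatic

/-- The norm `sup_{t ∈ I} sup_{k ≥ 0} |f^{(k)}(t)| tc^{α+k} / Γ(α+k)`, with values in `[0, ∞]`. -/
def facNorm (α tc : ℝ) (I : Set ℝ) (f : ℝ → ℂ) : ℝ≥0∞ :=
  ⨆ t ∈ I, ⨆ k : ℕ,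
    ENNReal.ofReal (‖iteratedDeriv k f t‖ * (tc ^ (α + k) / Real.Gamma (α + k)))

/-- The space `F_{α,tc}(I)`. Degenerate intervals `I = {t}` are allowed, so smoothness on `I` is
smoothness (in the two-sided sense) at each point of `I`. -/
def FSpace (α tc : ℝ) (I : Set ℝ) : Set (ℝ → ℂ) :=
  {f | (∀ t ∈ I, ContDiffAt ℝ ∞ f t) ∧ facNorm α tc I f < ⊤}

/-- The pair of conjugate poles `iγ (1/(t - t₀) - 1/(t - conj t₀))`. -/
def polePair (γ : ℝ) (t₀ : ℂ) (t : ℝ) : ℂ :=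
  Complex.I * γ * (1 / ((t : ℂ) - t₀) - 1 / ((t : ℂ) - (starRingEnd ℂ) t₀))

/-- Assumption 1 for the adiabatic coupling `f = θ'` on `I`, with parameters `tr`, `tc`:
on the compact interval `I ⊆ [tr - tc, tr + tc]` containing `tr`, `f` is
`iγ (1/(t - tr + i tc) - 1/(t - tr - i tc))` plus an element of `F_{α,tc}(I)`. -/
def Assumption1 (f : ℝ → ℂ) (tr tc : ℝ) (I : Set ℝ) : Prop :=
  0 < tc ∧ (∃ a b : ℝ, I = Icc a b) ∧ I ⊆ Icc (tr - tc) (tr + tc) ∧ tr ∈ I ∧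
    ∃ γ α : ℝ, 0 < α ∧ α < 1 ∧
      (fun t : ℝ => f t - polePair γ ((tr : ℂ) - Complex.I * tc) t) ∈ FSpace α tc I

/-- Assumption 2 for the adiabatic coupling `f = θ'` on the compact interval `I` (which may be a
single point): `f ∈ F_{1,τ}(I)` for some `τ ≥ tc`. -/
def Assumption2 (f : ℝ → ℂ) (tc : ℝ) (I : Set ℝ) : Prop :=
  0 < tc ∧ (∃ a b : ℝ, a ≤ b ∧ I = Icc a b) ∧ ∃ τ : ℝ, tc ≤ τ ∧ f ∈ FSpace 1 τ I

/-- `ρ² = X² + Z²`. -/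
def rhoSq (X Z : ℂ → ℂ) (s : ℂ) : ℂ := X s ^ 2 + Z s ^ 2

/-- The critical points of `ρ²` in `U`: the zeros of `ρ²` and the poles of `X` and `Z`
(also when the singularity of `ρ²` there is removable). -/
def criticalPoints (U : Set ℂ) (X Z : ℂ → ℂ) : Set ℂ :=
  {s ∈ U | rhoSq X Z s = 0 ∨ meromorphicOrderAt X s < 0 ∨ meromorphicOrderAt Z s < 0}

/-- The form of `X` and `Z` near the critical point `s₀`, with parameters `m`, `n` and the sign
`ε = ±1`. -/
def HasCriticalForm (X Z : ℂ → ℂ) (s₀ : ℂ) (m : ℤ) (n : ℕ) (ε : ℤ) : Prop :=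
  0 < n ∧ (2 * (m : ℝ) + n) / 2 > -1 ∧ (ε = 1 ∨ ε = -1) ∧
    ∃ f gX gZ : ℂ → ℂ, AnalyticAt ℂ f 0 ∧ AnalyticAt ℂ gX 0 ∧ AnalyticAt ℂ gZ 0 ∧
      0 < ‖f 0 ^ 2 * (gX 0 - gZ 0)‖ ∧
      ∀ᶠ s in 𝓝[≠] s₀,
        X s = (s - s₀) ^ m * f (s - s₀) * (1 + (s - s₀) ^ n * gX (s - s₀)) ∧
        Z s = ε * Complex.I * (s - s₀) ^ m * f (s - s₀) * (1 + (s - s₀) ^ n * gZ (s - s₀))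

/-- Assumption XZ. `MeromorphicNFOn` says that the function is meromorphic, and analytic away from
its poles. The fields `realX`, `realZ` say that the Hamiltonian is real on the real axis. -/
structure AssumptionXZ (U : Set ℂ) (X Z : ℂ → ℂ) (sr : ℝ) : Prop where
  isOpen : IsOpen U
  mem : (sr : ℂ) ∈ U
  meroX : MeromorphicNFOn X U
  meroZ : MeromorphicNFOn Z U
  realX : ∀ x : ℝ, (x : ℂ) ∈ U → (X x).im = 0
  realZ : ∀ x : ℝ, (x : ℂ) ∈ U → (Z x).im = 0
  pos : ∃ c : ℝ, 0 < c ∧ ∀ x : ℝ, (x : ℂ) ∈ U → c ≤ (rhoSq X Z x).re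
  form : ∀ s₀ ∈ criticalPoints U X Z, ∃ (m : ℤ) (n : ℕ) (ε : ℤ), HasCriticalForm X Z s₀ m n ε
  discrete : ∀ s ∈ U, ¬ AccPt s (𝓟 (criticalPoints U X Z))

/-- `θt` is the angle of the Hamiltonian: `Z = ρ cos θt`, `X = ρ sin θt` on `U ∩ ℝ`, and `θt` is
continuous there. -/
def IsAngle (U : Set ℂ) (X Z : ℂ → ℂ) (θt : ℝ → ℝ) : Prop :=
  ContinuousOn θt {x : ℝ | (x : ℂ) ∈ U} ∧
    ∀ x : ℝ, (x : ℂ) ∈ U →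
      Z x = ((√(rhoSq X Z x).re * Real.cos (θt x) : ℝ) : ℂ) ∧
      X x = ((√(rhoSq X Z x).re * Real.sin (θt x) : ℝ) : ℂ)

/-- The natural time on the real axis, `τ(s) = 2 ∫_{sr}^s √(ρ²(u)) du`. -/
def realTime (X Z : ℂ → ℂ) (sr s : ℝ) : ℝ :=
  2 * ∫ u in sr..s, √(rhoSq X Z u).re

/-- `θ = θt ∘ τ⁻¹`, where `τ⁻¹` is the inverse of the natural time on the interval of `U ∩ ℝ`
around `sr`. -/
def thetaOf (U : Set ℂ) (X Z : ℂ → ℂ) (sr : ℝ) (θt : ℝ → ℝ) : ℝ → ℝ :=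
  θt ∘ Function.invFunOn (realTime X Z sr) (connectedComponentIn {x : ℝ | (x : ℂ) ∈ U} sr)

/-- The adiabatic coupling `θ'`, as a complex-valued function of the real time `t`. -/
def couplingOf (U : Set ℂ) (X Z : ℂ → ℂ) (sr : ℝ) (θt : ℝ → ℝ) (t : ℝ) : ℂ :=
  ((deriv (thetaOf U X Z sr θt) t : ℝ) : ℂ)

/-- `U` without the critical points and the branch cuts; `B s₀` is the branch cut attached to the
critical point `s₀` (empty if none is needed there). -/
def slitSet (U : Set ℂ) (X Z : ℂ → ℂ) (B : ℂ → Set ℂ) : Set ℂ :=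
  U \ ⋃ s₀ ∈ criticalPoints U X Z, insert s₀ (B s₀)

/-- `U₀`: the connected component of the slit set that contains `sr`. -/
def slitDomain (U : Set ℂ) (X Z : ℂ → ℂ) (sr : ℝ) (B : ℂ → Set ℂ) : Set ℂ :=
  connectedComponentIn (slitSet U X Z B) sr

/-- The requirements on the branch cuts. They are closed in `U`, avoid `sr`, and near its tip `s₀`
the cut does not disconnect the plane, which is the case for every cut along a simple arc that
starts at `s₀`. (That the cuts make `τ` single valued is part of `IsNaturalTime`.) -/
structure IsBranchCutSystem (U : Set ℂ) (X Z : ℂ → ℂ) (sr : ℝ) (B : ℂ → Set ℂ) : Prop where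
  isOpen_slit : IsOpen (slitSet U X Z B)
  not_mem : ∀ s₀ ∈ criticalPoints U X Z, (sr : ℂ) ∉ B s₀
  tip : ∀ s₀ ∈ criticalPoints U X Z, ∀ N ∈ 𝓝 s₀, ∃ M ∈ 𝓝 s₀, M ⊆ N ∧
    IsPreconnected (M ∩ slitSet U X Z B)

/-- `τ` is the natural time on `U₀`: the (single-valued) analytic function on `U₀` that is given by
`2 ∫_{sr}^s √(ρ²(u)) du` for real `s` near `sr`. Since `U₀` is connected, this determines `τ` on
`U₀`. -/
def IsNaturalTime (U : Set ℂ) (X Z : ℂ → ℂ) (sr : ℝ) (B : ℂ → Set ℂ) (τ : ℂ → ℂ) : Prop :=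
  AnalyticOnNhd ℂ τ (slitDomain U X Z sr B) ∧
    ∀ᶠ s : ℝ in 𝓝 sr, τ s = (realTime X Z sr s : ℂ)

/-- `C_{r,0}`: the connected component containing `sr` of `C_r = {s ∈ U₀ | |τ(s) - τ(sr)| < r}`. -/
def sublevel (U₀ : Set ℂ) (τ : ℂ → ℂ) (sr r : ℝ) : Set ℂ :=
  connectedComponentIn {s ∈ U₀ | ‖τ s - τ sr‖ < r} sr

/-- `R = sup {r > 0 | closure C_{r,0} ⊆ U₀}`, the supremum being finite. -/
def IsRadius (U₀ : Set ℂ) (τ : ℂ → ℂ) (sr R : ℝ) : Prop :=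
  IsLUB {r : ℝ | 0 < r ∧ closure (sublevel U₀ τ sr r) ⊆ U₀} R

/-- Assumption R2: as `r` grows to `R`, the bounded region `C_{r,0}` hits the boundary of `U₀` in
critical points only. -/
def AssumptionR2 (U₀ crit : Set ℂ) (τ : ℂ → ℂ) (sr R : ℝ) : Prop :=
  Bornology.IsBounded (sublevel U₀ τ sr R) ∧
    (frontier (sublevel U₀ τ sr R) ∩ frontier U₀).Finite ∧
    frontier (sublevel U₀ τ sr R) ∩ frontier U₀ ⊆ crit

/-- A level line of `Re τ` in `U₀` that emanates from `s₀` and reaches the real axis at `sr`. -/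
def HasStokesLine (U₀ : Set ℂ) (τ : ℂ → ℂ) (s₀ : ℂ) (sr : ℝ) : Prop :=
  ∃ σ : ℝ → ℂ, ContinuousOn σ (Icc 0 1) ∧ σ 0 = s₀ ∧ σ 1 = sr ∧
    ∀ u ∈ Ioc (0 : ℝ) 1, σ u ∈ U₀ ∧ (τ (σ u)).re = (τ sr).re

/-- Assumption R1 for the critical point `s₀`. -/
def AssumptionR1 (U₀ crit : Set ℂ) (τ : ℂ → ℂ) (sr R : ℝ) (s₀ : ℂ) : Prop :=
  s₀ ∈ crit ∧ HasStokesLine U₀ τ s₀ sr ∧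
    Bornology.IsBounded (sublevel U₀ τ sr R) ∧
    frontier (sublevel U₀ τ sr R) ∩ frontier U₀ = {s₀, (starRingEnd ℂ) s₀}

end SuperAdiabatic

end

namespace SuperAdiabatic

/-! In natural time the coupling is `h = (θ̃' / τ') ∘ φ`, where `φ` inverts `τ` and `θ̃' = (X' Z - X
Z') / ρ²`. Below radius `R` the sets `C_{r,0}` have compact closure inside `U₀`, where `τ' ≠ 0`. So
the inverse germ at `0` continues to the whole disc `|t| < R` (`exists_lift_ball`), and its image is
exactly `C_{R,0}` (`IsLift.sublevel_eq_image`). Since `∂C_{R,0} ∩ ∂U₀` is finite, `φ` has a limit at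
every point of the circle `|t| = R` (`IsLift.exists_tendsto`). If the limit lies in `U₀`, then `h`
continues analytically across that point; otherwise the limit is a critical point `s₀` and the
boundary point is `t₀ = τ(s₀)`.

Near `s₀`, with `u = s - s₀` and `M = 2m + n + 2`, one has `ρ² = u^(M-2) q(u)` and `u θ̃' = g(u)`
with `g(0) = ± i n / 2`. Integration gives `(τ - t₀)² = u^M k(u)²`, so `u` is an analytic function
of `y^(2/M)`, where `y = 1 - t / t₀`. Hence `h = L(y^(2/M)) / y` with `L` analytic
(`IsLift.exists_singular_form`): a simple pole with residue `2 g(0) / M = iγ`, plus a remainder of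
size `|y|^(2/M - 1)`, where `1 - 2/M = (2m + n) / (2m + n + 2)`.

The remainder after subtracting all the poles is controlled by Cauchy's formula
(`exists_cauchy_bound`). The space `F_{α,R}` asks for `k`-th derivatives of order `Γ(α + k) R^(-k)`.
A supremum bound on circles loses a factor `k`, so the formula is applied to the first derivative,
of size `|z - p|^(-1-α)`. Its mean over a circle of radius `r < R` is only `O((R - r)^(-α))`, and `R
- r = R / (2(k + 1))` gives the right growth. This works at every centre `t` near `0` whose distance
to all the singular points is at least `R`. The centre `0` always qualifies, which gives (i), where
the poles themselves belong to `F_{1,R}({0})`. In (ii) the Stokes line puts `t₀` on the imaginary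
axis, and reflection makes `t₀` and its conjugate the only singular points; then every real `t` near
`0` qualifies, which gives an interval. -/

/-! ### Tools from one complex variable: inverses, roots, a singular linear equation, gluing,
restriction to the real line. -/

theorem exists_analytic_inverse {τ : ℂ → ℂ} {s : ℂ} (h : AnalyticAt ℂ τ s) (h' : deriv τ s ≠ 0) :
    ∃ ψ : ℂ → ℂ, AnalyticAt ℂ ψ (τ s) ∧ ψ (τ s) = s ∧ (∀ᶠ t in 𝓝 (τ s), τ (ψ t) = t) ∧
      ∀ᶠ x in 𝓝 s, ψ (τ x) = x := by
  have hc : ContDiffAt ℂ ⊤ τ s := h.contDiffAt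
  have hs := (h.hasStrictDerivAt).hasStrictFDerivAt_equiv h'
  have hf := hs.hasFDerivAt
  refine ⟨hc.localInverse hf (by simp), (hc.to_localInverse hf (by simp)).analyticAt,
    hc.localInverse_apply_image hf (by simp), ?_, ?_⟩
  · exact (hc.hasStrictFDerivAt' hf (by simp)).eventually_right_inverse
  · exact (hc.hasStrictFDerivAt' hf (by simp)).eventually_left_inverse

theorem exists_analytic_root {q : ℂ → ℂ} (hq : AnalyticAt ℂ q 0) (h0 : q 0 ≠ 0) {M : ℕ}
    (hM : M ≠ 0) : ∃ p : ℂ → ℂ, AnalyticAt ℂ p 0 ∧ p 0 ≠ 0 ∧ ∀ z, p z ^ M = q z := by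
  refine ⟨fun z => (q 0) ^ ((M : ℂ)⁻¹) * (q z / q 0) ^ ((M : ℂ)⁻¹), ?_, ?_, ?_⟩
  · refine analyticAt_const.mul ((hq.div analyticAt_const h0).cpow analyticAt_const ?_)
    simp [h0]
  · simp [h0]
  · intro z
    simp only [mul_pow, Complex.cpow_nat_inv_pow _ hM]
    field_simp

/-- For `P = 2p` this is the equation of the factor `k` in `τ - t₀ = u^(M/2) k(u)` when `τ' = 2
u^(M/2 - 1) p(u)`. The solution is `∫₀¹ x^(M/2 - 1) P(x u) dx`; substituting `x = y²` removes the
half-integer power. The equation is then the fundamental theorem of calculus for `y^M P(y² u)`. -/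
theorem exists_analytic_ode {P : ℂ → ℂ} (hP : AnalyticAt ℂ P 0) {M : ℕ} (hM : 0 < M) :
    ∃ k : ℂ → ℂ, AnalyticAt ℂ k 0 ∧ ∀ᶠ u in 𝓝 (0 : ℂ), (M / 2 : ℂ) * k u + u * deriv k u = P u := by
  obtain ⟨δ, hδ, hball⟩ := Metric.eventually_nhds_iff_ball.1 hP.eventually_analyticAt
  obtain ⟨C, hC⟩ : ∃ C, ∀ z ∈ Metric.closedBall (0 : ℂ) (δ / 2), ‖deriv P z‖ ≤ C :=
    (isCompact_closedBall _ _).exists_bound_of_continuousOn fun z hz =>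
      (hball z (Metric.closedBall_subset_ball (by linarith) hz)).deriv.continuousAt.continuousWithinAt
  have hmem : ∀ u ∈ Metric.ball (0 : ℂ) (δ / 2), ∀ y ∈ Icc (0 : ℝ) 1,
      ((y : ℂ) ^ 2 * u) ∈ Metric.ball (0 : ℂ) (δ / 2) := by
    intro u hu y hy
    rw [mem_ball_zero_iff] at hu ⊢
    rw [norm_mul, norm_pow, Complex.norm_real, Real.norm_of_nonneg hy.1]
    have : y ^ 2 ≤ 1 := pow_le_one₀ hy.1 hy.2
    nlinarith [norm_nonneg u]
  have hanal : ∀ u ∈ Metric.ball (0 : ℂ) (δ / 2), ∀ y ∈ Icc (0 : ℝ) 1,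
      AnalyticAt ℂ P ((y : ℂ) ^ 2 * u) := fun u hu y hy =>
    hball _ (Metric.ball_subset_ball (by linarith) (hmem u hu y hy))
  have hcont : ∀ u ∈ Metric.ball (0 : ℂ) (δ / 2), ContinuousOn
      (fun y : ℝ => 2 * (y : ℂ) ^ (M - 1) * P ((y : ℂ) ^ 2 * u)) (Icc 0 1) := by
    intro u hu y hy
    refine ContinuousAt.continuousWithinAt ?_
    refine ContinuousAt.mul (by fun_prop) ?_
    exact ContinuousAt.comp (f := fun y : ℝ => (y : ℂ) ^ 2 * u) (hanal u hu y hy).continuousAt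
      (by fun_prop)
  have hcont' : ∀ u ∈ Metric.ball (0 : ℂ) (δ / 2), ContinuousOn
      (fun y : ℝ => 2 * (y : ℂ) ^ (M - 1) * (deriv P ((y : ℂ) ^ 2 * u) * (y : ℂ) ^ 2))
      (Icc 0 1) := by
    intro u hu y hy
    refine ContinuousAt.continuousWithinAt ?_
    refine ContinuousAt.mul (by fun_prop) (ContinuousAt.mul ?_ (by fun_prop))
    exact ContinuousAt.comp (f := fun y : ℝ => (y : ℂ) ^ 2 * u)
      (hanal u hu y hy).deriv.continuousAt (by fun_prop)
  have hint : ∀ u ∈ Metric.ball (0 : ℂ) (δ / 2), IntervalIntegrable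
      (fun y : ℝ => 2 * (y : ℂ) ^ (M - 1) * P ((y : ℂ) ^ 2 * u)) volume 0 1 := fun u hu =>
    ContinuousOn.intervalIntegrable (by rw [uIcc_of_le zero_le_one]; exact hcont u hu)
  set k : ℂ → ℂ := fun u => ∫ y in (0 : ℝ)..1, 2 * (y : ℂ) ^ (M - 1) * P ((y : ℂ) ^ 2 * u)
  have hder : ∀ u ∈ Metric.ball (0 : ℂ) (δ / 2), HasDerivAt k
      (∫ y in (0 : ℝ)..1, 2 * (y : ℂ) ^ (M - 1) * (deriv P ((y : ℂ) ^ 2 * u) * (y : ℂ) ^ 2)) u := by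
    intro u hu
    have hn : Metric.ball (0 : ℂ) (δ / 2) ∈ 𝓝 u := Metric.isOpen_ball.mem_nhds hu
    refine (intervalIntegral.hasDerivAt_integral_of_dominated_loc_of_deriv_le
      (F := fun u (y : ℝ) => 2 * (y : ℂ) ^ (M - 1) * P ((y : ℂ) ^ 2 * u))
      (F' := fun u (y : ℝ) => 2 * (y : ℂ) ^ (M - 1) * (deriv P ((y : ℂ) ^ 2 * u) * (y : ℂ) ^ 2))
      (bound := fun _ => 2 * C) hn ?_ (hint u hu) ?_ ?_ intervalIntegrable_const ?_).2
    · filter_upwards [hn] with v hv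
      have := (hint v hv).aestronglyMeasurable
      rwa [uIoc_of_le zero_le_one]
    · have : IntervalIntegrable
        (fun y : ℝ => 2 * (y : ℂ) ^ (M - 1) * (deriv P ((y : ℂ) ^ 2 * u) * (y : ℂ) ^ 2)) volume 0 1 :=
        ContinuousOn.intervalIntegrable (by rw [uIcc_of_le zero_le_one]; exact hcont' u hu)
      rw [uIoc_of_le zero_le_one]
      exact this.aestronglyMeasurable
    · refine Eventually.of_forall fun y hy v hv => ?_
      rw [uIoc_of_le zero_le_one] at hy
      have hy' : y ∈ Icc (0 : ℝ) 1 := ⟨hy.1.le, hy.2⟩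
      have h1 := hC _ (Metric.ball_subset_closedBall (hmem v hv y hy'))
      have h2 : y ^ (M - 1) ≤ 1 := pow_le_one₀ hy'.1 hy'.2
      have h3 : y ^ 2 ≤ 1 := pow_le_one₀ hy'.1 hy'.2
      simp only [norm_mul, norm_pow, Complex.norm_real, Real.norm_of_nonneg hy'.1, Complex.norm_ofNat]
      have h4 : 0 ≤ y ^ (M - 1) := pow_nonneg hy'.1 _
      have h5 : 0 ≤ C := (norm_nonneg _).trans h1
      have : ‖deriv P ((y : ℂ) ^ 2 * v)‖ * y ^ 2 ≤ C * 1 := by gcongr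
      calc 2 * y ^ (M - 1) * (‖deriv P ((y : ℂ) ^ 2 * v)‖ * y ^ 2) ≤ 2 * 1 * (C * 1) := by gcongr
        _ = 2 * C := by ring
    · refine Eventually.of_forall fun y hy v hv => ?_
      rw [uIoc_of_le zero_le_one] at hy
      have hy' : y ∈ Icc (0 : ℝ) 1 := ⟨hy.1.le, hy.2⟩
      refine HasDerivAt.const_mul _ ?_
      have h2 : HasDerivAt (fun v : ℂ => (y : ℂ) ^ 2 * v) ((y : ℂ) ^ 2) v := by
        simpa using (hasDerivAt_id v).const_mul ((y : ℂ) ^ 2)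
      exact HasDerivAt.comp v (hanal v hv y hy').differentiableAt.hasDerivAt h2
  have hδ2 : 0 < δ / 2 := by linarith
  refine ⟨k, ?_, ?_⟩
  · refine DifferentiableOn.analyticAt (s := Metric.ball (0 : ℂ) (δ / 2))
      (fun u hu => (hder u hu).differentiableAt.differentiableWithinAt) (Metric.ball_mem_nhds _ hδ2)
  · filter_upwards [Metric.ball_mem_nhds (0 : ℂ) hδ2] with u hu
    rw [(hder u hu).deriv]
    have hi' : IntervalIntegrable
        (fun y : ℝ => 2 * (y : ℂ) ^ (M - 1) * (deriv P ((y : ℂ) ^ 2 * u) * (y : ℂ) ^ 2)) volume 0 1 :=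
        ContinuousOn.intervalIntegrable (by rw [uIcc_of_le zero_le_one]; exact hcont' u hu)
    rw [← intervalIntegral.integral_const_mul, ← intervalIntegral.integral_const_mul,
      ← intervalIntegral.integral_add ((hint u hu).const_mul _) (hi'.const_mul _)]
    have hF : ∀ y ∈ uIcc (0 : ℝ) 1, HasDerivAt (fun y : ℝ => (y : ℂ) ^ M * P ((y : ℂ) ^ 2 * u))
        ((M / 2 : ℂ) * (2 * (y : ℂ) ^ (M - 1) * P ((y : ℂ) ^ 2 * u)) +
          u * (2 * (y : ℂ) ^ (M - 1) * (deriv P ((y : ℂ) ^ 2 * u) * (y : ℂ) ^ 2))) y := by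
      intro y hy
      rw [uIcc_of_le zero_le_one] at hy
      have h1 : HasDerivAt (fun z : ℂ => z ^ 2 * u) (2 * (y : ℂ) * u) (y : ℂ) := by
        simpa using (hasDerivAt_pow 2 (y : ℂ)).mul_const u
      have h2 : HasDerivAt (fun z : ℂ => P (z ^ 2 * u)) _ (y : ℂ) :=
        HasDerivAt.comp (y : ℂ) (h := fun z : ℂ => z ^ 2 * u)
          (hanal u hu y hy).differentiableAt.hasDerivAt h1
      have h3 := ((hasDerivAt_pow M (y : ℂ)).mul h2).comp_ofReal
      refine h3.congr_deriv ?_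
      obtain ⟨M, rfl⟩ : ∃ M', M = M' + 1 := ⟨M - 1, by omega⟩
      simp only [Nat.add_sub_cancel]
      push_cast
      ring
    rw [intervalIntegral.integral_eq_sub_of_hasDerivAt hF
      (((hint u hu).const_mul _).add (hi'.const_mul _))]
    simp [hM.ne']

/-- Two local extensions agree where they overlap in `E`: the overlap `ball p ∩ ball q ∩ E` is
convex and meets `D`, so the identity theorem applies. Convexity thus replaces any monodromy
argument. -/
theorem exists_glue {D E : Set ℂ} (hD : IsOpen D) (hDc : Convex ℝ D) (hDE : D ⊆ E)
    (hE : IsOpen E) (hEc : Convex ℝ E) {f : ℂ → ℂ} {δ : ℂ → ℝ}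
    {g : ℂ → ℂ → ℂ} (hδ : ∀ p ∈ closure D, 0 < δ p)
    (hg : ∀ p ∈ closure D, AnalyticOnNhd ℂ (g p) (Metric.ball p (δ p) ∩ E))
    (hgf : ∀ p ∈ closure D, EqOn (g p) f (Metric.ball p (δ p) ∩ D)) :
    ∃ F : ℂ → ℂ, (∀ p ∈ closure D, EqOn F (g p) (Metric.ball p (δ p) ∩ E)) ∧ EqOn F f D ∧
      AnalyticOnNhd ℂ F (E ∩ ⋃ p ∈ closure D, Metric.ball p (δ p)) := by
  classical
  have key : ∀ p ∈ closure D, ∀ q ∈ closure D, ∀ z ∈ E, z ∈ Metric.ball p (δ p) →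
      z ∈ Metric.ball q (δ q) → g p z = g q z := by
    intro p hp q hq z hzE hzp hzq
    have hdist : dist p q < δ p + δ q := by
      have h1 := Metric.mem_ball.1 hzp
      have h2 := Metric.mem_ball.1 hzq
      have := dist_triangle_left p q z
      linarith
    obtain ⟨w, hwp, hwq, hw⟩ : ∃ w, w ∈ Metric.ball p (δ p) ∧ w ∈ Metric.ball q (δ q) ∧
        w ∈ closure D := by
      have hs : 0 < δ p + δ q := add_pos (hδ p hp) (hδ q hq)
      -- The point dividing the segment in the ratio of the radii lies in both balls, and in
      -- `closure D` by convexity.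
      refine ⟨AffineMap.lineMap p q (δ p / (δ p + δ q)), ?_, ?_, ?_⟩
      · rw [Metric.mem_ball, dist_lineMap_left, Real.norm_of_nonneg (by have := hδ p hp; positivity),
          div_mul_eq_mul_div, div_lt_iff₀ hs]
        exact mul_lt_mul_of_pos_left hdist (hδ p hp)
      · rw [Metric.mem_ball, dist_lineMap_right]
        have : 1 - δ p / (δ p + δ q) = δ q / (δ p + δ q) := by field_simp; ring
        rw [this, Real.norm_of_nonneg (by have := hδ q hq; positivity),
          div_mul_eq_mul_div, div_lt_iff₀ hs]
        exact mul_lt_mul_of_pos_left hdist (hδ q hq)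
      · refine (hDc.closure).lineMap_mem hp hq ⟨by have := hδ p hp; positivity, ?_⟩
        rw [div_le_one hs]
        linarith [hδ q hq]
    have ho : IsOpen (Metric.ball p (δ p) ∩ Metric.ball q (δ q)) :=
      Metric.isOpen_ball.inter Metric.isOpen_ball
    obtain ⟨v, hv, hvD⟩ := mem_closure_iff.1 hw _ ho ⟨hwp, hwq⟩
    have hconv : IsPreconnected ((Metric.ball p (δ p) ∩ Metric.ball q (δ q)) ∩ E) :=
      (((convex_ball _ _).inter (convex_ball _ _)).inter hEc).isPreconnected
    refine AnalyticOnNhd.eqOn_of_preconnected_of_eventuallyEq (f := g p) (g := g q)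
      ((hg p hp).mono fun x hx => ⟨hx.1.1, hx.2⟩) ((hg q hq).mono fun x hx => ⟨hx.1.2, hx.2⟩)
      hconv (z₀ := v) ⟨hv, hDE hvD⟩ ?_ ⟨⟨hzp, hzq⟩, hzE⟩
    filter_upwards [ho.mem_nhds hv, hD.mem_nhds hvD] with x hx hxD
    rw [hgf p hp ⟨hx.1, hxD⟩, hgf q hq ⟨hx.2, hxD⟩]
  let F : ℂ → ℂ := fun z =>
    if h : ∃ p ∈ closure D, z ∈ Metric.ball p (δ p) then g h.choose z else 0
  have hF : ∀ p ∈ closure D, EqOn F (g p) (Metric.ball p (δ p) ∩ E) := by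
    intro p hp z hz
    have h : ∃ p ∈ closure D, z ∈ Metric.ball p (δ p) := ⟨p, hp, hz.1⟩
    have : F z = g h.choose z := dif_pos h
    rw [this]
    exact key _ h.choose_spec.1 p hp z hz.2 h.choose_spec.2 hz.1
  refine ⟨F, hF, ?_, ?_⟩
  · intro z hz
    have hb := Metric.mem_ball_self (x := z) (hδ z (subset_closure hz))
    rw [hF z (subset_closure hz) ⟨hb, hDE hz⟩, hgf z (subset_closure hz) ⟨hb, hz⟩]
  · rintro z ⟨hzE, hz⟩
    obtain ⟨p, hp, hzp⟩ := mem_iUnion₂.1 hz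
    refine (hg p hp z ⟨hzp, hzE⟩).congr ?_
    filter_upwards [(Metric.isOpen_ball.inter hE).mem_nhds ⟨hzp, hzE⟩] with x hx
    exact (hF p hp hx).symm

theorem analyticAt_conj_conj {f : ℂ → ℂ} {z : ℂ} (hf : AnalyticAt ℂ f z) :
    AnalyticAt ℂ (fun w => (starRingEnd ℂ) (f ((starRingEnd ℂ) w))) ((starRingEnd ℂ) z) := by
  rw [Complex.analyticAt_iff_eventually_differentiableAt] at hf ⊢
  have : Tendsto (starRingEnd ℂ) (𝓝 ((starRingEnd ℂ) z)) (𝓝 z) := by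
    simpa using Complex.continuous_conj.tendsto ((starRingEnd ℂ) z)
  filter_upwards [this.eventually hf] with w hw
  simpa [Function.comp_def] using hw.conj_conj

theorem iteratedDeriv_comp_ofReal {F : ℂ → ℂ} (k : ℕ) : ∀ {t : ℝ}, AnalyticAt ℂ F t →
    iteratedDeriv k (fun x : ℝ => F x) t = iteratedDeriv k F t := by
  induction k with
  | zero => intro t _; simp
  | succ k ih =>
    intro t ht
    rw [iteratedDeriv_succ, iteratedDeriv_succ]
    have h1 : (iteratedDeriv k fun x : ℝ => F x) =ᶠ[𝓝 t] fun x : ℝ => iteratedDeriv k F x := by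
      have : Tendsto (fun x : ℝ => (x : ℂ)) (𝓝 t) (𝓝 (t : ℂ)) :=
        Complex.continuous_ofReal.tendsto t
      filter_upwards [this.eventually ht.eventually_analyticAt] with x hx using ih hx
    rw [h1.deriv_eq]
    have h2 : AnalyticAt ℂ (iteratedDeriv k F) t := by
      rw [iteratedDeriv_eq_iterate]; exact ht.iterated_deriv k
    exact h2.differentiableAt.hasDerivAt.comp_ofReal.deriv

theorem contDiffAt_comp_ofReal {F : ℂ → ℂ} {t : ℝ} (ht : AnalyticAt ℂ F t) :
    ContDiffAt ℝ ∞ (fun x : ℝ => F x) t := by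
  have h1 : ContDiffAt ℝ ∞ F (t : ℂ) := (ht.contDiffAt (n := ∞)).restrict_scalars ℝ
  exact ContDiffAt.comp t h1 Complex.ofRealCLM.contDiff.contDiffAt

/-! ### Cauchy estimates in the mean, for power singularities on the boundary of the disc. -/

theorem norm_iteratedDeriv_le_circle_mean {F : ℂ → ℂ} {t : ℂ} {r : ℝ} (hr : 0 < r)
    (hF : DiffContOnCl ℂ F (Metric.ball t r)) (k : ℕ) :
    ‖iteratedDeriv k F t‖ ≤
      k.factorial * (((2 * Real.pi)⁻¹ * ∫ θ : ℝ in 0..2 * Real.pi, ‖F (circleMap t r θ)‖) *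
        r⁻¹ ^ k) := by
  have hπ := Real.pi_pos
  have h1 := hF.circleIntegral_one_div_sub_center_pow_smul hr k
  have h2 : ‖∮ z in C(t, r), (1 / (z - t) ^ (k + 1)) • F z‖ ≤
      ∫ θ : ℝ in 0..2 * Real.pi, r⁻¹ ^ k * ‖F (circleMap t r θ)‖ := by
    refine (intervalIntegral.norm_integral_le_integral_norm (by positivity)).trans_eq ?_
    congr 1 with θ
    simp only [deriv_circleMap, norm_smul, norm_mul, norm_div, norm_pow, norm_one, Complex.norm_I,
      circleMap_sub_center, norm_circleMap_zero, abs_of_pos hr, inv_pow, pow_succ]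
    field_simp
  rw [h1, intervalIntegral.integral_const_mul, norm_smul, norm_div, norm_mul, norm_mul,
    Complex.norm_I, Complex.norm_real, Complex.norm_natCast, Real.norm_of_nonneg hπ.le,
    Complex.norm_ofNat, mul_one, div_mul_eq_mul_div, div_le_iff₀ (by positivity)] at h2
  rw [← mul_le_mul_iff_right₀ (show 0 < 2 * Real.pi by positivity)]
  refine h2.trans_eq ?_
  field_simp

/-- The squared distance is `(D - r)² + 2 r D (1 - cos φ)`. It dominates the radial gap and, by `1 -
cos φ ≥ 2φ²/π²`, the angular gap separately, hence also their average. The average is linear in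
`|φ|` and can be integrated explicitly. -/
theorem le_norm_circleMap_sub {R r D φ : ℝ} (hR : 0 < R) (hr : R / 2 ≤ r) (hrR : r < R)
    (hD : R ≤ D) (hφ : |φ| ≤ Real.pi) :
    ((R - r) + R / Real.pi * |φ|) / 2 ≤ ‖circleMap 0 r φ - D‖ := by
  have hcos := Real.cos_le_one_sub_mul_cos_sq hφ
  have hr0 : 0 < r := by linarith
  have hsq : ‖circleMap 0 r φ - D‖ ^ 2 = (D - r) ^ 2 + 2 * r * D * (1 - Real.cos φ) := by
    rw [← Complex.normSq_eq_norm_sq, Complex.normSq_apply]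
    simp [circleMap, Complex.exp_ofReal_mul_I_re, Complex.exp_ofReal_mul_I_im]
    linear_combination r ^ 2 * Real.sin_sq_add_cos_sq φ
  have hc0 : 0 ≤ 1 - Real.cos φ := by linarith [Real.cos_le_one φ]
  have h1 : R - r ≤ ‖circleMap 0 r φ - D‖ := by
    refine le_of_sq_le_sq ?_ (norm_nonneg _)
    rw [hsq]
    have : (R - r) ^ 2 ≤ (D - r) ^ 2 := by gcongr
    have : 0 ≤ 2 * r * D * (1 - Real.cos φ) := by
      have : 0 < D := by linarith
      positivity
    linarith
  have h2 : R / Real.pi * |φ| ≤ ‖circleMap 0 r φ - D‖ := by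
    refine le_of_sq_le_sq ?_ (norm_nonneg _)
    rw [hsq, mul_pow, div_pow, sq_abs]
    have hq : 2 / Real.pi ^ 2 * φ ^ 2 ≤ 1 - Real.cos φ := by linarith
    have hrD : R ^ 2 / 2 ≤ r * D := by nlinarith
    calc R ^ 2 / Real.pi ^ 2 * φ ^ 2 = 2 * (R ^ 2 / 2) * (2 / Real.pi ^ 2 * φ ^ 2) / 2 := by ring
      _ ≤ 2 * (r * D) * (1 - Real.cos φ) := by
        have : 2 * (R ^ 2 / 2) * (2 / Real.pi ^ 2 * φ ^ 2) ≤ 2 * (r * D) * (1 - Real.cos φ) := by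
          have : 0 ≤ r * D := (by positivity : 0 ≤ R ^ 2 / 2).trans hrD
          gcongr
        have h3 : 0 ≤ 2 * (R ^ 2 / 2) * (2 / Real.pi ^ 2 * φ ^ 2) := by positivity
        linarith
      _ ≤ _ := by nlinarith [sq_nonneg (D - r)]
  linarith

theorem integral_rpow_neg_le {α c d b : ℝ} (hα : 0 < α) (hc : 0 < c) (hd : 0 < d) (hb : 0 ≤ b) :
    ∫ x in (0 : ℝ)..b, ((d + c * x) / 2) ^ (-1 - α) ≤ 2 / (c * α) * (d / 2) ^ (-α) := by
  have hpos : ∀ x ∈ uIcc 0 b, 0 < (d + c * x) / 2 := by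
    intro x hx
    rw [uIcc_of_le hb] at hx
    have := mul_nonneg hc.le hx.1
    linarith
  have hder : ∀ x ∈ uIcc 0 b, HasDerivAt (fun x : ℝ => -(2 / (c * α)) * ((d + c * x) / 2) ^ (-α))
      (((d + c * x) / 2) ^ (-1 - α)) x := by
    intro x hx
    have h1 : HasDerivAt (fun x : ℝ => (d + c * x) / 2) (c / 2) x := by
      simpa using (((hasDerivAt_id x).const_mul c).const_add d).div_const 2
    refine ((h1.rpow_const (p := -α) (Or.inl (hpos x hx).ne')).const_mul (-(2 / (c * α)))).congr_deriv ?_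
    rw [show -α - 1 = -1 - α by ring]
    field_simp
  have hcont : ContinuousOn (fun x : ℝ => ((d + c * x) / 2) ^ (-1 - α)) (uIcc 0 b) := by
    refine ContinuousOn.rpow_const (by fun_prop) fun x hx => Or.inl (hpos x hx).ne'
  rw [intervalIntegral.integral_eq_sub_of_hasDerivAt hder hcont.intervalIntegrable]
  have h1 : 0 ≤ 2 / (c * α) * ((d + c * b) / 2) ^ (-α) :=
    mul_nonneg (by positivity) (Real.rpow_nonneg (hpos b right_mem_uIcc).le _)
  simp only [mul_zero, add_zero]
  linarith

/-- Integrating the power `-1 - α` along the circle gains one power of `R - r` over the supremum.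
The constant is uniform in the centre and in the singular point; a rotation puts that point on the
positive axis. -/
theorem exists_integral_circle_rpow_le {R α : ℝ} (hR : 0 < R) (hα : 0 < α) :
    ∃ C, 0 ≤ C ∧ ∀ r, R / 2 ≤ r → r < R → ∀ t p : ℂ, R ≤ ‖p - t‖ →
      ∫ θ in (0 : ℝ)..2 * Real.pi, ‖circleMap t r θ - p‖ ^ (-1 - α) ≤ C * (R - r) ^ (-α) := by
  have hπ := Real.pi_pos
  refine ⟨4 / (R / Real.pi * α) * 2 ^ α, by positivity, fun r hr hrR t p hp => ?_⟩
  set D := ‖p - t‖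
  set w₀ := (p - t).arg
  set f : ℝ → ℝ := fun θ => ‖circleMap t r θ - p‖ ^ (-1 - α) with hf
  set g : ℝ → ℝ := fun φ => (((R - r) + R / Real.pi * |φ|) / 2) ^ (-1 - α) with hg
  have hd : 0 < R - r := by linarith
  have hper : Function.Periodic f (2 * Real.pi) := fun θ => by
    simp only [hf, (periodic_circleMap t r) θ]
  have hpol : ∀ φ, circleMap t r (φ + w₀) - p = Complex.exp (w₀ * Complex.I) * (circleMap 0 r φ - D) := by
    intro φ
    have : p = t + D * Complex.exp (w₀ * Complex.I) := by
      rw [Complex.norm_mul_exp_arg_mul_I]; ring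
    rw [this]
    simp only [circleMap, Complex.ofReal_add, add_mul, Complex.exp_add, zero_add]
    ring
  have hnorm : ∀ φ, f (φ + w₀) = ‖circleMap 0 r φ - D‖ ^ (-1 - α) := by
    intro φ
    simp only [hf, hpol, norm_mul, Complex.norm_exp_ofReal_mul_I, one_mul]
  have hgpos : ∀ φ : ℝ, 0 < ((R - r) + R / Real.pi * |φ|) / 2 := fun φ => by positivity
  have hgc : Continuous g := by
    refine Continuous.rpow_const (by fun_prop) fun φ => Or.inl (hgpos φ).ne'
  have hfc : Continuous fun φ => f (φ + w₀) := by
    have : (fun φ => f (φ + w₀)) = fun φ => ‖circleMap 0 r φ - D‖ ^ (-1 - α) := funext hnorm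
    rw [this]
    refine Continuous.rpow_const (by fun_prop) fun φ => Or.inl ?_
    have h1 : ‖circleMap 0 r φ‖ = r := by simp [abs_of_pos (by linarith : 0 < r)]
    have h2 := norm_sub_norm_le (D : ℂ) (circleMap 0 r φ)
    rw [h1, Complex.norm_real, Real.norm_of_nonneg (norm_nonneg _), norm_sub_rev (D : ℂ)] at h2
    linarith
  calc ∫ θ in (0 : ℝ)..2 * Real.pi, f θ = ∫ θ in (-Real.pi + w₀)..(-Real.pi + w₀) + 2 * Real.pi, f θ := by
        have := hper.intervalIntegral_add_eq 0 (-Real.pi + w₀)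
        simpa using this
    _ = ∫ φ in -Real.pi..Real.pi, f (φ + w₀) := by
        rw [intervalIntegral.integral_comp_add_right]
        congr 1; ring
    _ ≤ ∫ φ in -Real.pi..Real.pi, g φ := by
        refine intervalIntegral.integral_mono_on (by linarith) (hfc.intervalIntegrable _ _)
          (hgc.intervalIntegrable _ _) fun φ hφ => ?_
        rw [hnorm]
        exact Real.rpow_le_rpow_of_nonpos (hgpos φ)
          (le_norm_circleMap_sub hR hr hrR hp (abs_le.2 hφ)) (by linarith)
    _ = 2 * ∫ φ in (0 : ℝ)..Real.pi, g φ := by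
        rw [← intervalIntegral.integral_add_adjacent_intervals (hgc.intervalIntegrable (-Real.pi) 0)
          (hgc.intervalIntegrable 0 Real.pi)]
        have : ∫ φ in -Real.pi..0, g φ = ∫ φ in (0 : ℝ)..Real.pi, g φ := by
          have h := intervalIntegral.integral_comp_neg (a := 0) (b := Real.pi) g
          rw [neg_zero] at h
          rw [← h]
          simp only [hg, abs_neg]
        rw [this]; ring
    _ = 2 * ∫ φ in (0 : ℝ)..Real.pi, (((R - r) + R / Real.pi * φ) / 2) ^ (-1 - α) := by
        congr 1
        refine intervalIntegral.integral_congr fun φ hφ => ?_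
        rw [uIcc_of_le hπ.le] at hφ
        simp only [hg, abs_of_nonneg hφ.1]
    _ ≤ 2 * (2 / (R / Real.pi * α) * ((R - r) / 2) ^ (-α)) := by
        gcongr
        exact integral_rpow_neg_le hα (by positivity) hd hπ.le
    _ = 4 / (R / Real.pi * α) * 2 ^ α * (R - r) ^ (-α) := by
        rw [Real.div_rpow hd.le (by norm_num), Real.rpow_neg (by norm_num : (0 : ℝ) ≤ 2)]
        field_simp
        ring

/-- On the cut, `z = (1 + x) p` with `x ≥ 0`, and expanding `‖(p - t) + x p‖²` gives at least `‖p -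
t‖² ≥ R²`. So a disc of radius `R` that avoids `p` avoids the whole outward ray from `p`, and the
principal power of `1 - z / p` is analytic there. -/
theorem one_sub_div_mem_slitPlane {R : ℝ} {t p z : ℂ} (ht : ‖t‖ ≤ R) (hp : ‖p‖ = R) (hp0 : p ≠ 0)
    (hpt : R ≤ ‖p - t‖) (hz : ‖z - t‖ < R) : 1 - z / p ∈ Complex.slitPlane := by
  by_contra hcon
  rw [Complex.mem_slitPlane_iff_not_le_zero, not_not, Complex.le_def] at hcon
  obtain ⟨x, hx⟩ : ∃ x : ℝ, 1 - z / p = -(x : ℂ) := by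
    refine ⟨-(1 - z / p).re, ?_⟩
    apply Complex.ext <;> simp [hcon.2]
  have hx0 : 0 ≤ x := by
    have := hcon.1
    rw [hx] at this
    simpa using this
  have hz' : z - t = (p - t) + x * p := by
    have : z / p = 1 + x := by linear_combination -hx
    rw [div_eq_iff hp0] at this
    rw [this]; ring
  have hR : 0 ≤ R := (norm_nonneg _).trans ht
  have h1 : (t * (starRingEnd ℂ) p).re ≤ R * R := by
    refine (Complex.re_le_norm _).trans ?_
    rw [norm_mul, Complex.norm_conj, hp]
    gcongr
  have h2 : ‖z - t‖ ^ 2 = ‖p - t‖ ^ 2 + 2 * x * (R * R - (t * (starRingEnd ℂ) p).re) + x ^ 2 * R ^ 2 := by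
    rw [hz', ← hp, ← pow_two, ← Complex.normSq_eq_norm_sq, ← Complex.normSq_eq_norm_sq,
      ← Complex.normSq_eq_norm_sq]
    simp [Complex.normSq_apply]
    ring
  have h3 : ‖z - t‖ ^ 2 < R ^ 2 := by gcongr
  have h4 : R ^ 2 ≤ ‖p - t‖ ^ 2 := by gcongr
  nlinarith [mul_nonneg hx0 (sub_nonneg.2 h1), sq_nonneg (x * R)]

/-- Removing `L 0` cancels the pole at `y = 1 - t / p = 0`. What is left is `O(|y|^(β-1))` with
derivative `O(|y|^(β-2))`, and `β - 2 ≥ -1 - α` is the condition on `α`. The radius `δ` does not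
depend on `α`, and `δ ≤ ‖p‖` ensures `|y| ≤ 1`. -/
theorem exists_bound_deriv_cpow_div {L : ℂ → ℂ} (hL : AnalyticAt ℂ L 0) {β : ℝ} (hβ : 0 < β)
    {p : ℂ} (hp : p ≠ 0) :
    ∃ δ > 0, ∀ α, 1 - β ≤ α → ∃ C, 0 ≤ C ∧ ∀ t ∈ Metric.ball p δ, 1 - t / p ∈ Complex.slitPlane →
      AnalyticAt ℂ (fun t => (L ((1 - t / p) ^ (β : ℂ)) - L 0) / (1 - t / p)) t ∧
      ‖deriv (fun t => (L ((1 - t / p) ^ (β : ℂ)) - L 0) / (1 - t / p)) t‖ ≤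
        C * ‖t - p‖ ^ (-1 - α) := by
  obtain ⟨η, hη, hball⟩ := Metric.eventually_nhds_iff_ball.1 hL.eventually_analyticAt
  obtain ⟨C, hC⟩ : ∃ C, ∀ z ∈ Metric.closedBall (0 : ℂ) (η / 2), ‖deriv L z‖ ≤ C :=
    (isCompact_closedBall _ _).exists_bound_of_continuousOn fun z hz =>
      (hball z (Metric.closedBall_subset_ball (by linarith) hz)).deriv.continuousAt.continuousWithinAt
  have hC0 : 0 ≤ C := (norm_nonneg _).trans (hC 0 (by simp; linarith))
  have hLip : ∀ w ∈ Metric.closedBall (0 : ℂ) (η / 2), ‖L w - L 0‖ ≤ C * ‖w‖ := by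
    intro w hw
    have := (convex_closedBall (0 : ℂ) (η / 2)).norm_image_sub_le_of_norm_deriv_le (𝕜 := ℂ) (f := L)
      (fun z hz => (hball z (Metric.closedBall_subset_ball (by linarith) hz)).differentiableAt) hC
      (Metric.mem_closedBall_self (by linarith)) hw
    simpa using this
  have hpn : 0 < ‖p‖ := norm_pos_iff.2 hp
  have hy : ∀ t, ‖1 - t / p‖ = ‖t - p‖ / ‖p‖ := by
    intro t
    rw [← norm_div, ← norm_neg]
    congr 1
    field_simp
    ring
  have hlim : Tendsto (fun t : ℂ => ‖1 - t / p‖ ^ β) (𝓝 p) (𝓝 0) := by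
    have : ContinuousAt (fun t : ℂ => ‖1 - t / p‖ ^ β) p :=
      ContinuousAt.rpow_const (by fun_prop) (Or.inr hβ.le)
    simpa [ContinuousAt, hp, Real.zero_rpow hβ.ne'] using this
  obtain ⟨δ, hδ, hδball⟩ := Metric.eventually_nhds_iff_ball.1
    (hlim.eventually (gt_mem_nhds (show (0 : ℝ) < η / 2 by linarith)))
  refine ⟨min δ ‖p‖, lt_min hδ hpn, fun α hαβ =>
    ⟨C * (β + 1) / ‖p‖ * ‖p‖ ^ (1 + α), by positivity, ?_⟩⟩
  intro t ht hts
  have ht1 := hδball t (Metric.ball_subset_ball (min_le_left _ _) ht)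
  have ht2 : ‖1 - t / p‖ ≤ 1 := by
    rw [hy, div_le_one hpn]
    have := Metric.mem_ball.1 (Metric.ball_subset_ball (min_le_right _ _) ht)
    rw [dist_eq_norm] at this
    exact this.le
  set y := 1 - t / p with hydef
  have hy0 : y ≠ 0 := Complex.slitPlane_ne_zero hts
  have hyn : 0 < ‖y‖ := norm_pos_iff.2 hy0
  have hynorm : ∀ b : ℝ, ‖y ^ (b : ℂ)‖ = ‖y‖ ^ b := fun b => Complex.norm_cpow_real y b
  have hmem : y ^ (β : ℂ) ∈ Metric.closedBall (0 : ℂ) (η / 2) := by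
    rw [mem_closedBall_zero_iff, hynorm]; exact ht1.le
  have hLan := hball _ (Metric.closedBall_subset_ball (by linarith) hmem)
  have hyan : AnalyticAt ℂ (fun t => 1 - t / p) t := by
    exact analyticAt_const.sub (analyticAt_id.div analyticAt_const hp)
  have hpow : AnalyticAt ℂ (fun t => (1 - t / p) ^ (β : ℂ)) t :=
    hyan.cpow analyticAt_const hts
  constructor
  · exact ((AnalyticAt.fun_comp (g := L) (f := fun t => (1 - t / p) ^ (β : ℂ)) hLan hpow).sub analyticAt_const).div hyan hy0
  · have hyd : HasDerivAt (fun t => 1 - t / p) (-(1 / p)) t :=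
      ((hasDerivAt_id t).div_const p).const_sub 1
    have hpd : HasDerivAt (fun t => (1 - t / p) ^ (β : ℂ)) _ t := hyd.cpow_const hts
    have hLd := HasDerivAt.comp t (h₂ := L) (h := fun t => (1 - t / p) ^ (β : ℂ))
      hLan.differentiableAt.hasDerivAt hpd
    have hd : HasDerivAt (fun t => (L ((1 - t / p) ^ (β : ℂ)) - L 0) / (1 - t / p)) _ t :=
      (hLd.sub_const (L 0)).div hyd hy0
    rw [hd.deriv]
    simp only [← hydef, Function.comp_apply]
    have hb1 : ((β : ℂ) - 1) = ((β - 1 : ℝ) : ℂ) := by push_cast; ring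
    rw [hb1, norm_div, norm_pow, div_le_iff₀ (by positivity)]
    have e1 : ‖y‖ ^ (β - 1) * ‖y‖ = ‖y‖ ^ β := by
      rw [← Real.rpow_add_one hyn.ne']; congr 1; ring
    calc ‖deriv L (y ^ (β : ℂ)) * ((β : ℂ) * y ^ (((β - 1 : ℝ) : ℂ)) * -(1 / p)) * y -
          (L (y ^ (β : ℂ)) - L 0) * -(1 / p)‖
        ≤ ‖deriv L (y ^ (β : ℂ)) * ((β : ℂ) * y ^ (((β - 1 : ℝ) : ℂ)) * -(1 / p)) * y‖ +
          ‖(L (y ^ (β : ℂ)) - L 0) * -(1 / p)‖ := norm_sub_le _ _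
      _ = ‖deriv L (y ^ (β : ℂ))‖ * (β * (‖y‖ ^ (β - 1) * ‖y‖)) * ‖p‖⁻¹ +
          ‖L (y ^ (β : ℂ)) - L 0‖ * ‖p‖⁻¹ := by
        simp only [norm_mul, norm_neg, norm_div, norm_one, hynorm, Complex.norm_real,
          Real.norm_of_nonneg hβ.le]
        ring
      _ ≤ C * (β * ‖y‖ ^ β) * ‖p‖⁻¹ + C * ‖y‖ ^ β * ‖p‖⁻¹ := by
        rw [e1]
        gcongr
        · exact hC _ hmem
        · have := hLip _ hmem
          rwa [hynorm] at this
      _ = C * (β + 1) / ‖p‖ * ‖y‖ ^ β := by ring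
      _ ≤ C * (β + 1) / ‖p‖ * (‖y‖ ^ (-1 - α) * ‖y‖ ^ 2) := by
        rw [← Real.rpow_natCast, ← Real.rpow_add hyn]
        gcongr 1
        exact Real.rpow_le_rpow_of_exponent_ge hyn ht2 (by push_cast; linarith)
      _ = C * (β + 1) / ‖p‖ * ‖p‖ ^ (1 + α) * ‖t - p‖ ^ (-1 - α) * ‖y‖ ^ 2 := by
        have : ‖y‖ ^ (-1 - α) = ‖p‖ ^ (1 + α) * ‖t - p‖ ^ (-1 - α) := by
          rw [hydef, hy, Real.div_rpow (norm_nonneg _) (norm_nonneg _),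
            show -1 - α = -(1 + α) by ring, Real.rpow_neg (norm_nonneg p), div_inv_eq_mul, mul_comm]
        rw [this]; ring

/-- The set of points that are not on a radial ray going outwards from a point of `P`. -/
def raySlit (P : Finset ℂ) : Set ℂ := {z | ∀ p ∈ P, 1 - z / p ∈ Complex.slitPlane}

/-- The hypothesis is on `deriv F`, because the mean value gains a full power only for exponents
below `-1`. From `F` itself, of size `|z - p|^(-α)` with `α < 1`, the mean would be merely bounded
and the factor `k^(α-1)` in `Γ(α + k)` would be lost. -/
theorem exists_cauchy_bound {R α C₀ : ℝ} (hR : 0 < R) (hα : 0 < α) (hC₀ : 0 ≤ C₀) (P : Finset ℂ) :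
    ∃ C, ∀ (F : ℂ → ℂ) (t : ℂ), (∀ p ∈ P, R ≤ ‖p - t‖) →
      AnalyticOnNhd ℂ F (Metric.ball t R) →
      (∀ z ∈ Metric.ball t R, ‖deriv F z‖ ≤ C₀ * (1 + ∑ p ∈ P, ‖z - p‖ ^ (-1 - α))) →
      ∀ k : ℕ, ‖iteratedDeriv (k + 1) F t‖ ≤ C * (k.factorial * (k + 1 : ℝ) ^ α * R⁻¹ ^ k) := by
  obtain ⟨C₁, hC₁, hint⟩ := exists_integral_circle_rpow_le hR hα
  have hπ := Real.pi_pos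
  refine ⟨(2 * Real.pi)⁻¹ * (C₀ * (2 * Real.pi + P.card * (C₁ * (2 / R) ^ α))) * 2, ?_⟩
  intro F t hPt hF hb k
  -- With this radius `(R - r)^(-α)` is a constant times `(k + 1)^α`, while `r^(-k)` exceeds
  -- `R^(-k)` by at most a factor `2`.
  set r := R * (1 - 1 / (2 * (k + 1))) with hr
  have hk : (0 : ℝ) < k + 1 := by positivity
  have hRr : R - r = R / (2 * (k + 1)) := by rw [hr]; field_simp; ring
  have hrR : r < R := by
    have : 0 < R / (2 * (k + 1)) := by positivity
    linarith
  have hr2 : R / 2 ≤ r := by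
    have : R / (2 * (k + 1)) ≤ R / 2 := by
      gcongr
      have : (0 : ℝ) ≤ k := Nat.cast_nonneg k
      linarith
    linarith
  have hr0 : 0 < r := by linarith
  have hcl : Metric.closedBall t r ⊆ Metric.ball t R := Metric.closedBall_subset_ball hrR
  have hdF : AnalyticOnNhd ℂ (deriv F) (Metric.ball t R) := hF.deriv
  have hcm : ∀ θ, circleMap t r θ ∈ Metric.ball t R := fun θ =>
    hcl (circleMap_mem_closedBall t hr0.le θ)
  have hdist : ∀ p ∈ P, ∀ θ, 0 < ‖circleMap t r θ - p‖ := by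
    intro p hp θ
    have h1 := norm_sub_le_norm_sub_add_norm_sub t (circleMap t r θ) p
    have h2 : ‖circleMap t r θ - t‖ = r := by simp [abs_of_pos hr0]
    have h3 := hPt p hp
    rw [norm_sub_rev t p, norm_sub_rev t] at h1
    linarith
  have hwc : ∀ p ∈ P, Continuous fun θ => ‖circleMap t r θ - p‖ ^ (-1 - α) := fun p hp =>
    Continuous.rpow_const (by fun_prop) fun θ => Or.inl (hdist p hp θ).ne'
  rw [iteratedDeriv_succ']
  have hdc : DiffContOnCl ℂ (deriv F) (Metric.ball t r) :=
    (hdF.differentiableOn.mono hcl).diffContOnCl_ball (subset_refl _)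
  refine (norm_iteratedDeriv_le_circle_mean hr0 hdc k).trans ?_
  have hI : ∫ θ : ℝ in 0..2 * Real.pi, ‖deriv F (circleMap t r θ)‖ ≤
      C₀ * (2 * Real.pi + P.card * (C₁ * (2 / R) ^ α)) * (k + 1 : ℝ) ^ α := by
    have hk1 : 1 ≤ (k + 1 : ℝ) ^ α := Real.one_le_rpow (by
      have : (0 : ℝ) ≤ k := Nat.cast_nonneg k
      linarith) hα.le
    calc ∫ θ : ℝ in 0..2 * Real.pi, ‖deriv F (circleMap t r θ)‖
        ≤ ∫ θ : ℝ in 0..2 * Real.pi, C₀ * (1 + ∑ p ∈ P, ‖circleMap t r θ - p‖ ^ (-1 - α)) := by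
          refine intervalIntegral.integral_mono_on (by positivity) ?_ ?_ fun θ _ => hb _ (hcm θ)
          · refine Continuous.intervalIntegrable ?_ _ _
            refine Continuous.norm ?_
            exact hdF.continuousOn.comp_continuous (continuous_circleMap t r) hcm
          · refine Continuous.intervalIntegrable ?_ _ _
            exact continuous_const.mul (continuous_const.add (continuous_finsetSum _ hwc))
      _ = C₀ * (2 * Real.pi + ∑ p ∈ P, ∫ θ : ℝ in 0..2 * Real.pi,
            ‖circleMap t r θ - p‖ ^ (-1 - α)) := by
          rw [intervalIntegral.integral_const_mul, intervalIntegral.integral_add (by simp)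
            (Continuous.intervalIntegrable (continuous_finsetSum _ hwc) _ _),
            intervalIntegral.integral_finsetSum fun p hp => (hwc p hp).intervalIntegrable _ _]
          simp
      _ ≤ C₀ * (2 * Real.pi + ∑ p ∈ P, C₁ * (R - r) ^ (-α)) := by
          gcongr with p hp
          exact hint r hr2 hrR t p (hPt p hp)
      _ = C₀ * (2 * Real.pi + P.card * (C₁ * (2 / R) ^ α) * (k + 1 : ℝ) ^ α) := by
          have : (R - r) ^ (-α) = (2 / R) ^ α * (k + 1 : ℝ) ^ α := by
            rw [← Real.mul_rpow (by positivity) hk.le, hRr, Real.rpow_neg (by positivity),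
              ← Real.inv_rpow (by positivity)]
            congr 1
            field_simp
          rw [this, Finset.sum_const, nsmul_eq_mul]
          ring
      _ ≤ C₀ * (2 * Real.pi * (k + 1 : ℝ) ^ α + P.card * (C₁ * (2 / R) ^ α) * (k + 1 : ℝ) ^ α) := by
          refine mul_le_mul_of_nonneg_left (add_le_add_left ?_ _) hC₀
          exact le_mul_of_one_le_right (by positivity) hk1
      _ = _ := by ring
  have hrk : r⁻¹ ^ k ≤ 2 * R⁻¹ ^ k := by
    -- Bernoulli's inequality.
    have hb : (1 : ℝ) / 2 ≤ (1 - 1 / (2 * (k + 1))) ^ k := by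
      have h0 : (0 : ℝ) ≤ k := Nat.cast_nonneg k
      have h1 : 1 / (2 * (k + 1) : ℝ) ≤ 1 := by
        rw [div_le_one (by positivity)]; linarith
      have := one_add_mul_le_pow (a := -(1 / (2 * (k + 1) : ℝ))) (by linarith) k
      rw [← sub_eq_add_neg] at this
      refine le_trans ?_ this
      have : (k : ℝ) * (1 / (2 * (k + 1))) ≤ 1 / 2 := by
        rw [mul_one_div, div_le_div_iff₀ (by positivity) (by norm_num)]
        linarith
      linarith
    rw [hr, mul_inv, mul_pow, mul_comm]
    gcongr
    rw [inv_pow, inv_le_comm₀ (by positivity) (by norm_num)]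
    linarith
  have hint0 : 0 ≤ ∫ θ : ℝ in 0..2 * Real.pi, ‖deriv F (circleMap t r θ)‖ :=
    intervalIntegral.integral_nonneg (by positivity) fun _ _ => norm_nonneg _
  calc (k.factorial : ℝ) * ((2 * Real.pi)⁻¹ * (∫ θ : ℝ in 0..2 * Real.pi,
        ‖deriv F (circleMap t r θ)‖) * r⁻¹ ^ k)
      ≤ k.factorial * ((2 * Real.pi)⁻¹ * (C₀ * (2 * Real.pi + P.card * (C₁ * (2 / R) ^ α)) *
        (k + 1 : ℝ) ^ α) * (2 * R⁻¹ ^ k)) := by gcongr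
    _ = _ := by ring

/-- The choice `c p = -p L(0)` makes `c p / (z - p)` equal to `L(0) / (1 - z / p)`, so subtracting
it leaves the function of `exists_bound_deriv_cpow_div` minus the other poles, which are analytic
near `p`. The extension lives on the ball minus the outward rays. -/
theorem exists_local_extension {h : ℂ → ℂ} {c : ℂ → ℂ} {β : ℂ → ℝ} {R : ℝ} (hR : 0 < R)
    {P : Finset ℂ} (hP : ∀ p ∈ P, ‖p‖ = R) (hh : AnalyticOnNhd ℂ h (Metric.ball 0 R))
    (hreg : ∀ p : ℂ, ‖p‖ = R → p ∉ P →
      ∃ f : ℂ → ℂ, AnalyticAt ℂ f p ∧ ∀ᶠ t in 𝓝[Metric.ball 0 R] p, h t = f t)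
    (hβ : ∀ p ∈ P, 0 < β p)
    (hsing : ∀ p ∈ P, ∃ L : ℂ → ℂ, AnalyticAt ℂ L 0 ∧ c p = -p * L 0 ∧
      ∀ᶠ t in 𝓝[Metric.ball 0 R] p, h t = L ((1 - t / p) ^ (β p : ℂ)) / (1 - t / p))
    {x : ℂ} (hx : x ∈ Metric.closedBall 0 R) :
    ∃ δ > 0, ∃ g : ℂ → ℂ,
      EqOn g (fun z => h z - ∑ p ∈ P, c p / (z - p)) (Metric.ball x δ ∩ Metric.ball 0 R) ∧
      ∀ α, (∀ p ∈ P, 1 - β p ≤ α) → ∃ C, 0 ≤ C ∧ ∀ z ∈ Metric.ball x δ, z ∈ raySlit P → AnalyticAt ℂ g z ∧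
        ‖deriv g z‖ ≤ C * (1 + ∑ p ∈ P, ‖z - p‖ ^ (-1 - α)) := by
  classical
  have hP0 : ∀ p ∈ P, p ≠ 0 := fun p hp h0 => by
    have := hP p hp
    rw [h0, norm_zero] at this
    exact hR.ne this
  have hsum0 : ∀ (α : ℝ) (z : ℂ), 0 ≤ ∑ p ∈ P, ‖z - p‖ ^ (-1 - α) := fun α z =>
    Finset.sum_nonneg fun p _ => Real.rpow_nonneg (norm_nonneg _) _
  have hbdd : ∀ {g : ℂ → ℂ} {y : ℂ}, AnalyticAt ℂ g y →
      ∃ δ > 0, ∃ C, 0 ≤ C ∧ ∀ z ∈ Metric.ball y δ, AnalyticAt ℂ g z ∧ ‖deriv g z‖ ≤ C := by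
    intro g y hg
    have h1 : ∀ᶠ z in 𝓝 y, ‖deriv g z‖ < ‖deriv g y‖ + 1 :=
      hg.deriv.continuousAt.norm.eventually (gt_mem_nhds (by linarith))
    obtain ⟨δ, hδ, hb⟩ := Metric.eventually_nhds_iff_ball.1 (hg.eventually_analyticAt.and h1)
    exact ⟨δ, hδ, ‖deriv g y‖ + 1, by positivity, fun z hz => ⟨(hb z hz).1, (hb z hz).2.le⟩⟩
  have hsumana : ∀ Q ⊆ P, ∀ y, (∀ p ∈ Q, y ≠ p) →
      AnalyticAt ℂ (fun z => ∑ p ∈ Q, c p / (z - p)) y := by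
    intro Q _ y hy
    refine Finset.analyticAt_fun_sum _ fun p hp => ?_
    exact analyticAt_const.div (analyticAt_id.sub analyticAt_const) (sub_ne_zero.2 (hy p hp))
  by_cases hxP : x ∈ P
  · obtain ⟨L, hL, hc, hev⟩ := hsing x hxP
    have hx0 := hP0 x hxP
    obtain ⟨δ₁, hδ₁, hH⟩ := exists_bound_deriv_cpow_div hL (hβ x hxP) hx0
    have hrest := hsumana (P.erase x) (Finset.erase_subset _ _) x
      fun p hp => (Finset.ne_of_mem_erase hp).symm
    obtain ⟨δ₂, hδ₂, C₂, hC₂, hrest⟩ := hbdd hrest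
    obtain ⟨δ₃, hδ₃, hev⟩ := Metric.mem_nhdsWithin_iff.1 hev
    set H : ℂ → ℂ := fun t => (L ((1 - t / x) ^ (β x : ℂ)) - L 0) / (1 - t / x) with hHdef
    refine ⟨min δ₁ (min δ₂ δ₃), by positivity,
      H - fun z => ∑ p ∈ P.erase x, c p / (z - p), ?_, fun α hα => ?_⟩
    · rintro z ⟨hz, hzR⟩
      have hz3 : h z = _ := hev ⟨Metric.ball_subset_ball
        ((min_le_right _ _).trans (min_le_right _ _)) hz, hzR⟩
      have hzx : z ≠ x := by
        rintro rfl
        rw [mem_ball_zero_iff, hP z hxP] at hzR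
        exact lt_irrefl _ hzR
      simp only [Pi.sub_apply]
      rw [hz3, ← Finset.add_sum_erase P _ hxP, hHdef, hc]
      have h1 : x - z ≠ 0 := sub_ne_zero.2 hzx.symm
      have h2 : z - x ≠ 0 := sub_ne_zero.2 hzx
      have h3 : 1 - z / x = (x - z) / x := by field_simp
      have h4 : -x * L 0 / (z - x) = L 0 / ((x - z) / x) := by
        rw [← neg_sub x z]; field_simp
      simp only [h3, h4]
      ring
    · obtain ⟨C₁, hC₁, hH⟩ := hH α (hα x hxP)
      refine ⟨C₁ + C₂, by positivity, fun z hz hzs => ?_⟩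
      have hz1 := hH z (Metric.ball_subset_ball (min_le_left _ _) hz) (hzs x hxP)
      have hz2 := hrest z (Metric.ball_subset_ball
        ((min_le_right _ _).trans (min_le_left _ _)) hz)
      refine ⟨hz1.1.sub hz2.1, ?_⟩
      rw [(hz1.1.differentiableAt.hasDerivAt.sub hz2.1.differentiableAt.hasDerivAt).deriv]
      refine (norm_sub_le _ _).trans ?_
      have h5 : ‖z - x‖ ^ (-1 - α) ≤ ∑ p ∈ P, ‖z - p‖ ^ (-1 - α) :=
        Finset.single_le_sum (f := fun p => ‖z - p‖ ^ (-1 - α))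
          (fun p _ => Real.rpow_nonneg (norm_nonneg _) _) hxP
      have h6 := hsum0 α z
      have h7 := mul_le_mul_of_nonneg_left h5 hC₁
      nlinarith [hz1.2, hz2.2]
  · obtain ⟨f, hf, hfh⟩ : ∃ f : ℂ → ℂ, AnalyticAt ℂ f x ∧
        ∀ᶠ t in 𝓝[Metric.ball 0 R] x, h t = f t := by
      rcases (mem_closedBall_zero_iff.1 hx).lt_or_eq with hlt | heq
      · exact ⟨h, hh x (mem_ball_zero_iff.2 hlt), Eventually.of_forall fun _ => rfl⟩
      · exact hreg x heq hxP
    have hsum := hsumana P (subset_refl _) x fun p hp h => hxP (h ▸ hp)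
    obtain ⟨δ₁, hδ₁, C, hC, hb⟩ := hbdd (hf.sub hsum)
    obtain ⟨δ₂, hδ₂, hev⟩ := Metric.mem_nhdsWithin_iff.1 hfh
    refine ⟨min δ₁ δ₂, by positivity, f - fun z => ∑ p ∈ P, c p / (z - p), ?_,
      fun α _ => ⟨C, hC, ?_⟩⟩
    · rintro z ⟨hz, hzR⟩
      have : h z = f z := hev ⟨Metric.ball_subset_ball (min_le_right _ _) hz, hzR⟩
      simp [this]
    · intro z hz _
      have := hb z (Metric.ball_subset_ball (min_le_left _ _) hz)
      refine ⟨this.1, this.2.trans ?_⟩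
      have := hsum0 α z
      nlinarith

/-- For `t` near `0` the disc of radius `R` about `t` sticks out of `ball 0 R` by less than a
Lebesgue number of the cover by local extensions. They glue to a function on the whole disc, to
which the Cauchy bound applies. The number `ε` precedes `α`, so that one interval can serve all
exponents. -/
theorem exists_iteratedDeriv_bound {h : ℂ → ℂ} {c : ℂ → ℂ} {β : ℂ → ℝ} {R : ℝ} (hR : 0 < R)
    {P : Finset ℂ} (hP : ∀ p ∈ P, ‖p‖ = R) (hh : AnalyticOnNhd ℂ h (Metric.ball 0 R))
    (hreg : ∀ p : ℂ, ‖p‖ = R → p ∉ P →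
      ∃ f : ℂ → ℂ, AnalyticAt ℂ f p ∧ ∀ᶠ t in 𝓝[Metric.ball 0 R] p, h t = f t)
    (hβ : ∀ p ∈ P, 0 < β p)
    (hsing : ∀ p ∈ P, ∃ L : ℂ → ℂ, AnalyticAt ℂ L 0 ∧ c p = -p * L 0 ∧
      ∀ᶠ t in 𝓝[Metric.ball 0 R] p, h t = L ((1 - t / p) ^ (β p : ℂ)) / (1 - t / p)) :
    ∃ ε > 0, ∀ α, 0 < α → (∀ p ∈ P, 1 - β p ≤ α) → ∃ C, ∀ t : ℂ, ‖t‖ < ε → (∀ p ∈ P, R ≤ ‖p - t‖) → ∀ k : ℕ,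
      ‖iteratedDeriv (k + 1) (fun z => h z - ∑ p ∈ P, c p / (z - p)) t‖ ≤
        C * (k.factorial * (k + 1 : ℝ) ^ α * R⁻¹ ^ k) := by
  have hP0 : ∀ p ∈ P, p ≠ 0 := fun p hp h0 => by
    have := hP p hp
    rw [h0, norm_zero] at this
    exact hR.ne this
  set h₂ : ℂ → ℂ := fun z => h z - ∑ p ∈ P, c p / (z - p) with hh₂
  choose! δ hδ g hgh hg using
    fun x hx => exists_local_extension hR hP hh hreg hβ hsing (x := x) hx
  have hK : IsCompact (Metric.closedBall (0 : ℂ) R) := isCompact_closedBall _ _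
  obtain ⟨T, hT, hcover⟩ := hK.elim_nhds_subcover (fun x => Metric.ball x (δ x))
    fun x hx => Metric.ball_mem_nhds x (hδ x hx)
  obtain ⟨ε, hε, hleb⟩ := lebesgue_number_lemma_of_metric hK
    (c := fun x : T => Metric.ball (x : ℂ) (δ x)) (fun _ => Metric.isOpen_ball)
    (fun x hx => by
      obtain ⟨y, hy, hxy⟩ := mem_iUnion₂.1 (hcover hx)
      exact mem_iUnion.2 ⟨⟨y, hy⟩, hxy⟩)
  have : Nonempty T := ⟨(hleb 0 (Metric.mem_closedBall_self hR.le)).choose⟩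
  choose! i hi using hleb
  refine ⟨min ε R, lt_min hε hR, fun α hα hαβ => ?_⟩
  choose! C hC hg using fun x hx => hg x hx α hαβ
  set C₀ := ∑ x ∈ T, C x
  have hCle : ∀ x ∈ T, C x ≤ C₀ := fun x hx =>
    Finset.single_le_sum (fun y hy => hC y (hT y hy)) hx
  have hC₀ : 0 ≤ C₀ := Finset.sum_nonneg fun y hy => hC y (hT y hy)
  obtain ⟨C', hC'⟩ := exists_cauchy_bound hR hα hC₀ P
  refine ⟨C', fun t ht hPt k => ?_⟩
  have htε : ‖t‖ < ε := ht.trans_le (min_le_left _ _)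
  have htR : ‖t‖ < R := ht.trans_le (min_le_right _ _)
  set E := Metric.ball t R
  -- The lens common to both discs; it contains the disc about `t / 2` of radius `R - ‖t‖ / 2`.
  set D := Metric.ball (0 : ℂ) R ∩ E
  have hDo : IsOpen D := Metric.isOpen_ball.inter Metric.isOpen_ball
  have hES : E ⊆ raySlit P := fun z hz p hp =>
    one_sub_div_mem_slitPlane htR.le (hP p hp) (hP0 p hp) (hPt p hp) (mem_ball_iff_norm.1 hz)
  have hcl : closure D ⊆ Metric.closedBall 0 R :=
    (closure_mono inter_subset_left).trans Metric.closure_ball_subset_closedBall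
  obtain ⟨F, hFg, hFD, hFan⟩ := exists_glue (D := D) (E := E) hDo
    ((convex_ball _ _).inter (convex_ball _ _)) inter_subset_right Metric.isOpen_ball
    (convex_ball _ _) (f := h₂) (δ := fun _ => ε) (g := fun x => g (i x)) (fun _ _ => hε)
    (fun x hx z hz => (hg _ (hT _ (i x).2) z (hi x (hcl hx) hz.1) (hES hz.2)).1)
    (fun x hx z hz => hgh _ (hT _ (i x).2) ⟨hi x (hcl hx) hz.1, hz.2.1⟩)
  have hcov : ∀ z ∈ E, ∃ x ∈ closure D, z ∈ Metric.ball x ε := by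
    intro z hz
    have ht0 := norm_nonneg t
    have hz2 : ‖z - t / 2‖ < R + ‖t‖ / 2 := by
      have h1 : z - t / 2 = (z - t) + t / 2 := by ring
      have h2 : ‖t / 2‖ = ‖t‖ / 2 := by simp
      rw [h1, ← h2]
      exact (norm_add_le _ _).trans_lt (by gcongr; exact mem_ball_iff_norm.1 hz)
    have hpos : 0 < R + ‖t‖ / 2 := by positivity
    -- Contraction towards `t / 2` by `l` maps the disc of radius `R + ‖t‖ / 2` about `t / 2`, which
    -- contains `E`, onto the one of radius `R - ‖t‖ / 2` inside the lens. No point of `E` moves by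
    -- more than `‖t‖ < ε`.
    set l := (R - ‖t‖ / 2) / (R + ‖t‖ / 2) with hl
    have hl0 : 0 < l := div_pos (by linarith) hpos
    have hl1 : l ≤ 1 := by rw [hl, div_le_one hpos]; linarith
    have hlm : l * (R + ‖t‖ / 2) = R - ‖t‖ / 2 := div_mul_cancel₀ _ hpos.ne'
    have hnl : ‖(l : ℂ) * (z - t / 2)‖ < R - ‖t‖ / 2 := by
      rw [norm_mul, Complex.norm_real, Real.norm_of_nonneg hl0.le, ← hlm]
      exact mul_lt_mul_of_pos_left hz2 hl0
    have h2 : ‖t / 2‖ = ‖t‖ / 2 := by simp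
    refine ⟨t / 2 + l * (z - t / 2), subset_closure ⟨?_, ?_⟩, ?_⟩
    · rw [mem_ball_zero_iff]
      refine (norm_add_le _ _).trans_lt ?_
      rw [h2]; linarith
    · rw [mem_ball_iff_norm]
      have : t / 2 + l * (z - t / 2) - t = l * (z - t / 2) - t / 2 := by ring
      rw [this]
      refine (norm_sub_le _ _).trans_lt ?_
      rw [h2]; linarith
    · rw [mem_ball_iff_norm]
      have : z - (t / 2 + l * (z - t / 2)) = ((1 - l : ℝ) : ℂ) * (z - t / 2) := by
        push_cast; ring
      rw [this, norm_mul, Complex.norm_real, Real.norm_of_nonneg (by linarith)]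
      have : (1 - l) * ‖z - t / 2‖ ≤ (1 - l) * (R + ‖t‖ / 2) :=
        mul_le_mul_of_nonneg_left hz2.le (by linarith)
      linarith
  have hFanE : AnalyticOnNhd ℂ F E := fun z hz => by
    obtain ⟨x, hx, hzx⟩ := hcov z hz
    exact hFan z ⟨hz, mem_iUnion₂.2 ⟨x, hx, hzx⟩⟩
  have htD : t ∈ D := ⟨mem_ball_zero_iff.2 htR, Metric.mem_ball_self hR⟩
  have heq : h₂ =ᶠ[𝓝 t] F := by
    filter_upwards [hDo.mem_nhds htD] with z hz using (hFD hz).symm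
  rw [heq.iteratedDeriv_eq]
  refine hC' F t hPt hFanE (fun z hz => ?_) k
  obtain ⟨x, hx, hzx⟩ := hcov z hz
  have hFz : F =ᶠ[𝓝 z] g (i x) := by
    filter_upwards [(Metric.isOpen_ball.inter Metric.isOpen_ball).mem_nhds ⟨hzx, hz⟩] with y hy
      using hFg x hx hy
  rw [hFz.deriv_eq]
  refine ((hg _ (hT _ (i x).2) z (hi x (hcl hx) hzx) (hES hz)).2).trans ?_
  have : 0 ≤ ∑ p ∈ P, ‖z - p‖ ^ (-1 - α) :=
    Finset.sum_nonneg fun p _ => Real.rpow_nonneg (norm_nonneg _) _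
  gcongr
  exact hCle _ (i x).2

/-! ### Inverting the natural time on the disc of radius `R`, and boundary values of the inverse. -/

/-- `φ` is a holomorphic right inverse of `τ` on `D` with values in `U₀`. -/
structure IsLift (U₀ : Set ℂ) (τ φ : ℂ → ℂ) (D : Set ℂ) : Prop where
  analytic : AnalyticOnNhd ℂ φ D
  mem : ∀ t ∈ D, φ t ∈ U₀
  right_inv : ∀ t ∈ D, τ (φ t) = t

theorem IsLift.mono {U₀ D D' : Set ℂ} {τ φ : ℂ → ℂ} (h : IsLift U₀ τ φ D) (hD : D' ⊆ D) :
    IsLift U₀ τ φ D' :=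
  ⟨h.analytic.mono hD, fun t ht => h.mem t (hD ht), fun t ht => h.right_inv t (hD ht)⟩

section Lift

variable {U₀ : Set ℂ} {τ φ : ℂ → ℂ}

theorem IsLift.deriv_eq {D : Set ℂ} (hU : AnalyticOnNhd ℂ τ U₀) (h : IsLift U₀ τ φ D)
    (hD : IsOpen D) {t : ℂ} (ht : t ∈ D) :
    deriv φ t = (deriv τ (φ t))⁻¹ := by
  have h1 := (hU _ (h.mem t ht)).differentiableAt.hasDerivAt.comp t
    (h.analytic t ht).differentiableAt.hasDerivAt
  have h2 : τ ∘ φ =ᶠ[𝓝 t] id := by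
    filter_upwards [hD.mem_nhds ht] with x hx using h.right_inv x hx
  have h3 := h1.unique ((hasDerivAt_id t).congr_of_eventuallyEq h2)
  exact eq_inv_of_mul_eq_one_right h3

theorem exists_lift_nhds (hUo : IsOpen U₀) (hU : AnalyticOnNhd ℂ τ U₀) {s : ℂ} (hs : s ∈ U₀)
    (hτ' : deriv τ s ≠ 0) :
    ∃ (ψ : ℂ → ℂ) (δ : ℝ), 0 < δ ∧ IsLift U₀ τ ψ (Metric.ball (τ s) δ) ∧ ψ (τ s) = s ∧
      ∀ᶠ x in 𝓝 s, ψ (τ x) = x := by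
  obtain ⟨ψ, hψ, hψs, h1, h2⟩ := exists_analytic_inverse (hU s hs) hτ'
  have h3 : ∀ᶠ t in 𝓝 (τ s), ψ t ∈ U₀ :=
    hψ.continuousAt.eventually (by rw [hψs]; exact hUo.mem_nhds hs)
  obtain ⟨δ, hδ, hb⟩ := Metric.eventually_nhds_iff_ball.1
    (hψ.eventually_analyticAt.and (h1.and h3))
  exact ⟨ψ, δ, hδ, ⟨fun t ht => (hb t ht).1, fun t ht => (hb t ht).2.2,
    fun t ht => (hb t ht).2.1⟩, hψs, h2⟩

/-- A cluster value `s ∈ U₀` satisfies `τ s = p` by continuity, so the local inverse at `s` is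
defined near `p`. It agrees with `φ` at points where `φ` is close to `s`, hence on the convex set
`ball p δ ∩ D`. -/
theorem IsLift.exists_extension {D : Set ℂ} (hUo : IsOpen U₀) (hU : AnalyticOnNhd ℂ τ U₀)
    (hτ' : ∀ s ∈ U₀, deriv τ s ≠ 0) (h : IsLift U₀ τ φ D) (hD : IsOpen D) (hDc : Convex ℝ D)
    {p s : ℂ} (hs : s ∈ U₀) (hps : MapClusterPt s (𝓝[D] p) φ) :
    ∃ (ψ : ℂ → ℂ) (δ : ℝ), 0 < δ ∧ IsLift U₀ τ ψ (Metric.ball p δ) ∧ ψ p = s ∧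
      EqOn φ ψ (Metric.ball p δ ∩ D) := by
  have hτs : τ s = p := by
    have h1 : MapClusterPt (τ s) (𝓝[D] p) (τ ∘ φ) := hps.continuousAt_comp (hU s hs).continuousAt
    have h2 : Tendsto (τ ∘ φ) (𝓝[D] p) (𝓝 p) := by
      refine Tendsto.congr' (f₁ := id) ?_ (tendsto_id.mono_left nhdsWithin_le_nhds)
      filter_upwards [self_mem_nhdsWithin] with t ht using (h.right_inv t ht).symm
    have h3 : ClusterPt (τ s) (𝓝 p) := ClusterPt.mono h1 h2
    exact eq_of_nhds_neBot h3
  obtain ⟨ψ, δ, hδ, hψ, hψs, hleft⟩ := exists_lift_nhds hUo hU hs (hτ' s hs)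
  rw [hτs] at hψ hψs
  refine ⟨ψ, δ, hδ, hψ, hψs, ?_⟩
  have h1 : ∃ᶠ t in 𝓝[D] p, ∀ᶠ x in 𝓝 (φ t), ψ (τ x) = x :=
    hps.frequently hleft.eventually_nhds
  have h2 : ∀ᶠ t in 𝓝[D] p, t ∈ Metric.ball p δ ∧ t ∈ D := by
    filter_upwards [self_mem_nhdsWithin, mem_nhdsWithin_of_mem_nhds (Metric.ball_mem_nhds p hδ)]
      with t ht htb using ⟨htb, ht⟩
  obtain ⟨t, ht, htb, htD⟩ := (h1.and_eventually h2).exists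
  refine (h.analytic.mono inter_subset_right).eqOn_of_preconnected_of_eventuallyEq
    (hψ.analytic.mono inter_subset_left) ((convex_ball p δ).inter hDc).isPreconnected
    (z₀ := t) ⟨htb, htD⟩ ?_
  filter_upwards [(h.analytic t htD).continuousAt.eventually ht, hD.mem_nhds htD] with x hx hxD
  rw [h.right_inv x hxD] at hx
  exact hx.symm

theorem IsLift.eqOn {D : Set ℂ} {φ' : ℂ → ℂ} (hUo : IsOpen U₀) (hU : AnalyticOnNhd ℂ τ U₀)
    (hτ' : ∀ s ∈ U₀, deriv τ s ≠ 0) (h : IsLift U₀ τ φ D) (h' : IsLift U₀ τ φ' D)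
    (hD : IsOpen D) (hDc : IsPreconnected D) {t : ℂ} (ht : t ∈ D) (heq : φ t = φ' t) :
    EqOn φ φ' D := by
  obtain ⟨ψ, δ, hδ, hψ, hψs, hleft⟩ := exists_lift_nhds hUo hU (h.mem t ht) (hτ' _ (h.mem t ht))
  refine h.analytic.eqOn_of_preconnected_of_eventuallyEq h'.analytic hDc ht ?_
  have h1 := (h.analytic t ht).continuousAt.eventually hleft
  have h2 := (h'.analytic t ht).continuousAt.eventually (heq ▸ hleft)
  filter_upwards [h1, h2, hD.mem_nhds ht] with x hx1 hx2 hx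
  rw [h.right_inv x hx] at hx1
  rw [h'.right_inv x hx] at hx2
  rw [← hx1, hx2]

variable {a : ℝ}

theorem isOpen_sublevel (hUo : IsOpen U₀) (hU : AnalyticOnNhd ℂ τ U₀) (r : ℝ) :
    IsOpen (sublevel U₀ τ a r) := by
  refine IsOpen.connectedComponentIn ?_
  have : {s ∈ U₀ | ‖τ s - τ a‖ < r} = U₀ ∩ (fun s => ‖τ s - τ a‖) ⁻¹' Iio r := rfl
  rw [this]
  exact (hU.continuousOn.sub continuousOn_const).norm.isOpen_inter_preimage hUo isOpen_Iio

theorem sublevel_subset (r : ℝ) : sublevel U₀ τ a r ⊆ {s ∈ U₀ | ‖τ s - τ a‖ < r} :=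
  connectedComponentIn_subset _ _

theorem sublevel_mono {r r' : ℝ} (h : r ≤ r') : sublevel U₀ τ a r ⊆ sublevel U₀ τ a r' :=
  connectedComponentIn_mono _ fun _ hs => ⟨hs.1, hs.2.trans_le h⟩

theorem IsLift.mem_sublevel {r : ℝ} (hr : 0 < r) (h : IsLift U₀ τ φ (Metric.ball 0 r))
    (h0 : φ 0 = a) (ha : τ a = 0) {t : ℂ} (ht : t ∈ Metric.ball 0 r) : φ t ∈ sublevel U₀ τ a r := by
  have hpc : IsPreconnected (φ '' Metric.ball 0 r) :=
    (convex_ball (0 : ℂ) r).isPreconnected.image _ h.analytic.continuousOn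
  refine hpc.subset_connectedComponentIn ⟨0, Metric.mem_ball_self hr, h0⟩ ?_ (mem_image_of_mem _ ht)
  rintro _ ⟨x, hx, rfl⟩
  refine ⟨h.mem x hx, ?_⟩
  rw [h.right_inv x hx, ha, sub_zero]
  exact mem_ball_zero_iff.1 hx

theorem exists_lift_ball (hUo : IsOpen U₀) (hU : AnalyticOnNhd ℂ τ U₀)
    (hτ' : ∀ s ∈ U₀, deriv τ s ≠ 0) (haU : (a : ℂ) ∈ U₀) (ha : τ a = 0) {R : ℝ} (hR : 0 < R)
    (hK : ∀ r < R, IsCompact (closure (sublevel U₀ τ a r)) ∧ closure (sublevel U₀ τ a r) ⊆ U₀) :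
    ∃ φ, IsLift U₀ τ φ (Metric.ball 0 R) ∧ φ 0 = a := by
  set A : Set ℝ := {r | 0 < r ∧ r ≤ R ∧ ∃ φ, IsLift U₀ τ φ (Metric.ball 0 r) ∧ φ 0 = a}
  have hAb : BddAbove A := ⟨R, fun r hr => hr.2.1⟩
  obtain ⟨r₀, hr₀⟩ : A.Nonempty := by
    obtain ⟨ψ, δ, hδ, hψ, hψs, -⟩ := exists_lift_nhds hUo hU haU (hτ' _ haU)
    rw [ha] at hψ hψs
    exact ⟨min δ R, lt_min hδ hR, min_le_right _ _, ψ,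
      hψ.mono (Metric.ball_subset_ball (min_le_left _ _)), hψs⟩
  set r := sSup A
  have hr₀r : r₀ ≤ r := le_csSup hAb hr₀
  have hr : 0 < r := hr₀.1.trans_le hr₀r
  have hrR : r ≤ R := csSup_le ⟨r₀, hr₀⟩ fun x hx => hx.2.1
  have hex : ∀ x < r, ∃ φ, IsLift U₀ τ φ (Metric.ball 0 x) ∧ φ 0 = a := by
    intro x hx
    obtain ⟨y, hy, hxy⟩ := exists_lt_of_lt_csSup ⟨r₀, hr₀⟩ hx
    obtain ⟨φ, hφ, h0⟩ := hy.2.2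
    exact ⟨φ, hφ.mono (Metric.ball_subset_ball hxy.le), h0⟩
  choose! f hf hf0 using hex
  have hΦ : ∀ x < r, ∀ y < r, x ≤ y → EqOn (f x) (f y) (Metric.ball 0 x) := by
    intro x hx y hy hxy
    by_cases hx0 : 0 < x
    · exact (hf x hx).eqOn hUo hU hτ' ((hf y hy).mono (Metric.ball_subset_ball hxy))
        Metric.isOpen_ball (convex_ball _ _).isPreconnected (Metric.mem_ball_self hx0)
        ((hf0 x hx).trans (hf0 y hy).symm)
    · rw [Metric.ball_eq_empty.2 (not_lt.1 hx0)]
      exact eqOn_empty _ _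
  obtain ⟨Φ, hΦl, hΦ0⟩ : ∃ φ, IsLift U₀ τ φ (Metric.ball 0 r) ∧ φ 0 = a := by
    -- Any radius strictly between `‖t‖` and `r` would do; the midpoint is an explicit choice.
    set Φ : ℂ → ℂ := fun t => f ((‖t‖ + r) / 2) t
    have hE : ∀ x < r, EqOn Φ (f x) (Metric.ball 0 x) := by
      intro x hx t ht
      have htx := mem_ball_zero_iff.1 ht
      have h1 : (‖t‖ + r) / 2 < r := by linarith
      rcases le_total x ((‖t‖ + r) / 2) with h2 | h2
      · exact (hΦ x hx _ h1 h2 ht).symm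
      · exact hΦ _ h1 x hx h2 (mem_ball_zero_iff.2 (by linarith))
    have hloc : ∀ t ∈ Metric.ball (0 : ℂ) r, ∃ x < r, t ∈ Metric.ball (0 : ℂ) x := fun t ht =>
      ⟨(‖t‖ + r) / 2, by linarith [mem_ball_zero_iff.1 ht],
        mem_ball_zero_iff.2 (by linarith [mem_ball_zero_iff.1 ht])⟩
    refine ⟨Φ, ⟨fun t ht => ?_, fun t ht => ?_, fun t ht => ?_⟩, ?_⟩
    · obtain ⟨x, hx, htx⟩ := hloc t ht
      refine ((hf x hx).analytic t htx).congr ?_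
      filter_upwards [Metric.isOpen_ball.mem_nhds htx] with y hy using (hE x hx hy).symm
    · obtain ⟨x, hx, htx⟩ := hloc t ht
      rw [hE x hx htx]; exact (hf x hx).mem t htx
    · obtain ⟨x, hx, htx⟩ := hloc t ht
      rw [hE x hx htx]; exact (hf x hx).right_inv t htx
    · obtain ⟨x, hx, htx⟩ := hloc 0 (Metric.mem_ball_self hr)
      rw [hE x hx htx]; exact hf0 x hx
  rcases hrR.eq_or_lt with h | hlt
  · exact h ▸ ⟨Φ, hΦl, hΦ0⟩
  exfalso
  have hext : ∀ p ∈ closure (Metric.ball (0 : ℂ) r), ∃ (ψ : ℂ → ℂ) (δ : ℝ), 0 < δ ∧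
      IsLift U₀ τ ψ (Metric.ball p δ) ∧ EqOn Φ ψ (Metric.ball p δ ∩ Metric.ball 0 r) := by
    intro p hp
    have : (𝓝[Metric.ball (0 : ℂ) r] p).NeBot := mem_closure_iff_nhdsWithin_neBot.1 hp
    obtain ⟨s, hs, hcl⟩ := (hK r hlt).1.exists_mapClusterPt (f := 𝓝[Metric.ball (0 : ℂ) r] p) (u := Φ)
      (le_principal_iff.2 (mem_map.2 (by
        filter_upwards [self_mem_nhdsWithin] with t ht
        exact subset_closure (hΦl.mem_sublevel hr hΦ0 ha ht))))
    obtain ⟨ψ, δ, hδ, hψ, -, hE⟩ := hΦl.exists_extension hUo hU hτ' Metric.isOpen_ball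
      (convex_ball _ _) ((hK r hlt).2 hs) hcl
    exact ⟨ψ, δ, hδ, hψ, hE⟩
  choose! g δ hδ hg hgE using hext
  obtain ⟨F, hFg, hFΦ, hFan⟩ := exists_glue (D := Metric.ball (0 : ℂ) r) (E := univ)
    Metric.isOpen_ball (convex_ball _ _) (subset_univ _) isOpen_univ convex_univ (f := Φ)
    (δ := δ) (g := g) hδ (fun p hp => by simpa using (hg p hp).analytic)
    (fun p hp => (hgE p hp).symm)
  have hW : IsOpen (⋃ p ∈ closure (Metric.ball (0 : ℂ) r), Metric.ball p (δ p)) :=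
    isOpen_biUnion fun _ _ => Metric.isOpen_ball
  obtain ⟨η, hη, hsub⟩ := (isCompact_closedBall (0 : ℂ) r).exists_thickening_subset_open hW
    (fun p hp => by
      rw [← closure_ball (0 : ℂ) hr.ne'] at hp
      exact mem_iUnion₂.2 ⟨p, hp, Metric.mem_ball_self (hδ p hp)⟩)
  rw [thickening_closedBall hη hr.le] at hsub
  have hFl : IsLift U₀ τ F (Metric.ball 0 (η + r)) := by
    refine ⟨fun t ht => hFan t ⟨mem_univ _, hsub ht⟩, fun t ht => ?_, fun t ht => ?_⟩
    · obtain ⟨p, hp, hpt⟩ := mem_iUnion₂.1 (hsub ht)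
      rw [hFg p hp ⟨hpt, mem_univ _⟩]; exact (hg p hp).mem t hpt
    · obtain ⟨p, hp, hpt⟩ := mem_iUnion₂.1 (hsub ht)
      rw [hFg p hp ⟨hpt, mem_univ _⟩]; exact (hg p hp).right_inv t hpt
  have hmem : min (η + r) R ∈ A :=
    ⟨lt_min (by linarith) hR, min_le_right _ _, F,
      hFl.mono (Metric.ball_subset_ball (min_le_left _ _)),
      by rw [hFΦ (Metric.mem_ball_self hr), hΦ0]⟩
  have := le_csSup hAb hmem
  have : r < min (η + r) R := lt_min (by linarith) hlt
  linarith

/-- The image of the disc is open, because `τ` is locally invertible, and relatively closed in the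
sublevel component, because `φ ∘ τ` is continuous there and is the identity on the image.
Connectedness gives equality. -/
theorem IsLift.sublevel_eq_image (hUo : IsOpen U₀) (hU : AnalyticOnNhd ℂ τ U₀)
    (hτ' : ∀ s ∈ U₀, deriv τ s ≠ 0) (ha : τ a = 0) {R : ℝ} (hR : 0 < R)
    (h : IsLift U₀ τ φ (Metric.ball 0 R)) (h0 : φ 0 = a) {s : ℂ} (hs : s ∈ sublevel U₀ τ a R) :
    τ s ∈ Metric.ball 0 R ∧ φ (τ s) = s := by
  have hsub : ∀ x ∈ sublevel U₀ τ a R, x ∈ U₀ ∧ τ x ∈ Metric.ball 0 R := fun x hx => by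
    have : x ∈ U₀ ∧ ‖τ x - τ a‖ < R := sublevel_subset R hx
    rw [ha, sub_zero] at this
    exact ⟨this.1, mem_ball_zero_iff.2 this.2⟩
  have hopen : IsOpen (φ '' Metric.ball 0 R) := by
    rw [isOpen_iff_mem_nhds]
    rintro _ ⟨t, ht, rfl⟩
    obtain ⟨ψ, δ, hδ, hψ, hψs, hleft⟩ := exists_lift_nhds hUo hU (h.mem t ht) (hτ' _ (h.mem t ht))
    have h1 := (h.analytic t ht).continuousAt.eventually hleft
    have h2 : ∀ᶠ x in 𝓝 t, φ x = ψ x := by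
      filter_upwards [h1, Metric.isOpen_ball.mem_nhds ht] with x hx hxb
      rw [h.right_inv x hxb] at hx
      exact hx.symm
    have h3 : Tendsto τ (𝓝 (φ t)) (𝓝 t) := by
      have := (hU _ (h.mem t ht)).continuousAt.tendsto
      rwa [h.right_inv t ht] at this
    filter_upwards [hleft, h3.eventually h2, h3.eventually (Metric.isOpen_ball.mem_nhds ht)]
      with x hx1 hx2 hx3
    exact ⟨τ x, hx3, hx2.trans hx1⟩
  have hsubset : sublevel U₀ τ a R ⊆ φ '' Metric.ball 0 R := by
    refine IsPreconnected.subset_of_closure_inter_subset isPreconnected_connectedComponentIn hopen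
      ⟨a, ?_, 0, Metric.mem_ball_self hR, h0⟩ ?_
    · exact h0 ▸ h.mem_sublevel hR h0 ha (Metric.mem_ball_self hR)
    · rintro x ⟨hxc, hx⟩
      obtain ⟨hxU, hxR⟩ := hsub x hx
      refine ⟨τ x, hxR, ?_⟩
      have : (𝓝[φ '' Metric.ball 0 R] x).NeBot := mem_closure_iff_nhdsWithin_neBot.1 hxc
      have h1 : Tendsto (fun y => φ (τ y)) (𝓝[φ '' Metric.ball 0 R] x) (𝓝 (φ (τ x))) :=
        (((h.analytic _ hxR).continuousAt.comp (hU x hxU).continuousAt).tendsto).mono_left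
          nhdsWithin_le_nhds
      have h2 : Tendsto (fun y => φ (τ y)) (𝓝[φ '' Metric.ball 0 R] x) (𝓝 x) := by
        refine Tendsto.congr' (f₁ := id) ?_ (tendsto_id.mono_left nhdsWithin_le_nhds)
        filter_upwards [self_mem_nhdsWithin] with y hy
        obtain ⟨t, ht, rfl⟩ := hy
        rw [h.right_inv t ht]; rfl
      exact tendsto_nhds_unique h1 h2
  obtain ⟨t, ht, rfl⟩ := hsubset hs
  rw [h.right_inv t ht]
  exact ⟨ht, rfl⟩

theorem closure_sublevel_subset (hUo : IsOpen U₀) (hU : AnalyticOnNhd ℂ τ U₀) {R : ℝ} {s : ℂ}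
    (hs : s ∈ closure (sublevel U₀ τ a R)) (hsU : s ∉ U₀) :
    s ∈ frontier (sublevel U₀ τ a R) ∩ frontier U₀ := by
  have hsub : sublevel U₀ τ a R ⊆ U₀ := fun x hx => (sublevel_subset R hx).1
  rw [(isOpen_sublevel hUo hU R).frontier_eq, hUo.frontier_eq]
  exact ⟨⟨hs, fun h => hsU (hsub h)⟩, closure_mono hsub hs, hsU⟩

/-- By compactness there is a cluster value. One in `U₀` is the limit, since `φ` then extends
analytically. One outside `U₀` lies in a finite set; were it not the limit, `φ` would keep crossing
a small sphere around it, which carries no other point of that set. This would give a second cluster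
value in `U₀`, which is then the limit: a contradiction. -/
theorem IsLift.exists_tendsto (hUo : IsOpen U₀) (hU : AnalyticOnNhd ℂ τ U₀)
    (hτ' : ∀ s ∈ U₀, deriv τ s ≠ 0) (ha : τ a = 0) {R : ℝ} (hR : 0 < R)
    (h : IsLift U₀ τ φ (Metric.ball 0 R)) (h0 : φ 0 = a)
    (hb : Bornology.IsBounded (sublevel U₀ τ a R))
    (hfin : (frontier (sublevel U₀ τ a R) ∩ frontier U₀).Finite) {p : ℂ} (hp : ‖p‖ = R) :
    ∃ s ∈ closure (sublevel U₀ τ a R), Tendsto φ (𝓝[Metric.ball 0 R] p) (𝓝 s) := by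
  set D := Metric.ball (0 : ℂ) R
  have hK : IsCompact (closure (sublevel U₀ τ a R)) := hb.isCompact_closure
  have hpD : p ∈ closure D := by
    rw [closure_ball _ hR.ne']; exact mem_closedBall_zero_iff.2 hp.le
  have : (𝓝[D] p).NeBot := mem_closure_iff_nhdsWithin_neBot.1 hpD
  have hmem : ∀ t ∈ D, φ t ∈ sublevel U₀ τ a R := fun t ht => h.mem_sublevel hR h0 ha ht
  have hreg : ∀ s ∈ U₀, MapClusterPt s (𝓝[D] p) φ → Tendsto φ (𝓝[D] p) (𝓝 s) := by
    intro s hs hcl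
    obtain ⟨ψ, δ, hδ, hψ, hψs, hE⟩ := h.exists_extension hUo hU hτ' Metric.isOpen_ball
      (convex_ball _ _) hs hcl
    have h1 : Tendsto ψ (𝓝[D] p) (𝓝 s) := by
      have := (hψ.analytic p (Metric.mem_ball_self hδ)).continuousAt.tendsto
      rw [hψs] at this
      exact this.mono_left nhdsWithin_le_nhds
    refine h1.congr' ?_
    filter_upwards [self_mem_nhdsWithin, mem_nhdsWithin_of_mem_nhds (Metric.ball_mem_nhds p hδ)]
      with t ht htb using (hE ⟨htb, ht⟩).symm
  obtain ⟨s, hs, hcl⟩ := hK.exists_mapClusterPt (f := 𝓝[D] p) (u := φ)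
    (le_principal_iff.2 (mem_map.2 (by
      filter_upwards [self_mem_nhdsWithin] with t ht using subset_closure (hmem t ht))))
  refine ⟨s, hs, ?_⟩
  by_cases hsU : s ∈ U₀
  · exact hreg s hsU hcl
  obtain ⟨ε₀, hε₀, hsep⟩ : ∃ ε₀ > 0, ∀ x ∈ Metric.ball s ε₀,
      x ∈ frontier (sublevel U₀ τ a R) ∩ frontier U₀ → x = s := by
    have hfin' : ((frontier (sublevel U₀ τ a R) ∩ frontier U₀) \ {s}).Finite :=
      hfin.subset sdiff_subset
    have := hfin'.isClosed.isOpen_compl.mem_nhds (x := s) (by simp)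
    obtain ⟨ε₀, hε₀, hb⟩ := Metric.mem_nhds_iff.1 this
    refine ⟨ε₀, hε₀, fun x hx hxF => ?_⟩
    by_contra hne
    exact hb hx ⟨hxF, hne⟩
  rw [Metric.tendsto_nhds]
  intro ε' hε'
  set ε := min ε' (ε₀ / 2)
  have hε : 0 < ε := lt_min hε' (by linarith)
  suffices hev : ∀ᶠ t in 𝓝[D] p, dist (φ t) s < ε by
    filter_upwards [hev] with t ht using ht.trans_le (min_le_left _ _)
  by_contra hnot
  have hfar : ∃ᶠ t in 𝓝[D] p, ε ≤ dist (φ t) s :=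
    (not_eventually.1 hnot).mono fun t ht => not_lt.1 ht
  have hnear : ∃ᶠ t in 𝓝[D] p, dist (φ t) s < ε := hcl.frequently (Metric.ball_mem_nhds s hε)
  -- Intermediate value theorem for the distance to `s` on the connected set `ball p δ ∩ D`.
  have hsphere : ∃ᶠ t in 𝓝[D] p, φ t ∈ Metric.sphere s ε := by
    rw [frequently_iff]
    intro V hV
    obtain ⟨δ, hδ, hVs⟩ := Metric.mem_nhdsWithin_iff.1 hV
    have hmemV : ∀ᶠ t in 𝓝[D] p, t ∈ Metric.ball p δ ∩ D := by
      filter_upwards [self_mem_nhdsWithin, mem_nhdsWithin_of_mem_nhds (Metric.ball_mem_nhds p hδ)]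
        with t ht htb using ⟨htb, ht⟩
    obtain ⟨t₁, h1, h1m⟩ := (hfar.and_eventually hmemV).exists
    obtain ⟨t₂, h2, h2m⟩ := (hnear.and_eventually hmemV).exists
    have hpc : IsPreconnected (Metric.ball p δ ∩ D) :=
      ((convex_ball _ _).inter (convex_ball _ _)).isPreconnected
    have hcont : ContinuousOn (fun t => dist (φ t) s) (Metric.ball p δ ∩ D) :=
      Continuous.comp_continuousOn (g := fun y => dist y s) (by fun_prop)
        (h.analytic.continuousOn.mono inter_subset_right)
    obtain ⟨t, ht, hte⟩ := hpc.intermediate_value h2m h1m hcont ⟨h2.le, h1⟩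
    exact ⟨t, hVs ht, hte⟩
  have hK2 : IsCompact (closure (sublevel U₀ τ a R) ∩ Metric.sphere s ε) :=
    hK.inter_right Metric.isClosed_sphere
  obtain ⟨s', hs', hcl'⟩ := hK2.exists_mapClusterPt_of_frequently (l := 𝓝[D] p) (f := φ) (by
    refine (hsphere.and_eventually self_mem_nhdsWithin).mono fun t ht => ?_
    exact ⟨subset_closure (hmem t ht.2), ht.1⟩)
  have hne : s' ≠ s := by
    rintro rfl
    have := hs'.2
    rw [Metric.mem_sphere, dist_self] at this
    exact hε.ne this
  have hs'U : s' ∈ U₀ := by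
    by_contra hcon
    refine hne (hsep s' ?_ (closure_sublevel_subset hUo hU hs'.1 hcon))
    rw [Metric.mem_ball, Metric.mem_sphere.1 hs'.2]
    have := min_le_right ε' (ε₀ / 2)
    linarith
  have hlim := hreg s' hs'U hcl'
  exact hne (eq_of_nhds_neBot (ClusterPt.mono hcl hlim)).symm

end Lift

/-! ### Local analysis at a critical point. -/

/-- The derivative of the angle of the Hamiltonian with respect to `s`. -/
noncomputable def angleDeriv (X Z : ℂ → ℂ) (s : ℂ) : ℂ :=
  (deriv X s * Z s - X s * deriv Z s) / rhoSq X Z s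

/-- Write `X = F A` and `Z = ε i F B` with `F = u^m f`. Then `ρ² = F² (A² - B²)` and `X' Z - X Z' =
ε i F² (A' B - A B')`, so `F` cancels in `θ̃'`. Both `A² - B²` and `u (A' B - A B')` contain the
factor `u^n`, which leaves a regular quotient. -/
theorem HasCriticalForm.exists_local {X Z : ℂ → ℂ} {s₀ : ℂ} {m : ℤ} {n : ℕ} {ε : ℤ}
    (h : HasCriticalForm X Z s₀ m n ε) :
    ∃ (M : ℕ) (q g : ℂ → ℂ), 0 < M ∧ (M : ℤ) = 2 * m + n + 2 ∧ AnalyticAt ℂ q 0 ∧ q 0 ≠ 0 ∧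
      AnalyticAt ℂ g 0 ∧ g 0 = ε * Complex.I * n / 2 ∧
      ∀ᶠ s in 𝓝[≠] s₀, rhoSq X Z s = (s - s₀) ^ (2 * m + n) * q (s - s₀) ∧
        (s - s₀) * angleDeriv X Z s = g (s - s₀) := by
  obtain ⟨hn, hmn, hε, f, gX, gZ, hf, hgX, hgZ, hne, hev⟩ := h
  have hε2 : (ε : ℂ) ^ 2 = 1 := by rcases hε with rfl | rfl <;> norm_num
  rw [norm_pos_iff] at hne
  have hf0 : f 0 ≠ 0 := fun h => hne (by simp [h])
  have hd0 : gX 0 - gZ 0 ≠ 0 := fun h => hne (by simp [h])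
  have hM : 0 < 2 * m + n + 2 := by
    have h1 : (-2 : ℝ) < 2 * m + n := by linarith
    have h2 : (-2 : ℤ) < 2 * m + n := by exact_mod_cast h1
    omega
  have hda : AnalyticAt ℂ (fun u => gX u - gZ u) 0 := hgX.sub hgZ
  have hea : AnalyticAt ℂ (fun u => 2 + u ^ n * (gX u + gZ u)) 0 := by fun_prop
  have he0 : (2 : ℂ) + 0 ^ n * (gX 0 + gZ 0) ≠ 0 := by simp [hn.ne']
  refine ⟨(2 * m + n + 2).toNat,
    fun u => f u ^ 2 * ((gX u - gZ u) * (2 + u ^ n * (gX u + gZ u))),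
    fun u => ε * Complex.I * (n * (gX u - gZ u) + u * (deriv gX u - deriv gZ u) +
      u ^ (n + 1) * (deriv gX u * gZ u - gX u * deriv gZ u)) /
      ((gX u - gZ u) * (2 + u ^ n * (gX u + gZ u))), by omega, by omega, ?_, ?_, ?_, ?_, ?_⟩
  · exact (hf.pow 2).mul (hda.mul hea)
  · exact mul_ne_zero (pow_ne_zero _ hf0) (mul_ne_zero hd0 he0)
  · have h1 := hgX.deriv
    have h2 := hgZ.deriv
    exact AnalyticAt.div (by fun_prop) (hda.mul hea) (mul_ne_zero hd0 he0)
  · simp only [hn.ne', zero_mul, add_zero, ne_eq, not_false_eq_true, zero_pow, Nat.succ_ne_zero]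
    field_simp
  have hsub : Tendsto (fun s => s - s₀) (𝓝[≠] s₀) (𝓝 0) := by
    have : Tendsto (fun s => s - s₀) (𝓝 s₀) (𝓝 (s₀ - s₀)) := by
      apply Continuous.tendsto; fun_prop
    rw [sub_self] at this
    exact this.mono_left nhdsWithin_le_nhds
  have hev' : ∀ᶠ s in 𝓝[≠] s₀, ∀ᶠ x in 𝓝 s,
      X x = (x - s₀) ^ m * f (x - s₀) * (1 + (x - s₀) ^ n * gX (x - s₀)) ∧
      Z x = ε * Complex.I * (x - s₀) ^ m * f (x - s₀) * (1 + (x - s₀) ^ n * gZ (x - s₀)) := by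
    have h1 := eventually_nhdsWithin_iff.1 hev
    filter_upwards [eventually_nhdsWithin_of_eventually_nhds h1.eventually_nhds,
      self_mem_nhdsWithin] with s hs hsne
    filter_upwards [hs, isOpen_compl_singleton.mem_nhds hsne] with x hx hxne using hx hxne
  filter_upwards [hev', self_mem_nhdsWithin, hsub.eventually hf.eventually_analyticAt,
    hsub.eventually hgX.eventually_analyticAt, hsub.eventually hgZ.eventually_analyticAt,
    hsub.eventually (hf.continuousAt.eventually_ne hf0),
    hsub.eventually (hda.continuousAt.eventually_ne hd0),
    hsub.eventually (hea.continuousAt.eventually_ne he0)]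
    with s hs hsne hfs hXs hZs hf0s hd0s he0s
  have hu0 : s - s₀ ≠ 0 := sub_ne_zero.2 hsne
  have hsubd : HasDerivAt (fun x => x - s₀) 1 s := (hasDerivAt_id s).sub_const s₀
  have hF : DifferentiableAt ℂ (fun x => (x - s₀) ^ m * f (x - s₀)) s := by
    refine DifferentiableAt.mul ?_ ?_
    · exact DifferentiableAt.zpow hsubd.differentiableAt (Or.inl hu0)
    · exact DifferentiableAt.comp s (f := fun x => x - s₀) hfs.differentiableAt
        hsubd.differentiableAt
  have hG : ∀ {g : ℂ → ℂ}, AnalyticAt ℂ g (s - s₀) →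
      HasDerivAt (fun x => 1 + (x - s₀) ^ n * g (x - s₀))
        (n * (s - s₀) ^ (n - 1) * g (s - s₀) + (s - s₀) ^ n * deriv g (s - s₀)) s := by
    intro g hg
    have h1 : HasDerivAt (fun x => g (x - s₀)) _ s :=
      HasDerivAt.comp s (h := fun x => x - s₀) hg.differentiableAt.hasDerivAt hsubd
    simpa using ((hsubd.pow n).mul h1).const_add 1
  obtain ⟨hXe, hZe⟩ := hs.self_of_nhds
  have hXd := ((hF.hasDerivAt.mul (hG hXs)).congr_of_eventuallyEq
    (f₁ := X) (hs.mono fun x hx => hx.1)).deriv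
  have hZd := (((hF.hasDerivAt.mul (hG hZs)).const_mul (ε * Complex.I)).congr_of_eventuallyEq
    (f₁ := Z) (hs.mono fun x hx => by rw [hx.2]; simp only [Pi.mul_apply]; ring)).deriv
  set F' := deriv (fun x => (x - s₀) ^ m * f (x - s₀)) s
  set u := s - s₀
  obtain ⟨j, rfl⟩ : ∃ j, n = j + 1 := ⟨n - 1, by omega⟩
  simp only [Nat.add_sub_cancel] at hXd hZd
  have hzp : u ^ (2 * m + ((j + 1 : ℕ) : ℤ)) = u ^ m * u ^ m * u ^ (j + 1) := by
    rw [zpow_add₀ hu0, two_mul, zpow_add₀ hu0, zpow_natCast]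
  have hI := Complex.I_sq
  have hεI : ((ε : ℂ) * Complex.I) ^ 2 = -1 := by rw [mul_pow, hε2, hI]; ring
  have hrho : rhoSq X Z s = u ^ (2 * m + ((j + 1 : ℕ) : ℤ)) *
      (f u ^ 2 * ((gX u - gZ u) * (2 + u ^ (j + 1) * (gX u + gZ u)))) := by
    rw [rhoSq, hXe, hZe, hzp]
    linear_combination (u ^ m * f u * (1 + u ^ (j + 1) * gZ u)) ^ 2 * hεI
  refine ⟨hrho, ?_⟩
  have hum : u ^ m ≠ 0 := zpow_ne_zero _ hu0
  rw [angleDeriv, hrho, hXd, hZd, hXe, hZe, hzp]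
  set S := u ^ m
  field_simp
  push_cast
  ring

/-- Formally `τ - t₀ = u^(M/2) k(u)`. The square root is avoided by using `τ'` itself as the branch
of `2 u^(N/2) p(u)`, so that both conclusions are single valued. The tip condition on the cuts makes
`U₀` connected near `s₀`, hence yields one constant `t₀`. -/
theorem exists_naturalTime_local {U₀ : Set ℂ} {τ : ℂ → ℂ} {rho : ℂ → ℂ} {s₀ : ℂ} {M : ℕ} {N : ℤ}
    {q : ℂ → ℂ} (hUo : IsOpen U₀) (hU : AnalyticOnNhd ℂ τ U₀) (hτ' : ∀ s ∈ U₀, deriv τ s ≠ 0)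
    (hsq : ∀ s ∈ U₀, deriv τ s ^ 2 = 4 * rho s) (hM : 0 < M) (hMN : (M : ℤ) = N + 2)
    (hq : AnalyticAt ℂ q 0) (hq0 : q 0 ≠ 0) (hs₀ : s₀ ∉ U₀) (hcl : s₀ ∈ closure U₀)
    (hrho : ∀ᶠ s in 𝓝[≠] s₀, rho s = (s - s₀) ^ N * q (s - s₀))
    (htip : ∀ W ∈ 𝓝 s₀, ∃ V ∈ 𝓝 s₀, V ⊆ W ∧ IsPreconnected (V ∩ U₀)) :
    ∃ (t₀ : ℂ) (k p : ℂ → ℂ), AnalyticAt ℂ k 0 ∧ AnalyticAt ℂ p 0 ∧ p 0 ≠ 0 ∧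
      k 0 = 4 * p 0 / M ∧ Tendsto τ (𝓝[U₀] s₀) (𝓝 t₀) ∧
      ∀ᶠ s in 𝓝[U₀] s₀, (τ s - t₀) * (2 * p (s - s₀)) = (s - s₀) * k (s - s₀) * deriv τ s ∧
        (τ s - t₀) ^ 2 = (s - s₀) ^ M * k (s - s₀) ^ 2 := by
  obtain ⟨p, hp, hp0, hpq⟩ := exists_analytic_root hq hq0 two_ne_zero
  obtain ⟨k, hk, hode⟩ := exists_analytic_ode (analyticAt_const (v := (2 : ℂ)).mul hp) hM
  have hsub : Tendsto (fun s => s - s₀) (𝓝 s₀) (𝓝 0) := by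
    have : Tendsto (fun s => s - s₀) (𝓝 s₀) (𝓝 (s₀ - s₀)) := by
      apply Continuous.tendsto; fun_prop
    rwa [sub_self] at this
  have hMc : (M : ℂ) ≠ 0 := by exact_mod_cast hM.ne'
  have hMN' : (M : ℂ) = N + 2 := by exact_mod_cast hMN
  have hk0 : k 0 = 4 * p 0 / M := by
    have := hode.self_of_nhds
    simp only [zero_mul, add_zero, Pi.mul_apply] at this
    field_simp
    linear_combination 2 * this
  have hall := ((hsub.eventually hk.eventually_analyticAt).and
    ((hsub.eventually hp.eventually_analyticAt).and
    ((hsub.eventually (hp.continuousAt.eventually_ne hp0)).and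
    ((hsub.eventually hode).and (eventually_nhdsWithin_iff.1 hrho)))))
  obtain ⟨W, hW, hWo, hWs⟩ := eventually_nhds_iff.1 hall
  set O := U₀ ∩ W
  have hO : IsOpen O := hUo.inter hWo
  -- The candidate for `τ - t₀`: an antiderivative of `τ'` by the choice of `k`.
  set E : ℂ → ℂ := fun s => (s - s₀) * k (s - s₀) * deriv τ s / (2 * p (s - s₀)) with hE
  have hne : ∀ s ∈ O, s ≠ s₀ := fun s hs h => hs₀ (h ▸ hs.1)
  have hsq' : ∀ s ∈ O, deriv τ s ^ 2 = 4 * ((s - s₀) ^ N * p (s - s₀) ^ 2) := fun s hs => by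
    rw [hsq s hs.1, (hW s hs.2).2.2.2.2 (hne s hs), hpq]
  have hder : ∀ s ∈ O, HasDerivAt E (deriv τ s) s := by
    intro s hs
    obtain ⟨hks, hps, hps0, hodes, -⟩ := hW s hs.2
    have hu0 : s - s₀ ≠ 0 := sub_ne_zero.2 (hne s hs)
    have hsubd : HasDerivAt (fun x => x - s₀) 1 s := (hasDerivAt_id s).sub_const s₀
    have hkd : HasDerivAt (fun x => k (x - s₀)) _ s :=
      HasDerivAt.comp s (h := fun x => x - s₀) hks.differentiableAt.hasDerivAt hsubd
    have hpd : HasDerivAt (fun x => p (x - s₀)) _ s :=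
      HasDerivAt.comp s (h := fun x => x - s₀) hps.differentiableAt.hasDerivAt hsubd
    have hτd : HasDerivAt (deriv τ) (deriv (deriv τ) s) s :=
      (hU s hs.1).deriv.differentiableAt.hasDerivAt
    have hzd : HasDerivAt (fun x => (x - s₀) ^ N) (N * (s - s₀) ^ (N - 1) * 1) s :=
      HasDerivAt.comp s (h := fun x => x - s₀) (hasDerivAt_zpow N _ (Or.inl hu0)) hsubd
    have hsqd := ((hτd.pow 2).congr_of_eventuallyEq (f₁ := fun x => 4 * ((x - s₀) ^ N * p (x - s₀) ^ 2))
      (by filter_upwards [hO.mem_nhds hs] with x hx using (hsq' x hx).symm)).unique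
      ((hzd.mul (hpd.pow 2)).const_mul 4)
    have hEd := ((hsubd.mul hkd).mul hτd).div (hpd.const_mul 2) (mul_ne_zero two_ne_zero hps0)
    refine hEd.congr_deriv ?_
    have hs2 := hsq' s hs
    have hz : (s - s₀) ^ N = (s - s₀) * (s - s₀) ^ (N - 1) := by
      rw [← zpow_one_add₀ hu0]; congr 1; ring
    have hτ0 := hτ' s hs.1
    simp only [Pi.mul_apply] at hodes hsqd ⊢
    rw [hz] at hsqd hs2
    rw [hMN'] at hodes
    set u := s - s₀
    set S := u ^ (N - 1)
    set T := deriv τ s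
    set T2 := deriv (deriv τ) s
    rw [div_eq_iff (pow_ne_zero _ (mul_ne_zero two_ne_zero hps0))]
    -- After multiplication by `τ'` only `τ'²` and `τ' τ''` occur, and both are known from the
    -- formula for `τ'²` and its derivative.
    refine mul_left_cancel₀ hτ0 ?_
    simp only [Pi.pow_apply, Nat.reduceSub, pow_one, Nat.cast_ofNat, mul_one] at hsqd
    linear_combination (2 * p u * (k u + u * deriv k u) - 2 * u * k u * deriv p u - 4 * p u ^ 2) * hs2
      + p u * u * k u * hsqd + 8 * u * S * p u ^ 3 * hodes
  obtain ⟨V, hV, hVW, hVc⟩ := htip W (hWo.mem_nhds hWs)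
  obtain ⟨x₀, hx₀V, hx₀⟩ := mem_closure_iff_nhds.1 hcl V hV
  have hVO : V ∩ U₀ ⊆ O := fun x hx => ⟨hx.2, hVW hx.1⟩
  have hcomp : V ∩ U₀ ⊆ connectedComponentIn O x₀ :=
    hVc.subset_connectedComponentIn ⟨hx₀V, hx₀⟩ hVO
  have hcO : connectedComponentIn O x₀ ⊆ O := connectedComponentIn_subset _ _
  have hdiff : ∀ x ∈ connectedComponentIn O x₀, HasDerivAt (fun s => τ s - E s) 0 x := by
    intro x hx
    have := (hU x (hcO hx).1).differentiableAt.hasDerivAt.sub (hder x (hcO hx))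
    rwa [sub_self] at this
  obtain ⟨t₀, ht₀⟩ := hO.connectedComponentIn.exists_is_const_of_deriv_eq_zero
    isPreconnected_connectedComponentIn (f := fun s => τ s - E s)
    (fun x hx => (hdiff x hx).differentiableAt.differentiableWithinAt)
    (fun x hx => (hdiff x hx).deriv)
  have hVev : ∀ᶠ s in 𝓝[U₀] s₀, s ∈ V ∩ U₀ := by
    filter_upwards [self_mem_nhdsWithin, mem_nhdsWithin_of_mem_nhds hV] with s h1 h2 using ⟨h2, h1⟩
  have hfin : ∀ᶠ s in 𝓝[U₀] s₀,
      (τ s - t₀) * (2 * p (s - s₀)) = (s - s₀) * k (s - s₀) * deriv τ s ∧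
        (τ s - t₀) ^ 2 = (s - s₀) ^ M * k (s - s₀) ^ 2 := by
    filter_upwards [hVev] with s hs
    have hsO := hVO hs
    have hps0 := (hW s hsO.2).2.2.1
    have hu0 : s - s₀ ≠ 0 := sub_ne_zero.2 (hne s hsO)
    have h1 : τ s - t₀ = E s := by
      have : τ s - E s = t₀ := ht₀ s (hcomp hs)
      linear_combination this
    rw [h1]
    refine ⟨div_mul_cancel₀ _ (mul_ne_zero two_ne_zero hps0), ?_⟩
    have hpow : (s - s₀) ^ M = (s - s₀) ^ N * (s - s₀) ^ 2 := by
      rw [← zpow_natCast, hMN, zpow_add₀ hu0]; rfl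
    rw [hE, div_pow, mul_pow, mul_pow, hsq' s hsO, hpow]
    field_simp
    ring
  refine ⟨t₀, k, p, hk, hp, hp0, hk0, ?_, hfin⟩
  have hsub' : Tendsto (fun s => s - s₀) (𝓝[U₀] s₀) (𝓝 0) := hsub.mono_left nhdsWithin_le_nhds
  have h1 : Tendsto (fun s => (s - s₀) ^ M * k (s - s₀) ^ 2) (𝓝[U₀] s₀) (𝓝 0) := by
    have := (hsub'.pow M).mul ((hk.continuousAt.tendsto.comp hsub').pow 2)
    simpa [hM.ne'] using this
  have h2 : Tendsto (fun s => (τ s - t₀) ^ 2) (𝓝[U₀] s₀) (𝓝 0) :=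
    h1.congr' (hfin.mono fun s hs => hs.2.symm)
  have h3 : Tendsto (fun s => √‖(τ s - t₀) ^ 2‖) (𝓝[U₀] s₀) (𝓝 0) := by
    have := (Real.continuous_sqrt.tendsto _).comp h2.norm
    simpa only [Function.comp_def, norm_zero, Real.sqrt_zero] using this
  rw [tendsto_iff_norm_sub_tendsto_zero]
  simpa [norm_pow, Real.sqrt_sq (norm_nonneg _)] using h3

theorem eqOn_const_of_pow_eq {f : ℂ → ℂ} {D : Set ℂ} (hD : IsPreconnected D)
    (hf : ContinuousOn f D) {M : ℕ} (hM : 0 < M) {w : ℂ} (hw : ∀ t ∈ D, f t ^ M = w) :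
    ∃ c, ∀ t ∈ D, f t = c := by
  rcases D.eq_empty_or_nonempty with rfl | ⟨x, hx⟩
  · exact ⟨0, by simp⟩
  have hfin : {z : ℂ | z ^ M = w}.Finite := by
    refine (Polynomial.nthRoots M w).toFinset.finite_toSet.subset fun z hz => ?_
    simpa [Polynomial.mem_nthRoots hM] using hz
  exact ⟨f x, fun t ht => hD.constant_of_mapsTo hfin.isDiscrete hf hw ht hx⟩

theorem re_one_sub_div_pos {R : ℝ} {t p : ℂ} (hp : ‖p‖ = R) (ht : ‖t‖ < R) :
    0 < (1 - t / p).re := by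
  have hR : 0 < R := (norm_nonneg t).trans_lt ht
  have h1 : (t / p).re ≤ ‖t / p‖ := Complex.re_le_norm _
  have h2 : ‖t / p‖ < 1 := by rw [norm_div, hp, div_lt_one hR]; exact ht
  rw [Complex.sub_re, Complex.one_re]
  linarith

/-- With `κ^M = k²`, the local coordinate `V = u κ(u)` satisfies `V^M = (t - t₀)²`, so `V = c (1 - t
/ t₀)^(2/M)` and `u = ψ(V)`. The relation `2 p (t - t₀) = u k τ'` turns `G / τ' = g / (u τ')` into
`g k / (2 p (t - t₀))`. -/
theorem IsLift.exists_singular_form {U₀ : Set ℂ} {τ φ : ℂ → ℂ} {s₀ t₀ : ℂ} {R : ℝ} {M : ℕ}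
    {k p g G : ℂ → ℂ} (hR : 0 < R) (h : IsLift U₀ τ φ (Metric.ball 0 R)) (hs₀ : s₀ ∉ U₀)
    (hτ' : ∀ s ∈ U₀, deriv τ s ≠ 0) (hM : 0 < M) (ht₀ : ‖t₀‖ = R)
    (hlim : Tendsto φ (𝓝[Metric.ball 0 R] t₀) (𝓝 s₀))
    (hk : AnalyticAt ℂ k 0) (hp : AnalyticAt ℂ p 0) (hp0 : p 0 ≠ 0) (hk0 : k 0 = 4 * p 0 / M)
    (hg : AnalyticAt ℂ g 0) (hG : ∀ᶠ s in 𝓝[≠] s₀, (s - s₀) * G s = g (s - s₀))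
    (hE : ∀ᶠ s in 𝓝[U₀] s₀, (τ s - t₀) * (2 * p (s - s₀)) = (s - s₀) * k (s - s₀) * deriv τ s ∧
        (τ s - t₀) ^ 2 = (s - s₀) ^ M * k (s - s₀) ^ 2) :
    ∃ L : ℂ → ℂ, AnalyticAt ℂ L 0 ∧ -t₀ * L 0 = 2 * g 0 / M ∧
      ∀ᶠ t in 𝓝[Metric.ball 0 R] t₀, G (φ t) / deriv τ (φ t) =
        L ((1 - t / t₀) ^ (((2 / M : ℝ)) : ℂ)) / (1 - t / t₀) := by
  have hMc : (M : ℂ) ≠ 0 := by exact_mod_cast hM.ne'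
  have hk00 : k 0 ≠ 0 := by rw [hk0]; exact div_ne_zero (mul_ne_zero (by norm_num) hp0) hMc
  have ht00 : t₀ ≠ 0 := norm_pos_iff.1 (ht₀ ▸ hR)
  set D := Metric.ball (0 : ℂ) R
  obtain ⟨κ, hκ, hκ0, hκM⟩ := exists_analytic_root (hk.pow 2) (pow_ne_zero 2 hk00) hM.ne'
  have hV : AnalyticAt ℂ (fun u => u * κ u) 0 := analyticAt_id.mul hκ
  have hV' : deriv (fun u => u * κ u) 0 ≠ 0 := by
    have := ((hasDerivAt_id (0 : ℂ)).mul hκ.differentiableAt.hasDerivAt).deriv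
    simp only [id_eq, one_mul, zero_mul, add_zero] at this
    exact this ▸ hκ0
  obtain ⟨ψ, hψ, hψ0, -, hψV⟩ := exists_analytic_inverse hV hV'
  rw [zero_mul] at hψ hψ0
  have hlimU : Tendsto φ (𝓝[D] t₀) (𝓝[U₀] s₀) := by
    refine tendsto_nhdsWithin_iff.2 ⟨hlim, ?_⟩
    filter_upwards [self_mem_nhdsWithin] with t ht using h.mem t ht
  have hlimne : Tendsto φ (𝓝[D] t₀) (𝓝[≠] s₀) := by
    refine tendsto_nhdsWithin_iff.2 ⟨hlim, ?_⟩
    filter_upwards [self_mem_nhdsWithin] with t ht heq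
    exact hs₀ (heq ▸ h.mem t ht)
  have hlim0 : Tendsto (fun t => φ t - s₀) (𝓝[D] t₀) (𝓝 0) := by
    simpa using hlim.sub_const s₀
  have hall := (hlimU.eventually hE).and ((hlimne.eventually hG).and
    ((hlim0.eventually hψV).and ((hlim0.eventually (hp.continuousAt.eventually_ne hp0)).and
      (hlim0.eventually hκ.eventually_analyticAt))))
  obtain ⟨δ, hδ, hb⟩ := Metric.mem_nhdsWithin_iff.1 hall
  set S := Metric.ball t₀ δ ∩ D
  have hS : IsPreconnected S := ((convex_ball _ _).inter (convex_ball _ _)).isPreconnected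
  set β : ℂ := ((2 / M : ℝ) : ℂ)
  have hy : ∀ t ∈ S, 1 - t / t₀ ∈ Complex.slitPlane := fun t ht =>
    Or.inl (re_one_sub_div_pos ht₀ (mem_ball_zero_iff.1 ht.2))
  have hy0 : ∀ t ∈ S, (1 - t / t₀) ^ β ≠ 0 := fun t ht h0 =>
    Complex.slitPlane_ne_zero (hy t ht) (Complex.cpow_eq_zero_iff _ _ |>.1 h0).1
  have hyM : ∀ t, ((1 - t / t₀) ^ β) ^ M = (1 - t / t₀) ^ 2 := by
    intro t
    rw [← Complex.cpow_nat_mul]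
    have : (M : ℂ) * β = (2 : ℕ) := by simp only [β]; push_cast; field_simp
    rw [this, Complex.cpow_natCast]
  -- The quotient has constant `M`-th power `t₀²`; being continuous on a connected set, it stays at
  -- one of finitely many roots.
  obtain ⟨c, hc⟩ := eqOn_const_of_pow_eq hS
    (f := fun t => (φ t - s₀) * κ (φ t - s₀) / (1 - t / t₀) ^ β) (M := M) (w := t₀ ^ 2) (by
      intro t ht
      refine ContinuousAt.continuousWithinAt ?_
      have hφc := (h.analytic t ht.2).continuousAt
      have hκc : ContinuousAt (fun t => κ (φ t - s₀)) t :=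
        ContinuousAt.comp (f := fun t => φ t - s₀) (hb ht).2.2.2.2.continuousAt
          (hφc.sub continuousAt_const)
      exact ((hφc.sub continuousAt_const).mul hκc).div
        (ContinuousAt.cpow (by fun_prop) continuousAt_const (hy t ht)) (hy0 t ht)) hM (by
      intro t ht
      have h1 := (hb ht).1.2
      have h2 := Complex.slitPlane_ne_zero (hy t ht)
      rw [h.right_inv t ht.2] at h1
      have h3 : κ (φ t - s₀) ^ M = k (φ t - s₀) ^ 2 := hκM _
      rw [div_pow, hyM, mul_pow, h3, ← h1, div_eq_iff (pow_ne_zero 2 h2)]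
      have h4 : t - t₀ = -(t₀ * (1 - t / t₀)) := by field_simp; ring
      rw [h4]; ring)
  have hψc : AnalyticAt ℂ (fun w => ψ (c * w)) 0 := by
    refine AnalyticAt.fun_comp_of_eq (f := fun w : ℂ => c * w) (g := ψ) hψ (by fun_prop) (by simp)
  have hL₀ : AnalyticAt ℂ (fun u => g u * k u / (2 * p u)) 0 :=
    (hg.mul hk).div (analyticAt_const.mul hp) (mul_ne_zero two_ne_zero hp0)
  refine ⟨fun w => -(1 / t₀) * (g (ψ (c * w)) * k (ψ (c * w)) / (2 * p (ψ (c * w)))), ?_, ?_, ?_⟩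
  · refine analyticAt_const.mul ?_
    exact AnalyticAt.fun_comp_of_eq (f := fun w => ψ (c * w))
      (g := fun u => g u * k u / (2 * p u)) hL₀ hψc (by simp [hψ0])
  · simp only [mul_zero, hψ0, hk0]
    field_simp
    norm_num
  · have hmem : ∀ᶠ t in 𝓝[D] t₀, t ∈ S := by
      filter_upwards [self_mem_nhdsWithin, mem_nhdsWithin_of_mem_nhds (Metric.ball_mem_nhds t₀ hδ)]
        with t ht htb using ⟨htb, ht⟩
    filter_upwards [hmem] with t ht
    obtain ⟨⟨h1, -⟩, h2, h3, h4, -⟩ := hb ht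
    rw [h.right_inv t ht.2] at h1
    have h5 := hc t ht
    rw [div_eq_iff (hy0 t ht)] at h5
    rw [← h5, h3]
    have h6 : 1 - t / t₀ ≠ 0 := Complex.slitPlane_ne_zero (hy t ht)
    have h7 := hτ' _ (h.mem t ht.2)
    have h8 : t - t₀ ≠ 0 := fun h0 => h6 (by rw [sub_eq_zero.1 h0]; field_simp; simp)
    have h9 : 1 - t / t₀ = -(t - t₀) / t₀ := by field_simp; ring
    have hu0 : φ t - s₀ ≠ 0 := fun h0 => hs₀ (sub_eq_zero.1 h0 ▸ h.mem t ht.2)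
    rw [h9]
    set u := φ t - s₀
    rw [← h2]
    field_simp
    linear_combination G (φ t) * h1

/-! ### The Hamiltonian, its angle and the natural time on the real axis. -/

theorem tendsto_ofReal_punctured (a : ℝ) :
    Tendsto (fun x : ℝ => (x : ℂ)) (𝓝[≠] a) (𝓝[≠] (a : ℂ)) := by
  refine tendsto_nhdsWithin_iff.2 ⟨(Complex.continuous_ofReal.tendsto a).mono_left
    nhdsWithin_le_nhds, ?_⟩
  filter_upwards [self_mem_nhdsWithin] with x hx h
  exact hx (Complex.ofReal_injective h)

theorem eqOn_of_eventually_eq_ofReal {f g : ℂ → ℂ} {D : Set ℂ} (hf : AnalyticOnNhd ℂ f D)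
    (hg : AnalyticOnNhd ℂ g D) (hD : IsPreconnected D) {a : ℝ} (ha : (a : ℂ) ∈ D)
    (h : ∀ᶠ x : ℝ in 𝓝 a, f x = g x) : EqOn f g D := by
  refine hf.eqOn_of_preconnected_of_frequently_eq hg hD ha ?_
  have h1 : ∃ᶠ x : ℝ in 𝓝[≠] a, f x = g x := (h.filter_mono nhdsWithin_le_nhds).frequently
  exact (tendsto_ofReal_punctured a).frequently h1

section RealAxis

variable {U : Set ℂ} {X Z : ℂ → ℂ} {sr : ℝ}

/-- At a critical point `Z / X` tends to `± i`, whereas on the real axis it is real. The positive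
lower bound on `ρ²` alone would not exclude poles. -/
theorem AssumptionXZ.not_critical (h : AssumptionXZ U X Z sr) {x : ℝ} (hx : (x : ℂ) ∈ U) :
    (x : ℂ) ∉ criticalPoints U X Z := by
  intro hc
  obtain ⟨m, n, ε, hn, -, hε, f, gX, gZ, hf, hgX, hgZ, hne, hev⟩ := h.form x hc
  rw [norm_pos_iff] at hne
  have hf0 : f 0 ≠ 0 := fun h => hne (by simp [h])
  have hsub : Tendsto (fun s => s - (x : ℂ)) (𝓝[≠] (x : ℂ)) (𝓝 0) := by
    have : Tendsto (fun s => s - (x : ℂ)) (𝓝 (x : ℂ)) (𝓝 ((x : ℂ) - x)) := by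
      apply Continuous.tendsto; fun_prop
    rw [sub_self] at this
    exact this.mono_left nhdsWithin_le_nhds
  have hA : ∀ {g : ℂ → ℂ}, AnalyticAt ℂ g 0 →
      Tendsto (fun s => 1 + (s - x) ^ n * g (s - x)) (𝓝[≠] (x : ℂ)) (𝓝 1) := by
    intro g hg
    have := ((hsub.pow n).mul (hg.continuousAt.tendsto.comp hsub)).const_add 1
    simpa [hn.ne'] using this
  have hlim := (((hA hgZ).div (hA hgX) one_ne_zero).const_mul (ε * Complex.I)).comp
    (tendsto_ofReal_punctured x)
  have him := (Complex.continuous_im.tendsto _).comp hlim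
  have hzero : Tendsto (fun _ : ℝ => (0 : ℝ)) (𝓝[≠] x) (𝓝 0) := tendsto_const_nhds
  have heq : (0 : ℝ) = ((ε : ℂ) * Complex.I * (1 / 1)).im := by
    refine tendsto_nhds_unique hzero (him.congr' ?_)
    have hU : ∀ᶠ s : ℝ in 𝓝[≠] x, (s : ℂ) ∈ U :=
      ((Complex.continuous_ofReal.tendsto x).eventually (h.isOpen.mem_nhds hx)).filter_mono
        nhdsWithin_le_nhds
    filter_upwards [hU, (tendsto_ofReal_punctured x).eventually hev, self_mem_nhdsWithin,
      (tendsto_ofReal_punctured x).eventually (hsub.eventually (hf.continuousAt.eventually_ne hf0)),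
      (tendsto_ofReal_punctured x).eventually ((hA hgX).eventually_ne one_ne_zero)]
      with s hs hXZ hsx hfs hAs
    have hu0 : (s : ℂ) - x ≠ 0 := by
      rw [sub_ne_zero]; exact fun h => hsx (Complex.ofReal_injective h)
    have hum : ((s : ℂ) - x) ^ m ≠ 0 := zpow_ne_zero _ hu0
    have hX := h.realX s hs
    have hZ := h.realZ s hs
    have hq : (ε : ℂ) * Complex.I * ((1 + ((s : ℂ) - x) ^ n * gZ (s - x)) /
        (1 + ((s : ℂ) - x) ^ n * gX (s - x))) = Z s / X s := by
      rw [hXZ.1, hXZ.2]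
      field_simp
    simp only [Function.comp_apply, Pi.div_apply]
    rw [hq]
    have e1 : X s = ((X s).re : ℂ) := Complex.ext rfl (by simp [hX])
    have e2 : Z s = ((Z s).re : ℂ) := Complex.ext rfl (by simp [hZ])
    rw [e1, e2, ← Complex.ofReal_div, Complex.ofReal_im]
  rcases hε with rfl | rfl <;> simp at heq

theorem AssumptionXZ.analyticAt (h : AssumptionXZ U X Z sr) {s : ℂ} (hs : s ∈ U)
    (hc : s ∉ criticalPoints U X Z) :
    AnalyticAt ℂ X s ∧ AnalyticAt ℂ Z s ∧ rhoSq X Z s ≠ 0 := by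
  have h1 : ¬ (rhoSq X Z s = 0 ∨ meromorphicOrderAt X s < 0 ∨ meromorphicOrderAt Z s < 0) :=
    fun h' => hc ⟨hs, h'⟩
  push Not at h1
  exact ⟨(h.meroX hs).meromorphicOrderAt_nonneg_iff_analyticAt.1 h1.2.1,
    (h.meroZ hs).meromorphicOrderAt_nonneg_iff_analyticAt.1 h1.2.2, h1.1⟩

theorem AssumptionXZ.eq_ofReal (h : AssumptionXZ U X Z sr) {x : ℝ} (hx : (x : ℂ) ∈ U) :
    X x = ((X x).re : ℂ) ∧ Z x = ((Z x).re : ℂ) ∧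
      rhoSq X Z x = (((X x).re ^ 2 + (Z x).re ^ 2 : ℝ) : ℂ) ∧ 0 < (X x).re ^ 2 + (Z x).re ^ 2 := by
  have e1 : X x = ((X x).re : ℂ) := Complex.ext rfl (by simp [h.realX x hx])
  have e2 : Z x = ((Z x).re : ℂ) := Complex.ext rfl (by simp [h.realZ x hx])
  have e3 : rhoSq X Z x = (((X x).re ^ 2 + (Z x).re ^ 2 : ℝ) : ℂ) := by
    rw [rhoSq, e1, e2]; push_cast; simp
  obtain ⟨c, hc, hpos⟩ := h.pos
  refine ⟨e1, e2, e3, ?_⟩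
  have := hpos x hx
  rw [e3, Complex.ofReal_re] at this
  exact hc.trans_le this

theorem AssumptionXZ.isOpen_real (h : AssumptionXZ U X Z sr) : IsOpen {x : ℝ | (x : ℂ) ∈ U} :=
  h.isOpen.preimage Complex.continuous_ofReal

theorem hasDerivAt_re_of_real {f : ℂ → ℂ} {x : ℝ} (hf : AnalyticAt ℂ f x)
    (hr : ∀ᶠ y : ℝ in 𝓝 x, (f y).im = 0) :
    HasDerivAt (fun y : ℝ => (f y).re) (deriv f x).re x ∧ deriv f x = ((deriv f x).re : ℂ) := by
  have h1 := hf.differentiableAt.hasDerivAt.real_of_complex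
  refine ⟨h1, ?_⟩
  have h2 := hf.differentiableAt.hasDerivAt.comp_ofReal
  refine h2.unique (h1.ofReal_comp.congr_of_eventuallyEq ?_)
  filter_upwards [hr] with y hy
  exact Complex.ext rfl (by simp [hy])

theorem contDiffAt_re_comp_ofReal {f : ℂ → ℂ} {x : ℝ} (hf : AnalyticAt ℂ f x) :
    ContDiffAt ℝ ∞ (fun y : ℝ => (f y).re) x :=
  ContDiffAt.comp x Complex.reCLM.contDiff.contDiffAt (contDiffAt_comp_ofReal hf)

theorem IsAngle.hasDerivAt {θt : ℝ → ℝ} (hθ : IsAngle U X Z θt) (h : AssumptionXZ U X Z sr)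
    {x : ℝ} (hx : (x : ℂ) ∈ U) :
    HasDerivAt θt (angleDeriv X Z x).re x ∧ angleDeriv X Z x = ((angleDeriv X Z x).re : ℂ) ∧
      ContDiffAt ℝ ∞ θt x := by
  obtain ⟨hXa, hZa, -⟩ := h.analyticAt hx (h.not_critical hx)
  have hUev : ∀ᶠ y : ℝ in 𝓝 x, (y : ℂ) ∈ U := h.isOpen_real.mem_nhds hx
  obtain ⟨hXd, hXe⟩ := hasDerivAt_re_of_real hXa (hUev.mono fun y hy => h.realX y hy)
  obtain ⟨hZd, hZe⟩ := hasDerivAt_re_of_real hZa (hUev.mono fun y hy => h.realZ y hy)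
  have hXc := contDiffAt_re_comp_ofReal hXa
  have hZc := contDiffAt_re_comp_ofReal hZa
  set xr : ℝ → ℝ := fun y => (X y).re with hxr
  set zr : ℝ → ℝ := fun y => (Z y).re with hzr
  obtain ⟨hX0, hZ0, hr0, hpos⟩ := h.eq_ofReal hx
  set ρ : ℝ → ℝ := fun y => √(xr y ^ 2 + zr y ^ 2) with hρ
  have hρc : ContDiffAt ℝ ∞ ρ x := ((hXc.pow 2).add (hZc.pow 2)).sqrt hpos.ne'
  have hρ0 : ρ x ≠ 0 := (Real.sqrt_pos.2 hpos).ne'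
  -- This smooth function equals `sin (θt y - θt x)`. Continuity keeps the difference in `(-π/2,
  -- π/2)` near `x`, so `arcsin` recovers the angle with its regularity.
  set w : ℝ → ℝ := fun y => (xr y * zr x - zr y * xr x) / (ρ y * ρ x) with hw
  have hwc : ContDiffAt ℝ ∞ w x :=
    ((hXc.mul contDiffAt_const).sub (hZc.mul contDiffAt_const)).div (hρc.mul contDiffAt_const)
      (mul_ne_zero hρ0 hρ0)
  have hw0 : w x = 0 := by simp only [hw]; rw [mul_comm, sub_self, zero_div]
  have hθev : θt =ᶠ[𝓝 x] fun y => θt x + Real.arcsin (w y) := by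
    have hcont : ContinuousAt θt x := (hθ.1 x hx).continuousAt hUev
    have hlim : Tendsto (fun y => θt y - θt x) (𝓝 x) (𝓝 0) := by
      simpa using hcont.tendsto.sub_const (θt x)
    filter_upwards [hUev, hlim.eventually (Ioo_mem_nhds (show -(Real.pi / 2) < 0 by
      linarith [Real.pi_pos]) (show 0 < Real.pi / 2 by linarith [Real.pi_pos]))] with y hy hyI
    have key : ∀ {z : ℝ}, (z : ℂ) ∈ U → zr z = ρ z * Real.cos (θt z) ∧
        xr z = ρ z * Real.sin (θt z) ∧ 0 < ρ z := by
      intro z hz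
      obtain ⟨h1, h2⟩ := hθ.2 z hz
      obtain ⟨-, -, h3, h4⟩ := h.eq_ofReal hz
      rw [h3, Complex.ofReal_re] at h1 h2
      refine ⟨?_, ?_, Real.sqrt_pos.2 h4⟩
      · have := congrArg Complex.re h1
        rwa [Complex.ofReal_re] at this
      · have := congrArg Complex.re h2
        rwa [Complex.ofReal_re] at this
    obtain ⟨hz1, hx1, hp1⟩ := key hy
    obtain ⟨hz2, hx2, hp2⟩ := key hx
    have hwy : w y = Real.sin (θt y - θt x) := by
      simp only [hw]
      rw [hz1, hx1, hz2, hx2, Real.sin_sub]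
      field_simp
    rw [hwy, Real.arcsin_sin hyI.1.le hyI.2.le]
    ring
  have hderiv : angleDeriv X Z x = ((((deriv X x).re * zr x - xr x * (deriv Z x).re) /
      (xr x ^ 2 + zr x ^ 2) : ℝ) : ℂ) := by
    rw [angleDeriv, hr0, hXe, hZe, hX0, hZ0]
    push_cast
    simp [hxr, hzr]
  refine ⟨?_, ?_, ?_⟩
  · have hwd : HasDerivAt w (angleDeriv X Z x).re x := by
      have h1 := ((hXd.mul_const (zr x)).sub (hZd.mul_const (xr x))).div
        (((hρc.differentiableAt (by simp)).hasDerivAt).mul_const (ρ x)) (mul_ne_zero hρ0 hρ0)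
      refine h1.congr_deriv ?_
      have hsq : ρ x * ρ x = xr x ^ 2 + zr x ^ 2 := Real.mul_self_sqrt hpos.le
      rw [hderiv, Complex.ofReal_re]
      simp only [Pi.sub_apply]
      rw [mul_comm (xr x) (zr x), sub_self, zero_mul, sub_zero, hsq]
      field_simp
    have h2 : HasDerivAt Real.arcsin 1 (w x) := by
      have := Real.hasDerivAt_arcsin (x := w x) (by rw [hw0]; norm_num) (by rw [hw0]; norm_num)
      simpa [hw0] using this
    have h3 := (h2.comp x hwd).const_add (θt x)
    rw [one_mul] at h3
    exact h3.congr_of_eventuallyEq hθev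
  · rw [hderiv, Complex.ofReal_re]
  · refine ContDiffAt.congr_of_eventuallyEq ?_ hθev
    refine contDiffAt_const.add (ContDiffAt.comp (g := Real.arcsin) x ?_ hwc)
    exact Real.contDiffAt_arcsin (by rw [hw0]; norm_num) (by rw [hw0]; norm_num)

theorem AssumptionXZ.continuousAt_sqrt (h : AssumptionXZ U X Z sr) {x : ℝ} (hx : (x : ℂ) ∈ U) :
    ContinuousAt (fun u : ℝ => √(rhoSq X Z u).re) x := by
  obtain ⟨hXa, hZa, -⟩ := h.analyticAt hx (h.not_critical hx)
  have h1 : ContinuousAt (rhoSq X Z) x := (hXa.continuousAt.pow 2).add (hZa.continuousAt.pow 2)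
  have h2 : ContinuousAt (fun u : ℝ => rhoSq X Z u) x :=
    ContinuousAt.comp (f := fun u : ℝ => (u : ℂ)) h1 Complex.continuous_ofReal.continuousAt
  exact Real.continuous_sqrt.continuousAt.comp (Complex.continuous_re.continuousAt.comp h2)

/-- The interval of the real axis around `sr` on which the natural time is defined. -/
def realComponent (U : Set ℂ) (sr : ℝ) : Set ℝ := connectedComponentIn {x : ℝ | (x : ℂ) ∈ U} sr

theorem AssumptionXZ.realComponent_props (h : AssumptionXZ U X Z sr) :
    IsOpen (realComponent U sr) ∧ sr ∈ realComponent U sr ∧ (realComponent U sr).OrdConnected ∧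
      ∀ x ∈ realComponent U sr, (x : ℂ) ∈ U :=
  ⟨h.isOpen_real.connectedComponentIn, mem_connectedComponentIn h.mem,
    isPreconnected_connectedComponentIn.ordConnected, fun _ hx =>
      connectedComponentIn_subset {x : ℝ | (x : ℂ) ∈ U} sr hx⟩

theorem AssumptionXZ.hasStrictDerivAt_realTime (h : AssumptionXZ U X Z sr) {x : ℝ}
    (hx : x ∈ realComponent U sr) :
    HasStrictDerivAt (realTime X Z sr) (2 * √(rhoSq X Z x).re) x := by
  obtain ⟨hJo, hsr, hJc, hJU⟩ := h.realComponent_props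
  have hc : ContinuousOn (fun u : ℝ => √(rhoSq X Z u).re) (realComponent U sr) := fun y hy =>
    (h.continuousAt_sqrt (hJU y hy)).continuousWithinAt
  have hint : IntervalIntegrable (fun u : ℝ => √(rhoSq X Z u).re) volume sr x :=
    (hc.mono (hJc.uIcc_subset hsr hx)).intervalIntegrable
  exact (intervalIntegral.integral_hasStrictDerivAt_right hint
    (hc.stronglyMeasurableAtFilter hJo x hx) (h.continuousAt_sqrt (hJU x hx))).const_mul 2

theorem AssumptionXZ.sqrt_pos (h : AssumptionXZ U X Z sr) {x : ℝ} (hx : (x : ℂ) ∈ U) :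
    0 < √(rhoSq X Z x).re := by
  obtain ⟨-, -, h3, h4⟩ := h.eq_ofReal hx
  rw [h3, Complex.ofReal_re]
  exact Real.sqrt_pos.2 h4

theorem AssumptionXZ.injOn_realTime (h : AssumptionXZ U X Z sr) :
    InjOn (realTime X Z sr) (realComponent U sr) := by
  obtain ⟨hJo, hsr, hJc, hJU⟩ := h.realComponent_props
  refine StrictMonoOn.injOn (strictMonoOn_of_deriv_pos hJc.convex
    (fun x hx => (h.hasStrictDerivAt_realTime hx).hasDerivAt.continuousAt.continuousWithinAt) fun x hx => ?_)
  have hx' := interior_subset hx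
  rw [(h.hasStrictDerivAt_realTime hx').hasDerivAt.deriv]
  exact mul_pos two_pos (h.sqrt_pos (hJU x hx'))

theorem realTime_self : realTime X Z sr sr = 0 := by simp [realTime]

end RealAxis

/-! ### Natural time on the slit domain, and the coupling as the restriction of an analytic
function. -/

section NaturalTime

variable {U : Set ℂ} {X Z : ℂ → ℂ} {sr : ℝ} {B : ℂ → Set ℂ} {τ : ℂ → ℂ}

theorem slitDomain_subset {s : ℂ} (hs : s ∈ slitDomain U X Z sr B) :
    s ∈ U ∧ s ∉ criticalPoints U X Z := by
  have h1 : s ∈ slitSet U X Z B := connectedComponentIn_subset _ _ hs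
  exact ⟨h1.1, fun hc => h1.2 (mem_iUnion₂.2 ⟨s, hc, mem_insert _ _⟩)⟩

theorem IsBranchCutSystem.isOpen_slitDomain (hB : IsBranchCutSystem U X Z sr B) :
    IsOpen (slitDomain U X Z sr B) := hB.isOpen_slit.connectedComponentIn

theorem IsBranchCutSystem.mem_slitDomain (hB : IsBranchCutSystem U X Z sr B)
    (h : AssumptionXZ U X Z sr) : (sr : ℂ) ∈ slitDomain U X Z sr B := by
  refine mem_connectedComponentIn ⟨h.mem, fun hmem => ?_⟩
  obtain ⟨s₀, hs₀, hs⟩ := mem_iUnion₂.1 hmem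
  rcases hs with rfl | hs
  · exact h.not_critical h.mem hs₀
  · exact hB.not_mem s₀ hs₀ hs

theorem IsBranchCutSystem.tip_slitDomain (hB : IsBranchCutSystem U X Z sr B) {s₀ : ℂ}
    (hs₀ : s₀ ∈ criticalPoints U X Z) (hcl : s₀ ∈ closure (slitDomain U X Z sr B)) :
    ∀ W ∈ 𝓝 s₀, ∃ V ∈ 𝓝 s₀, V ⊆ W ∧ IsPreconnected (V ∩ slitDomain U X Z sr B) := by
  intro W hW
  obtain ⟨V, hV, hVW, hc⟩ := hB.tip s₀ hs₀ W hW
  refine ⟨V, hV, hVW, ?_⟩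
  obtain ⟨x, hxV, hx⟩ := mem_closure_iff_nhds.1 hcl V hV
  have hsub : slitDomain U X Z sr B ⊆ slitSet U X Z B := connectedComponentIn_subset _ _
  have h1 : V ∩ slitSet U X Z B ⊆ slitDomain U X Z sr B := by
    have := hc.subset_connectedComponentIn ⟨hxV, hsub hx⟩ inter_subset_right
    rwa [← connectedComponentIn_eq hx] at this
  have h2 : V ∩ slitDomain U X Z sr B = V ∩ slitSet U X Z B :=
    Subset.antisymm (inter_subset_inter_right _ hsub) fun y hy => ⟨hy.1, h1 hy⟩
  rwa [h2]

theorem IsNaturalTime.apply_self (hτ : IsNaturalTime U X Z sr B τ) : τ sr = 0 := by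
  have := hτ.2.self_of_nhds
  rwa [realTime_self, Complex.ofReal_zero] at this

/-- The identity holds on the real axis near `sr` and propagates over the connected `U₀`. Only the
squared relation is used, since the square root of `ρ²` depends on the branch. -/
theorem IsNaturalTime.deriv_sq (hτ : IsNaturalTime U X Z sr B τ) (h : AssumptionXZ U X Z sr)
    (hB : IsBranchCutSystem U X Z sr B) :
    ∀ s ∈ slitDomain U X Z sr B, deriv τ s ^ 2 = 4 * rhoSq X Z s := by
  obtain ⟨hJo, hsr, hJc, hJU⟩ := h.realComponent_props
  have hmem := hB.mem_slitDomain h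
  have hf : AnalyticOnNhd ℂ (fun s => deriv τ s ^ 2) (slitDomain U X Z sr B) := hτ.1.deriv.pow 2
  have hg : AnalyticOnNhd ℂ (fun s => 4 * rhoSq X Z s) (slitDomain U X Z sr B) := by
    intro s hs
    obtain ⟨h1, h2⟩ := slitDomain_subset hs
    obtain ⟨hXa, hZa, -⟩ := h.analyticAt h1 h2
    exact analyticAt_const.mul ((hXa.pow 2).add (hZa.pow 2))
  refine eqOn_of_eventually_eq_ofReal hf hg isPreconnected_connectedComponentIn hmem ?_
  have hUo : ∀ᶠ x : ℝ in 𝓝 sr, (x : ℂ) ∈ slitDomain U X Z sr B :=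
    (Complex.continuous_ofReal.tendsto sr).eventually (hB.isOpen_slitDomain.mem_nhds hmem)
  filter_upwards [hτ.2.eventually_nhds, hJo.mem_nhds hsr, hUo] with x hx hxJ hxU
  have h1 := (hτ.1 x hxU).differentiableAt.hasDerivAt.comp_ofReal
  have h2 := (h.hasStrictDerivAt_realTime hxJ).hasDerivAt.ofReal_comp
  have h3 := h1.unique (h2.congr_of_eventuallyEq hx)
  obtain ⟨-, -, h4, h5⟩ := h.eq_ofReal (hJU x hxJ)
  rw [h3, h4, Complex.ofReal_re]
  norm_cast
  rw [mul_pow, Real.sq_sqrt h5.le]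
  norm_num

theorem IsNaturalTime.deriv_ne_zero (hτ : IsNaturalTime U X Z sr B τ) (h : AssumptionXZ U X Z sr)
    (hB : IsBranchCutSystem U X Z sr B) :
    ∀ s ∈ slitDomain U X Z sr B, deriv τ s ≠ 0 := by
  intro s hs h0
  have h1 := hτ.deriv_sq h hB s hs
  obtain ⟨h2, h3⟩ := slitDomain_subset hs
  rw [h0] at h1
  exact (h.analyticAt h2 h3).2.2 (by simpa using h1.symm)

theorem analyticAt_angleDeriv (h : AssumptionXZ U X Z sr) {s : ℂ}
    (hs : s ∈ slitDomain U X Z sr B) : AnalyticAt ℂ (angleDeriv X Z) s := by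
  obtain ⟨h1, h2⟩ := slitDomain_subset hs
  obtain ⟨hXa, hZa, h0⟩ := h.analyticAt h1 h2
  exact ((hXa.deriv.mul hZa).sub (hXa.mul hZa.deriv)).div ((hXa.pow 2).add (hZa.pow 2)) h0

/-- Near `0` the real inverse `invFunOn` and the complex lift `φ` coincide, so `θ = θt ∘ φ` there.
The values of `φ` and of the coupling are real at real times, which later gives the reflection
symmetry. -/
theorem eventually_coupling_eq (hτ : IsNaturalTime U X Z sr B τ) (h : AssumptionXZ U X Z sr)
    (hB : IsBranchCutSystem U X Z sr B) {θt : ℝ → ℝ} (hθ : IsAngle U X Z θt) {φ : ℂ → ℂ} {R : ℝ}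
    (hR : 0 < R) (hφ : IsLift (slitDomain U X Z sr B) τ φ (Metric.ball 0 R)) (h0 : φ 0 = sr) :
    ∀ᶠ t : ℝ in 𝓝 0, ContDiffAt ℝ ∞ (thetaOf U X Z sr θt) t ∧
      couplingOf U X Z sr θt t = angleDeriv X Z (φ t) / deriv τ (φ t) ∧ (φ t).im = 0 ∧
      (couplingOf U X Z sr θt t).im = 0 := by
  obtain ⟨hJo, hsr, hJc, hJU⟩ := h.realComponent_props
  have hUo := hB.isOpen_slitDomain
  have hτ' := hτ.deriv_ne_zero h hB
  have hmem := hB.mem_slitDomain h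
  have hsub : ∀ᶠ x : ℝ in 𝓝 sr, φ (τ x) = x := by
    have : (sr : ℂ) ∈ sublevel (slitDomain U X Z sr B) τ sr R :=
      mem_connectedComponentIn ⟨hmem, by simpa using hR⟩
    filter_upwards [(Complex.continuous_ofReal.tendsto sr).eventually
      ((isOpen_sublevel hUo hτ.1 R).mem_nhds this)] with x hx
    exact (hφ.sublevel_eq_image hUo hτ.1 hτ' hτ.apply_self hR h0 hx).2
  have hev : ∀ᶠ x : ℝ in 𝓝 sr, x ∈ realComponent U sr ∧ τ x = (realTime X Z sr x : ℂ) ∧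
      φ (τ x) = x := by
    filter_upwards [hJo.mem_nhds hsr, hτ.2, hsub] with x h1 h2 h3 using ⟨h1, h2, h3⟩
  have hmap := (h.hasStrictDerivAt_realTime hsr).map_nhds_eq
    (mul_pos two_pos (h.sqrt_pos h.mem)).ne'
  rw [realTime_self] at hmap
  have hinv : ∀ᶠ t : ℝ in 𝓝 0, ∃ x ∈ realComponent U sr, φ t = x ∧
      thetaOf U X Z sr θt t = θt x := by
    have : ∀ᶠ t : ℝ in 𝓝 0, ∃ x : ℝ, (x ∈ realComponent U sr ∧ τ x = (realTime X Z sr x : ℂ) ∧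
        φ (τ x) = x) ∧ realTime X Z sr x = t := by
      rw [← hmap, eventually_map]
      filter_upwards [hev] with x hx using ⟨x, hx, rfl⟩
    filter_upwards [this] with t ht
    obtain ⟨x, ⟨hxJ, hx1, hx2⟩, rfl⟩ := ht
    refine ⟨x, hxJ, by rw [← hx1, hx2], ?_⟩
    have : Function.invFunOn (realTime X Z sr) (realComponent U sr) (realTime X Z sr x) = x :=
      h.injOn_realTime.leftInvOn_invFunOn hxJ
    exact congrArg θt this
  have hball : ∀ᶠ t : ℝ in 𝓝 0, (t : ℂ) ∈ Metric.ball (0 : ℂ) R := by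
    have : Tendsto (fun t : ℝ => (t : ℂ)) (𝓝 0) (𝓝 0) := by
      simpa using Complex.continuous_ofReal.tendsto 0
    exact this.eventually (Metric.ball_mem_nhds 0 hR)
  filter_upwards [hinv.eventually_nhds, hball] with t ht htb
  obtain ⟨x, hxJ, hx, -⟩ := ht.self_of_nhds
  have heq : thetaOf U X Z sr θt =ᶠ[𝓝 t] fun y => θt (φ y).re := by
    filter_upwards [ht] with y hy
    obtain ⟨z, -, h1, h2⟩ := hy
    rw [h2, h1, Complex.ofReal_re]
  have him : ∀ᶠ y : ℝ in 𝓝 t, (φ y).im = 0 := by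
    filter_upwards [ht] with y hy
    obtain ⟨z, -, h1, -⟩ := hy
    rw [h1, Complex.ofReal_im]
  have hφa := hφ.analytic t htb
  obtain ⟨hd, hde⟩ := hasDerivAt_re_of_real hφa him
  have hre : (φ t).re = x := by rw [hx, Complex.ofReal_re]
  obtain ⟨hθd, hθe, hθc⟩ := hθ.hasDerivAt h (hJU x hxJ)
  have hcoup : couplingOf U X Z sr θt t = angleDeriv X Z (φ t) / deriv τ (φ t) := by
    have h1 : HasDerivAt (fun y : ℝ => θt (φ y).re) _ t :=
      HasDerivAt.comp t (h := fun y : ℝ => (φ y).re) (by rw [hre]; exact hθd) hd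
    rw [couplingOf, (h1.congr_of_eventuallyEq heq).deriv, Complex.ofReal_mul, ← hθe, ← hde,
      hφ.deriv_eq hτ.1 Metric.isOpen_ball htb, hx, div_eq_mul_inv]
  refine ⟨?_, hcoup, him.self_of_nhds, by rw [couplingOf, Complex.ofReal_im]⟩
  refine ContDiffAt.congr_of_eventuallyEq ?_ heq
  exact ContDiffAt.comp t (f := fun y : ℝ => (φ y).re) (by rw [hre]; exact hθc)
    (contDiffAt_re_comp_ofReal hφa)

end NaturalTime

/-! ### From derivative bounds to the norms with Gamma weights. -/

theorem facNorm_lt_top {α tc K : ℝ} {I : Set ℝ} {f : ℝ → ℂ}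
    (h : ∀ t ∈ I, ∀ k : ℕ,
      ‖iteratedDeriv k f t‖ * (tc ^ (α + k) / Real.Gamma (α + k)) ≤ K) :
    facNorm α tc I f < ⊤ :=
  (iSup₂_le fun t ht => iSup_le fun k => ENNReal.ofReal_le_ofReal (h t ht k)).trans_lt
    ENNReal.ofReal_lt_top

/-- Log-convexity of `Γ` in the form of the Bohr–Mollerup inequality at the integer `k + 2`; it
needs an integer at least `2`, hence the shift and the separate small cases in
`exists_weighted_bound`. -/
theorem factorial_mul_rpow_le_Gamma {α : ℝ} (hα : 0 < α) (k : ℕ) :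
    (k + 1).factorial * (k + 1 : ℝ) ^ α ≤ Real.Gamma (α + (k + 2 : ℕ)) := by
  have h1 := Real.BohrMollerup.f_add_nat_ge (f := Real.log ∘ Real.Gamma) (x := α) (n := k + 2)
    Real.convexOn_log_Gamma (fun {y} hy => by
      simp only [Function.comp_apply]
      rw [Real.Gamma_add_one hy.ne', Real.log_mul hy.ne' (Real.Gamma_pos_of_pos hy).ne', add_comm])
    (by omega) hα
  have hk : (0 : ℝ) < k + 1 := by positivity
  have hΓ : Real.Gamma ((k + 2 : ℕ) : ℝ) = (k + 1).factorial := by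
    rw [← Real.Gamma_nat_eq_factorial]; push_cast; congr 1; ring
  have hG : 0 < Real.Gamma (α + (k + 2 : ℕ)) := Real.Gamma_pos_of_pos (by positivity)
  simp only [Function.comp_apply] at h1
  rw [hΓ, add_comm _ α] at h1
  rw [← Real.log_le_log_iff (by positivity) hG, Real.log_mul (by positivity) (by positivity),
    Real.log_rpow hk]
  refine le_trans (le_of_eq ?_) h1
  push_cast
  congr 3
  ring

theorem exists_weighted_bound {α R : ℝ} (hα : 0 < α) (hR : 0 < R) (C : ℝ) :
    ∃ K, ∀ a : ℕ → ℝ, a 0 ≤ C →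
      (∀ k, a (k + 1) ≤ C * (k.factorial * (k + 1 : ℝ) ^ α * R⁻¹ ^ k)) →
      ∀ k : ℕ, a k * (R ^ (α + k) / Real.Gamma (α + k)) ≤ K := by
  have hΓ : ∀ k : ℕ, 0 < Real.Gamma (α + k) := fun k => Real.Gamma_pos_of_pos (by positivity)
  refine ⟨max (max (|C| * (R ^ α / Real.Gamma α)) (|C| * (R ^ (α + 1) / Real.Gamma (α + 1))))
    (|C| * 2 ^ α * R ^ (α + 1)), fun a h0 h k => ?_⟩
  have hC := le_abs_self C
  rcases k with _ | k
  · refine le_trans ?_ ((le_max_left _ _).trans (le_max_left _ _))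
    simp only [Nat.cast_zero, add_zero]
    have h2 := (hΓ 0)
    simp only [Nat.cast_zero, add_zero] at h2
    gcongr
    exact h0.trans hC
  rcases k with _ | k
  · refine le_trans ?_ ((le_max_right _ _).trans (le_max_left _ _))
    have h1 := h 0
    simp only [Nat.factorial_zero, Nat.cast_one, Nat.cast_zero, zero_add, Real.one_rpow, pow_zero,
      mul_one] at h1
    have h2 := (hΓ 1)
    simp only [Nat.cast_one] at h2
    simp only [zero_add, Nat.cast_one]
    gcongr
    exact h1.trans hC
  · refine le_trans ?_ (le_max_right _ _)
    have h1 := h (k + 1)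
    have h2 := factorial_mul_rpow_le_Gamma hα k
    have h3 := hΓ (k + 2)
    rw [show k + 1 + 1 = k + 2 from rfl, ← mul_div_assoc, div_le_iff₀ h3]
    have h4 : ((k + 1 : ℕ) + 1 : ℝ) ^ α ≤ 2 ^ α * (k + 1 : ℝ) ^ α := by
      rw [← Real.mul_rpow (by norm_num) (by positivity)]
      gcongr
      push_cast
      linarith [(Nat.cast_nonneg k : (0 : ℝ) ≤ k)]
    have h5 : R ^ (α + (k + 2 : ℕ)) = R ^ (α + 1) * R ^ (k + 1) := by
      rw [← Real.rpow_natCast R (k + 1), ← Real.rpow_add hR]; push_cast; congr 1; ring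
    calc a (k + 1 + 1) * R ^ (α + (k + 2 : ℕ))
        ≤ |C| * ((k + 1).factorial * (2 ^ α * (k + 1 : ℝ) ^ α) * R⁻¹ ^ (k + 1)) *
          R ^ (α + (k + 2 : ℕ)) := by
          gcongr
          refine h1.trans ?_
          gcongr
      _ = |C| * 2 ^ α * R ^ (α + 1) * ((k + 1).factorial * (k + 1 : ℝ) ^ α) := by
          rw [h5, inv_pow]; field_simp
      _ ≤ _ := by gcongr

theorem norm_iteratedDeriv_pole {c p z : ℂ} (hz : z ≠ p) (k : ℕ) :
    ‖iteratedDeriv k (fun z => c / (z - p)) z‖ = ‖c‖ * k.factorial * ‖z - p‖⁻¹ ^ (k + 1) := by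
  have h1 : (fun z => c / (z - p)) = fun z => c * (1 * z + -p)⁻¹ := by
    funext z; rw [div_eq_mul_inv, one_mul, sub_eq_add_neg]
  have h2 : z - p ≠ 0 := sub_ne_zero.2 hz
  rw [h1, iteratedDeriv_const_mul_field, iteratedDeriv_eq_iterate, iter_deriv_inv_linear]
  simp only [norm_mul, norm_pow, norm_neg, norm_one, one_pow, one_mul, mul_one, norm_zpow,
    Complex.norm_natCast]
  rw [show (-1 - k : ℤ) = -((k + 1 : ℕ) : ℤ) by push_cast; ring, zpow_neg, zpow_natCast, inv_pow,
    mul_assoc, ← sub_eq_add_neg]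

/-! ### The coupling on the disc, and the case of finitely many critical points. -/

section Assembly

variable {U : Set ℂ} {X Z : ℂ → ℂ} {sr : ℝ} {B : ℂ → Set ℂ} {τ : ℂ → ℂ} {R : ℝ}

theorem IsRadius.pos {U₀ : Set ℂ} (hR : IsRadius U₀ τ sr R) : 0 < R := by
  rcases Set.eq_empty_or_nonempty {r : ℝ | 0 < r ∧ closure (sublevel U₀ τ sr r) ⊆ U₀} with h | h
  · have h1 := hR.2
    rw [h, upperBounds_empty] at h1
    have := h1 (mem_univ (R - 1))
    linarith
  · obtain ⟨r, hr⟩ := h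
    exact hr.1.trans_le (hR.1 hr)

theorem IsRadius.closure_subset {U₀ : Set ℂ} (hR : IsRadius U₀ τ sr R) {r : ℝ} (hr : r < R) :
    closure (sublevel U₀ τ sr r) ⊆ U₀ := by
  obtain ⟨c, hc, hrc⟩ := (lt_isLUB_iff hR).1 hr
  exact (closure_mono (sublevel_mono hrc.le)).trans hc.2

theorem IsNaturalTime.exists_lift (hτ : IsNaturalTime U X Z sr B τ) (h : AssumptionXZ U X Z sr)
    (hB : IsBranchCutSystem U X Z sr B) (hR : IsRadius (slitDomain U X Z sr B) τ sr R)
    (hb : Bornology.IsBounded (sublevel (slitDomain U X Z sr B) τ sr R)) :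
    ∃ φ, IsLift (slitDomain U X Z sr B) τ φ (Metric.ball 0 R) ∧ φ 0 = sr :=
  exists_lift_ball hB.isOpen_slitDomain hτ.1 (hτ.deriv_ne_zero h hB) (hB.mem_slitDomain h)
    hτ.apply_self hR.pos fun _ hr =>
      ⟨(hb.subset (sublevel_mono hr.le)).isCompact_closure, hR.closure_subset hr⟩

theorem analyticAt_coupling {φ : ℂ → ℂ} {D : Set ℂ} (hτ : IsNaturalTime U X Z sr B τ)
    (h : AssumptionXZ U X Z sr) (hB : IsBranchCutSystem U X Z sr B)
    (hφ : IsLift (slitDomain U X Z sr B) τ φ D) {t : ℂ} (ht : t ∈ D) :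
    AnalyticAt ℂ (fun t => angleDeriv X Z (φ t) / deriv τ (φ t)) t := by
  have hs := hφ.mem t ht
  exact ((analyticAt_angleDeriv h hs).fun_comp (hφ.analytic t ht)).div
    ((hτ.1 _ hs).deriv.fun_comp (hφ.analytic t ht)) (hτ.deriv_ne_zero h hB _ hs)

theorem exists_regular_extension {φ : ℂ → ℂ} (hτ : IsNaturalTime U X Z sr B τ)
    (h : AssumptionXZ U X Z sr) (hB : IsBranchCutSystem U X Z sr B) (hR : 0 < R)
    (hφ : IsLift (slitDomain U X Z sr B) τ φ (Metric.ball 0 R)) {p s : ℂ} (hp : ‖p‖ = R)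
    (hs : s ∈ slitDomain U X Z sr B) (hlim : Tendsto φ (𝓝[Metric.ball 0 R] p) (𝓝 s)) :
    ∃ f : ℂ → ℂ, AnalyticAt ℂ f p ∧ ∀ᶠ t in 𝓝[Metric.ball 0 R] p,
      angleDeriv X Z (φ t) / deriv τ (φ t) = f t := by
  have : (𝓝[Metric.ball (0 : ℂ) R] p).NeBot := by
    rw [← mem_closure_iff_nhdsWithin_neBot, closure_ball _ hR.ne']
    exact mem_closedBall_zero_iff.2 hp.le
  obtain ⟨ψ, δ, hδ, hψ, -, hE⟩ := hφ.exists_extension hB.isOpen_slitDomain hτ.1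
    (hτ.deriv_ne_zero h hB) Metric.isOpen_ball (convex_ball _ _) hs hlim.mapClusterPt
  refine ⟨_, analyticAt_coupling hτ h hB hψ (Metric.mem_ball_self hδ), ?_⟩
  filter_upwards [self_mem_nhdsWithin, mem_nhdsWithin_of_mem_nhds (Metric.ball_mem_nhds p hδ)]
    with t ht htb
  rw [hE ⟨htb, ht⟩]

/-- The time `t₀` comes from the local form at `s₀` alone. That `‖t₀‖ = R` and that the lift tends
to `s₀` are required only for the singular expansion. -/
theorem exists_critical_time (hτ : IsNaturalTime U X Z sr B τ)
    (h : AssumptionXZ U X Z sr) (hB : IsBranchCutSystem U X Z sr B) {s₀ : ℂ}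
    (hs₀ : s₀ ∈ criticalPoints U X Z) (hcl : s₀ ∈ closure (slitDomain U X Z sr B))
    {m : ℤ} {n : ℕ} {ε : ℤ} (hform : HasCriticalForm X Z s₀ m n ε) :
    (0 : ℝ) < 2 * m + n + 2 ∧
    ∃ t₀ : ℂ, Tendsto τ (𝓝[slitDomain U X Z sr B] s₀) (𝓝 t₀) ∧
      ∀ (R : ℝ) (φ : ℂ → ℂ), 0 < R → IsLift (slitDomain U X Z sr B) τ φ (Metric.ball 0 R) →
        ‖t₀‖ = R → Tendsto φ (𝓝[Metric.ball 0 R] t₀) (𝓝 s₀) →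
        ∃ L : ℂ → ℂ, AnalyticAt ℂ L 0 ∧
          -t₀ * L 0 = Complex.I * ((ε * n / (2 * m + n + 2) : ℝ) : ℂ) ∧
          ∀ᶠ t in 𝓝[Metric.ball 0 R] t₀, angleDeriv X Z (φ t) / deriv τ (φ t) =
            L ((1 - t / t₀) ^ (((2 / (2 * m + n + 2) : ℝ)) : ℂ)) / (1 - t / t₀) := by
  obtain ⟨M, q, g, hM, hMN, hq, hq0, hg, hg0, hev⟩ := hform.exists_local
  have hs₀U : s₀ ∉ slitDomain U X Z sr B := fun hmem => (slitDomain_subset hmem).2 hs₀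
  obtain ⟨t₀, k, p, hk, hp, hp0, hk0, hlim, hE⟩ := exists_naturalTime_local
    hB.isOpen_slitDomain hτ.1 (hτ.deriv_ne_zero h hB) (hτ.deriv_sq h hB) hM hMN hq hq0 hs₀U hcl
    (hev.mono fun s hs => hs.1) (hB.tip_slitDomain hs₀ hcl)
  have hMr : (M : ℝ) = 2 * m + n + 2 := by exact_mod_cast hMN
  refine ⟨by rw [← hMr]; exact_mod_cast hM, t₀, hlim, fun R φ hR hφ ht₀ hφlim => ?_⟩
  obtain ⟨L, hL, hL0, hLe⟩ := hφ.exists_singular_form (G := angleDeriv X Z) hR hs₀U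
    (hτ.deriv_ne_zero h hB) hM ht₀ hφlim hk hp hp0 hk0 hg (hev.mono fun s hs => hs.2) hE
  refine ⟨L, hL, ?_, ?_⟩
  · rw [hL0, hg0, ← hMr]
    push_cast
    ring
  · rw [← hMr]
    exact hLe

theorem IsLift.limit_time_eq {U₀ : Set ℂ} {φ : ℂ → ℂ} (hR : 0 < R)
    (hφ : IsLift U₀ τ φ (Metric.ball 0 R)) {p s t₀ : ℂ} (hp : ‖p‖ = R)
    (hlim : Tendsto φ (𝓝[Metric.ball 0 R] p) (𝓝 s)) (ht₀ : Tendsto τ (𝓝[U₀] s) (𝓝 t₀)) :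
    p = t₀ := by
  have : (𝓝[Metric.ball (0 : ℂ) R] p).NeBot := by
    rw [← mem_closure_iff_nhdsWithin_neBot, closure_ball _ hR.ne']
    exact mem_closedBall_zero_iff.2 hp.le
  have h1 : Tendsto φ (𝓝[Metric.ball 0 R] p) (𝓝[U₀] s) := by
    refine tendsto_nhdsWithin_iff.2 ⟨hlim, ?_⟩
    filter_upwards [self_mem_nhdsWithin] with t ht using hφ.mem t ht
  have h2 : Tendsto id (𝓝[Metric.ball 0 R] p) (𝓝 t₀) := by
    refine (ht₀.comp h1).congr' ?_
    filter_upwards [self_mem_nhdsWithin] with t ht using hφ.right_inv t ht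
  exact tendsto_nhds_unique (tendsto_id.mono_left nhdsWithin_le_nhds) h2

theorem exists_pos_lt_one_le {ι : Type*} (P : Finset ι) (β : ι → ℝ) (h : ∀ p ∈ P, 0 < β p) :
    ∃ b, 0 < b ∧ b < 1 ∧ ∀ p ∈ P, b ≤ β p := by
  classical
  induction P using Finset.induction_on with
  | empty => exact ⟨1 / 2, by norm_num, by norm_num, by simp⟩
  | insert a s _ ih =>
    obtain ⟨b, h0, h1, hb⟩ := ih fun p hp => h p (Finset.mem_insert_of_mem hp)
    refine ⟨min b (β a), lt_min h0 (h a (Finset.mem_insert_self _ _)),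
      (min_le_left _ _).trans_lt h1, fun p hp => ?_⟩
    rcases Finset.mem_insert.1 hp with rfl | hp
    · exact min_le_right _ _
    · exact (min_le_left _ _).trans (hb p hp)

/-- At `t = 0` all singular points are at distance exactly `R`. Each pole contributes `k! R^(-k-1)`,
which is just what the weight `Γ(1 + k)` allows, and the fractional remainders are smaller. -/
theorem coupling_mem_FSpace_of_R2 {θt : ℝ → ℝ} (h : AssumptionXZ U X Z sr)
    (hθ : IsAngle U X Z θt) (hB : IsBranchCutSystem U X Z sr B) (hτ : IsNaturalTime U X Z sr B τ)
    (hR : IsRadius (slitDomain U X Z sr B) τ sr R)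
    (h2 : AssumptionR2 (slitDomain U X Z sr B) (criticalPoints U X Z) τ sr R) :
    ContDiffAt ℝ ∞ (thetaOf U X Z sr θt) 0 ∧ couplingOf U X Z sr θt ∈ FSpace 1 R {0} := by
  obtain ⟨hb, hfin, hcrit⟩ := h2
  have hR0 := hR.pos
  have hUo := hB.isOpen_slitDomain
  have hτ' := hτ.deriv_ne_zero h hB
  obtain ⟨φ, hφ, hφ0⟩ := hτ.exists_lift h hB hR hb
  have hev := eventually_coupling_eq hτ h hB hθ hR0 hφ hφ0
  refine ⟨hev.self_of_nhds.1, ?_⟩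
  set hh : ℂ → ℂ := fun t => angleDeriv X Z (φ t) / deriv τ (φ t) with hhdef
  have hha : AnalyticOnNhd ℂ hh (Metric.ball 0 R) := fun t ht => analyticAt_coupling hτ h hB hφ ht
  have hlim := fun p hp => hφ.exists_tendsto hUo hτ.1 hτ' hτ.apply_self hR0 hφ0 hb hfin (p := p) hp
  choose! s hs hslim using hlim
  set P₀ : Set ℂ := {p | ‖p‖ = R ∧ s p ∉ slitDomain U X Z sr B}
  have hsF : ∀ p ∈ P₀, s p ∈ frontier (sublevel (slitDomain U X Z sr B) τ sr R) ∩
      frontier (slitDomain U X Z sr B) := fun p hp =>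
    closure_sublevel_subset hUo hτ.1 (hs p hp.1) hp.2
  have hdata : ∀ p ∈ P₀, Tendsto τ (𝓝[slitDomain U X Z sr B] (s p)) (𝓝 p) ∧
      ∃ (L : ℂ → ℂ) (β : ℝ), AnalyticAt ℂ L 0 ∧ 0 < β ∧
      ∀ᶠ t in 𝓝[Metric.ball 0 R] p, hh t = L ((1 - t / p) ^ (β : ℂ)) / (1 - t / p) := by
    intro p hp
    have hc := hcrit (hsF p hp)
    obtain ⟨m, n, ε, hform⟩ := h.form _ hc
    obtain ⟨hpos, t₀, ht₀, hL⟩ := exists_critical_time hτ h hB hc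
      (frontier_subset_closure (hsF p hp).2) hform
    obtain rfl : p = t₀ := hφ.limit_time_eq hR0 hp.1 (hslim p hp.1) ht₀
    obtain ⟨L, hLa, -, hLe⟩ := hL R φ hR0 hφ hp.1 (hslim p hp.1)
    exact ⟨ht₀, L, _, hLa, div_pos two_pos hpos, hLe⟩
  -- The point `p` is recovered from `s p` as the limit of `τ`, so `P₀` injects into the finite set
  -- of boundary critical points.
  have hPfin : P₀.Finite := by
    refine Set.Finite.of_injOn (f := s) hsF (fun p hp q hq hpq => ?_) hfin
    have h1 := (hdata p hp).1
    rw [hpq] at h1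
    have : (𝓝[slitDomain U X Z sr B] (s q)).NeBot :=
      mem_closure_iff_nhdsWithin_neBot.1 (frontier_subset_closure (hsF q hq).2)
    exact tendsto_nhds_unique h1 (hdata q hq).1
  choose! L β hLa hβ hLe using fun p hp => (hdata p hp).2
  set P := hPfin.toFinset
  have hmemP : ∀ p, p ∈ P ↔ p ∈ P₀ := fun p => hPfin.mem_toFinset
  obtain ⟨b, hb0, hb1, hbβ⟩ := exists_pos_lt_one_le P β fun p hp => hβ p ((hmemP p).1 hp)
  set c : ℂ → ℂ := fun p => -p * L p 0
  obtain ⟨ε, hε, hC⟩ := exists_iteratedDeriv_bound (h := hh) (c := c) (β := β) hR0 (P := P) (fun p hp => ((hmemP p).1 hp).1) hha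
    (fun p hp hpP => exists_regular_extension hτ h hB hR0 hφ hp
      (by by_contra hcon; exact hpP ((hmemP p).2 ⟨hp, hcon⟩)) (hslim p hp))
    (fun p hp => hβ p ((hmemP p).1 hp))
    (fun p hp => ⟨L p, hLa p ((hmemP p).1 hp), rfl, hLe p ((hmemP p).1 hp)⟩)
  -- An exponent in `(0, 1)` above every `1 - β p`.
  obtain ⟨C, hC⟩ := hC (1 - b) (by linarith) fun p hp => by linarith [hbβ p hp]
  have hnorm : ∀ p ∈ P, ‖p‖ = R := fun p hp => ((hmemP p).1 hp).1
  have hne : ∀ p ∈ P, (0 : ℂ) ≠ p := fun p hp h0 => by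
    have := hnorm p hp
    rw [← h0, norm_zero] at this
    exact hR0.ne this
  have hC0 := hC 0 (by simpa using hε) (fun p hp => by rw [sub_zero, hnorm p hp])
  have hha0 : AnalyticAt ℂ hh 0 := hha 0 (Metric.mem_ball_self hR0)
  have hpole : ∀ p ∈ P, AnalyticAt ℂ (fun z => c p / (z - p)) 0 := fun p hp =>
    analyticAt_const.div (analyticAt_id.sub analyticAt_const) (sub_ne_zero.2 (hne p hp))
  have hpsum : AnalyticAt ℂ (fun z => ∑ p ∈ P, c p / (z - p)) 0 :=
    Finset.analyticAt_fun_sum _ hpole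
  have hevh : couplingOf U X Z sr θt =ᶠ[𝓝 0] fun t : ℝ => hh t := hev.mono fun t ht => ht.2.1
  have hha0' : AnalyticAt ℂ hh ((0 : ℝ) : ℂ) := by rwa [Complex.ofReal_zero]
  refine ⟨fun t ht => ?_, ?_⟩
  · rw [mem_singleton_iff.1 ht]
    exact (contDiffAt_comp_ofReal hha0').congr_of_eventuallyEq hevh
  have hder : ∀ k, iteratedDeriv k (couplingOf U X Z sr θt) 0 = iteratedDeriv k hh 0 := fun k => by
    rw [hevh.iteratedDeriv_eq, iteratedDeriv_comp_ofReal k hha0', Complex.ofReal_zero]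
  have hsplit : ∀ k : ℕ, ‖iteratedDeriv (k + 1) hh 0‖ ≤
      (|C| + ∑ p ∈ P, ‖c p‖ * R⁻¹ ^ 2) * (k.factorial * (k + 1 : ℝ) ^ (1 : ℝ) * R⁻¹ ^ k) := by
    intro k
    have e1 : hh = (fun z => hh z - ∑ p ∈ P, c p / (z - p)) + fun z => ∑ p ∈ P, c p / (z - p) := by
      funext z; simp
    have e2 : iteratedDeriv (k + 1) hh 0 = iteratedDeriv (k + 1)
        (fun z => hh z - ∑ p ∈ P, c p / (z - p)) 0 +
        ∑ p ∈ P, iteratedDeriv (k + 1) (fun z => c p / (z - p)) 0 := by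
      rw [← iteratedDeriv_fun_sum (fun p hp => (hpole p hp).contDiffAt)]
      conv_lhs => rw [e1]
      exact iteratedDeriv_add (hha0.sub hpsum).contDiffAt hpsum.contDiffAt
    rw [e2, add_mul]
    refine (norm_add_le _ _).trans (add_le_add ((hC0 k).trans ?_) ?_)
    · have hk : (1 : ℝ) ≤ k + 1 := by
        have : (0 : ℝ) ≤ k := Nat.cast_nonneg k
        linarith
      have : (k + 1 : ℝ) ^ (1 - b) ≤ (k + 1 : ℝ) ^ (1 : ℝ) :=
        Real.rpow_le_rpow_of_exponent_le hk (by linarith)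
      gcongr
      exact le_abs_self C
    · refine (norm_sum_le _ _).trans ?_
      rw [Finset.sum_mul]
      refine Finset.sum_le_sum fun p hp => ?_
      rw [norm_iteratedDeriv_pole (hne p hp), zero_sub, norm_neg, hnorm p hp, Real.rpow_one,
        Nat.factorial_succ]
      push_cast
      refine le_of_eq ?_
      ring
  obtain ⟨K, hK⟩ := exists_weighted_bound one_pos hR0
    (max ‖hh 0‖ (|C| + ∑ p ∈ P, ‖c p‖ * R⁻¹ ^ 2))
  refine facNorm_lt_top (K := K) fun t ht k => ?_
  rw [mem_singleton_iff.1 ht, hder]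
  refine hK (fun k => ‖iteratedDeriv k hh 0‖) ?_ (fun k => (hsplit k).trans ?_) k
  · simp
  · gcongr
    exact le_max_right _ _

end Assembly

/-! ### Reflection symmetry, and the case of one conjugate pair of critical points. -/

section Coupling

variable {U : Set ℂ} {X Z : ℂ → ℂ} {sr : ℝ} {B : ℂ → Set ℂ} {τ : ℂ → ℂ} {R : ℝ}

theorem conj_mem_ball {t : ℂ} : (starRingEnd ℂ) t ∈ Metric.ball (0 : ℂ) R ↔ t ∈ Metric.ball 0 R := by
  simp

theorem tendsto_conj_nhdsWithin_ball (p : ℂ) :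
    Tendsto (starRingEnd ℂ) (𝓝[Metric.ball 0 R] ((starRingEnd ℂ) p)) (𝓝[Metric.ball 0 R] p) := by
  refine tendsto_nhdsWithin_iff.2 ⟨?_, ?_⟩
  · have : Tendsto (starRingEnd ℂ) (𝓝 ((starRingEnd ℂ) p)) (𝓝 p) := by
      simpa using Complex.continuous_conj.tendsto ((starRingEnd ℂ) p)
    exact this.mono_left nhdsWithin_le_nhds
  · filter_upwards [self_mem_nhdsWithin] with t ht using conj_mem_ball.2 ht

theorem conj_symm_of_real {f : ℂ → ℂ} (hR : 0 < R) (hf : AnalyticOnNhd ℂ f (Metric.ball 0 R))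
    (hr : ∀ᶠ x : ℝ in 𝓝 0, (f x).im = 0) {t : ℂ} (ht : t ∈ Metric.ball 0 R) :
    f ((starRingEnd ℂ) t) = (starRingEnd ℂ) (f t) := by
  have hg : AnalyticOnNhd ℂ (fun w => (starRingEnd ℂ) (f ((starRingEnd ℂ) w))) (Metric.ball 0 R) := by
    intro z hz
    have := analyticAt_conj_conj (hf _ (conj_mem_ball.2 hz))
    rwa [Complex.conj_conj] at this
  have := eqOn_of_eventually_eq_ofReal hf hg (convex_ball _ _).isPreconnected (a := 0)
    (by simpa using hR) (by
      filter_upwards [hr] with x hx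
      rw [Complex.conj_ofReal, Complex.conj_eq_iff_im.2 hx])
  have h1 := this (conj_mem_ball.2 ht)
  simpa using h1

theorem exists_singular_form_conj {f L : ℂ → ℂ} {β : ℝ} {p : ℂ} (hR : 0 < R) (hp : ‖p‖ = R)
    (hf : AnalyticOnNhd ℂ f (Metric.ball 0 R)) (hr : ∀ᶠ x : ℝ in 𝓝 0, (f x).im = 0)
    (hL : AnalyticAt ℂ L 0)
    (h : ∀ᶠ t in 𝓝[Metric.ball 0 R] p, f t = L ((1 - t / p) ^ (β : ℂ)) / (1 - t / p)) :
    ∃ L' : ℂ → ℂ, AnalyticAt ℂ L' 0 ∧ L' 0 = (starRingEnd ℂ) (L 0) ∧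
      ∀ᶠ t in 𝓝[Metric.ball 0 R] ((starRingEnd ℂ) p),
        f t = L' ((1 - t / (starRingEnd ℂ) p) ^ (β : ℂ)) / (1 - t / (starRingEnd ℂ) p) := by
  refine ⟨fun w => (starRingEnd ℂ) (L ((starRingEnd ℂ) w)), ?_, by simp, ?_⟩
  · have := analyticAt_conj_conj hL
    rwa [map_zero] at this
  · filter_upwards [(tendsto_conj_nhdsWithin_ball p).eventually h, self_mem_nhdsWithin] with t ht htb
    rw [conj_symm_of_real hR hf hr htb] at ht
    have h1 : (starRingEnd ℂ) (1 - t / (starRingEnd ℂ) p) = 1 - (starRingEnd ℂ) t / p := by simp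
    have h2 : (1 - t / (starRingEnd ℂ) p).arg ≠ Real.pi :=
      (Complex.mem_slitPlane_iff_arg.1 (Or.inl (re_one_sub_div_pos (R := R)
        (by rw [Complex.norm_conj, hp]) (mem_ball_zero_iff.1 htb)))).1
    have h3 := Complex.cpow_conj (1 - t / (starRingEnd ℂ) p) (β : ℂ) h2
    rw [Complex.conj_ofReal, h1] at h3
    rw [← Complex.conj_conj (f t), ht, map_div₀, h3, Complex.conj_conj, ← h1, Complex.conj_conj]

/-- This gives the distance hypothesis of `exists_iteratedDeriv_bound` on a whole real interval; a
pole off the imaginary axis comes closer than `‖p‖` for `t` on one side of `0`. -/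
theorem norm_ofReal_le_norm_sub {p : ℂ} (hp : p.re = 0) (t : ℝ) : ‖p‖ ≤ ‖p - t‖ := by
  rw [← sq_le_sq₀ (norm_nonneg _) (norm_nonneg _), ← Complex.normSq_eq_norm_sq,
    ← Complex.normSq_eq_norm_sq, Complex.normSq_apply, Complex.normSq_apply]
  simp only [hp, Complex.sub_re, Complex.sub_im, Complex.ofReal_re, Complex.ofReal_im]
  nlinarith [mul_self_nonneg t]

theorem coupling_of_R1 {θt : ℝ → ℝ} (h : AssumptionXZ U X Z sr)
    (hθ : IsAngle U X Z θt) (hB : IsBranchCutSystem U X Z sr B) (hτ : IsNaturalTime U X Z sr B τ)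
    (hR : IsRadius (slitDomain U X Z sr B) τ sr R) {s₀ : ℂ}
    (h1 : AssumptionR1 (slitDomain U X Z sr B) (criticalPoints U X Z) τ sr R s₀)
    {m : ℤ} {n : ℕ} {ε : ℤ} (hform : HasCriticalForm X Z s₀ m n ε) :
    (0 : ℝ) < 2 * m + n + 2 ∧
    ∃ t₀ : ℂ, Tendsto τ (𝓝[slitDomain U X Z sr B] s₀) (𝓝 t₀) ∧ t₀.re = 0 ∧ ‖t₀‖ = R ∧
      ∃ η, 0 < η ∧ η ≤ R ∧
        (∀ t ∈ Icc (-η) η, ContDiffAt ℝ ∞ (thetaOf U X Z sr θt) t) ∧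
        ∀ α : ℝ, 0 < α → α < 1 → (2 * (m : ℝ) + n) / (2 * m + n + 2) ≤ α →
          (fun t => couplingOf U X Z sr θt t - polePair (ε * n / (2 * m + n + 2)) t₀ t) ∈
            FSpace α R (Icc (-η) η) := by
  obtain ⟨hs₀, ⟨σ, hσc, hσ0, -, hσ⟩, hb, hF⟩ := h1
  have hR0 := hR.pos
  have hUo := hB.isOpen_slitDomain
  have hτ' := hτ.deriv_ne_zero h hB
  set U₀ := slitDomain U X Z sr B with hU₀
  set C := sublevel U₀ τ sr R with hCdef
  have hfin : (frontier C ∩ frontier U₀).Finite := by rw [hF]; exact Set.toFinite _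
  have hs₀F : s₀ ∈ frontier C ∩ frontier U₀ := by rw [hF]; exact mem_insert _ _
  have hs₀U : s₀ ∉ U₀ := fun hmem => (slitDomain_subset hmem).2 hs₀
  obtain ⟨φ, hφ, hφ0⟩ := hτ.exists_lift h hB hR hb
  obtain ⟨hpos, t₀, ht₀, hL⟩ := exists_critical_time hτ h hB hs₀
    (frontier_subset_closure hs₀F.2) hform
  -- `Re τ` is constant along the Stokes line, equal to its value `0` at `sr`, and `t₀` is the limit
  -- of `τ` along it.
  have hre : t₀.re = 0 := by
    have hσlim : Tendsto σ (𝓝[Ioc 0 1] 0) (𝓝[U₀] s₀) := by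
      refine tendsto_nhdsWithin_iff.2 ⟨?_, ?_⟩
      · have := (hσc 0 ⟨le_rfl, zero_le_one⟩).tendsto
        rw [hσ0] at this
        exact this.mono_left (nhdsWithin_mono _ Ioc_subset_Icc_self)
      · filter_upwards [self_mem_nhdsWithin] with u hu using (hσ u hu).1
    have h2 := (Complex.continuous_re.tendsto _).comp (ht₀.comp hσlim)
    have h3 : Tendsto (fun _ : ℝ => (0 : ℝ)) (𝓝[Ioc 0 1] (0 : ℝ)) (𝓝 t₀.re) := by
      refine h2.congr' ?_
      filter_upwards [self_mem_nhdsWithin] with u hu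
      simp only [Function.comp_apply, (hσ u hu).2, hτ.apply_self, Complex.zero_re]
    have : (𝓝[Ioc 0 1] (0 : ℝ)).NeBot := left_nhdsWithin_Ioc_neBot zero_lt_one
    exact tendsto_nhds_unique h3 tendsto_const_nhds |>.trans rfl
  have hCne : (𝓝[C] s₀).NeBot :=
    mem_closure_iff_nhdsWithin_neBot.1 (frontier_subset_closure hs₀F.1)
  have hCinv : ∀ s ∈ C, τ s ∈ Metric.ball 0 R ∧ φ (τ s) = s := fun s hs =>
    hφ.sublevel_eq_image hUo hτ.1 hτ' hτ.apply_self hR0 hφ0 hs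
  have hCU : C ⊆ U₀ := fun s hs => (sublevel_subset R hs).1
  have hτC : Tendsto τ (𝓝[C] s₀) (𝓝[Metric.ball 0 R] t₀) := by
    refine tendsto_nhdsWithin_iff.2 ⟨ht₀.mono_left (nhdsWithin_mono _ hCU), ?_⟩
    filter_upwards [self_mem_nhdsWithin] with s hs using (hCinv s hs).1
  have hφτ : Tendsto (φ ∘ τ) (𝓝[C] s₀) (𝓝 s₀) := by
    refine (tendsto_id.mono_left nhdsWithin_le_nhds).congr' ?_
    filter_upwards [self_mem_nhdsWithin] with s hs using (hCinv s hs).2.symm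
  -- If `t₀` were inside the disc, then `φ` would be continuous there, giving `s₀ = φ t₀ ∈ U₀`.
  have ht₀R : ‖t₀‖ = R := by
    have hle : ‖t₀‖ ≤ R := by
      refine le_of_tendsto (tendsto_nhdsWithin_iff.1 hτC).1.norm ?_
      filter_upwards [self_mem_nhdsWithin] with s hs
      exact (mem_ball_zero_iff.1 (hCinv s hs).1).le
    refine hle.eq_of_not_lt fun hlt => ?_
    have hmem : t₀ ∈ Metric.ball 0 R := mem_ball_zero_iff.2 hlt
    have h2 := ((hφ.analytic t₀ hmem).continuousAt.tendsto.mono_left nhdsWithin_le_nhds).comp hτC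
    exact hs₀U (tendsto_nhds_unique hφτ h2 ▸ hφ.mem t₀ hmem)
  have hlim := fun p hp => hφ.exists_tendsto hUo hτ.1 hτ' hτ.apply_self hR0 hφ0 hb hfin (p := p) hp
  have hφlim : Tendsto φ (𝓝[Metric.ball 0 R] t₀) (𝓝 s₀) := by
    obtain ⟨s, -, hs⟩ := hlim t₀ ht₀R
    rwa [← tendsto_nhds_unique hφτ (hs.comp hτC)] at hs
  obtain ⟨L, hLa, hL0, hLe⟩ := hL R φ hR0 hφ ht₀R hφlim
  have hev := eventually_coupling_eq hτ h hB hθ hR0 hφ hφ0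
  set hh : ℂ → ℂ := fun t => angleDeriv X Z (φ t) / deriv τ (φ t) with hhdef
  have hha : AnalyticOnNhd ℂ hh (Metric.ball 0 R) := fun t ht => analyticAt_coupling hτ h hB hφ ht
  have hhr : ∀ᶠ x : ℝ in 𝓝 0, (hh x).im = 0 := hev.mono fun x hx => by
    have := hx.2.2.2
    rwa [hx.2.1] at this
  obtain ⟨L', hL'a, hL'0, hL'e⟩ := exists_singular_form_conj hR0 ht₀R hha hhr hLa hLe
  set γ : ℝ := ε * n / (2 * m + n + 2) with hγ
  set t₁ := (starRingEnd ℂ) t₀ with ht₁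
  have ht₁R : ‖t₁‖ = R := by rw [ht₁, Complex.norm_conj, ht₀R]
  have hre₁ : t₁.re = 0 := by rw [ht₁, Complex.conj_re, hre]
  have hne : t₁ ≠ t₀ := fun heq => by
    have him := Complex.conj_eq_iff_im.1 heq
    have : t₀ = 0 := Complex.ext hre him
    rw [this, norm_zero] at ht₀R
    exact hR0.ne ht₀R
  set c : ℂ → ℂ := fun p => if p = t₀ then Complex.I * γ else -(Complex.I * γ) with hc
  have hreg : ∀ p : ℂ, ‖p‖ = R → p ∉ ({t₀, t₁} : Finset ℂ) → ∃ f : ℂ → ℂ, AnalyticAt ℂ f p ∧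
      ∀ᶠ t in 𝓝[Metric.ball 0 R] p, hh t = f t := by
    intro p hp hpP
    obtain ⟨s, hs, hslim⟩ := hlim p hp
    by_cases hsU : s ∈ U₀
    · exact exists_regular_extension hτ h hB hR0 hφ hp hsU hslim
    exfalso
    have hsF := closure_sublevel_subset hUo hτ.1 hs hsU
    rw [← hCdef, hF] at hsF
    refine hpP ?_
    rw [Finset.mem_insert, Finset.mem_singleton]
    rcases hsF with rfl | hsF
    · exact Or.inl (hφ.limit_time_eq hR0 hp hslim ht₀)
    · rw [mem_singleton_iff] at hsF
      right
      -- Since `φ` commutes with conjugation, a boundary point sent to the conjugate of `s₀` is the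
      -- conjugate of one sent to `s₀`, that is, of `t₀`.
      have hslim' : Tendsto φ (𝓝[Metric.ball 0 R] ((starRingEnd ℂ) p)) (𝓝 s₀) := by
        have h2 := (Complex.continuous_conj.tendsto s).comp
          (hslim.comp (tendsto_conj_nhdsWithin_ball p))
        rw [hsF, Complex.conj_conj] at h2
        refine h2.congr' ?_
        filter_upwards [self_mem_nhdsWithin] with t ht
        simp only [Function.comp_apply]
        rw [conj_symm_of_real hR0 hφ.analytic (hev.mono fun x hx => hx.2.2.1) ht, Complex.conj_conj]
      have := hφ.limit_time_eq hR0 (by rw [Complex.norm_conj, hp]) hslim' ht₀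
      rw [ht₁, ← this, Complex.conj_conj]
  have hPnorm : ∀ p ∈ ({t₀, t₁} : Finset ℂ), ‖p‖ = R ∧ p.re = 0 := by
    intro p hp
    rw [Finset.mem_insert, Finset.mem_singleton] at hp
    rcases hp with rfl | rfl
    · exact ⟨ht₀R, hre⟩
    · exact ⟨ht₁R, hre₁⟩
  obtain ⟨ε', hε', hbound⟩ := exists_iteratedDeriv_bound (h := hh) (c := c)
    (β := fun _ => 2 / (2 * m + n + 2)) hR0 (P := {t₀, t₁}) (fun p hp => (hPnorm p hp).1) hha hreg
    (fun _ _ => div_pos two_pos hpos) (by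
      intro p hp
      rw [Finset.mem_insert, Finset.mem_singleton] at hp
      rcases hp with rfl | rfl
      · exact ⟨L, hLa, by rw [hL0, hc]; simp only [if_true], hLe⟩
      · refine ⟨L', hL'a, ?_, hL'e⟩
        have h2 := congrArg (starRingEnd ℂ) hL0
        rw [map_mul, map_neg, map_mul, Complex.conj_I, Complex.conj_ofReal] at h2
        rw [hL'0, h2, hc]
        simp only [if_neg hne, neg_mul])
  have hpoles : ∀ z : ℂ, ∑ p ∈ ({t₀, t₁} : Finset ℂ), c p / (z - p) =
      Complex.I * γ * (1 / (z - t₀) - 1 / (z - t₁)) := by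
    intro z
    rw [Finset.sum_pair hne.symm, hc]
    simp only [if_neg hne, if_true]
    ring
  obtain ⟨δ, hδ, hδev⟩ := Metric.eventually_nhds_iff_ball.1 hev
  -- Chosen before `α`, so the interval is the same for all exponents.
  set η := min (δ / 2) (min (ε' / 2) (R / 2)) with hη
  have hη0 : 0 < η := by positivity
  have hη1 : η < δ := (min_le_left _ _).trans_lt (by linarith)
  have hη2 : η < ε' := ((min_le_right _ _).trans (min_le_left _ _)).trans_lt (by linarith)
  have hη3 : η < R := ((min_le_right _ _).trans (min_le_right _ _)).trans_lt (by linarith)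
  have habs : ∀ t ∈ Icc (-η) η, |t| ≤ η := fun t ht => abs_le.2 ht
  have hδt : ∀ t ∈ Icc (-η) η, t ∈ Metric.ball (0 : ℝ) δ := fun t ht => by
    rw [mem_ball_zero_iff, Real.norm_eq_abs]; exact (habs t ht).trans_lt hη1
  have hRt : ∀ t ∈ Icc (-η) η, (t : ℂ) ∈ Metric.ball (0 : ℂ) R := fun t ht => by
    rw [mem_ball_zero_iff, Complex.norm_real, Real.norm_eq_abs]; exact (habs t ht).trans_lt hη3
  refine ⟨hpos, t₀, ht₀, hre, ht₀R, η, hη0, hη3.le, fun t ht => (hδev t (hδt t ht)).1, ?_⟩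
  intro α hα hα1 hαmn
  obtain ⟨C₁, hC₁⟩ := hbound α hα fun _ _ => by
    refine le_trans (le_of_eq ?_) hαmn
    field_simp
    ring
  set h₂ : ℂ → ℂ := fun z => hh z - ∑ p ∈ ({t₀, t₁} : Finset ℂ), c p / (z - p) with hh₂
  have hne₂ : ∀ z ∈ Metric.ball (0 : ℂ) R, ∀ p ∈ ({t₀, t₁} : Finset ℂ), z ≠ p := by
    rintro z hz p hp rfl
    rw [mem_ball_zero_iff, (hPnorm z hp).1] at hz
    exact lt_irrefl _ hz
  have hh₂a : AnalyticOnNhd ℂ h₂ (Metric.ball 0 R) := fun z hz =>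
    (hha z hz).sub (Finset.analyticAt_fun_sum _ fun p hp =>
      analyticAt_const.div (analyticAt_id.sub analyticAt_const) (sub_ne_zero.2 (hne₂ z hz p hp)))
  have heq : ∀ t ∈ Icc (-η) η, (fun t : ℝ => couplingOf U X Z sr θt t - polePair γ t₀ t) =ᶠ[𝓝 t]
      fun t : ℝ => h₂ t := fun t ht => by
    filter_upwards [Metric.isOpen_ball.mem_nhds (hδt t ht)] with x hx
    rw [(hδev x hx).2.1, hh₂]
    simp only [hpoles, polePair]
    rfl
  obtain ⟨K₀, hK₀⟩ : ∃ K, ∀ z ∈ Metric.closedBall (0 : ℂ) η, ‖h₂ z‖ ≤ K :=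
    (isCompact_closedBall _ _).exists_bound_of_continuousOn
      (hh₂a.continuousOn.mono (Metric.closedBall_subset_ball hη3))
  obtain ⟨K, hK⟩ := exists_weighted_bound hα hR0 (max K₀ C₁)
  refine ⟨fun t ht => (contDiffAt_comp_ofReal (hh₂a t (hRt t ht))).congr_of_eventuallyEq (heq t ht),
    facNorm_lt_top (K := K) fun t ht k => ?_⟩
  rw [(heq t ht).iteratedDeriv_eq, iteratedDeriv_comp_ofReal k (hh₂a t (hRt t ht))]
  refine hK (fun k => ‖iteratedDeriv k h₂ t‖) ?_ (fun k => ?_) k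
  · simp only [iteratedDeriv_zero]
    refine (hK₀ t ?_).trans (le_max_left _ _)
    rw [mem_closedBall_zero_iff, Complex.norm_real]
    exact habs t ht
  · refine (hC₁ t ?_ ?_ k).trans ?_
    · rw [Complex.norm_real]
      exact (habs t ht).trans_lt hη2
    · intro p hp
      rw [← (hPnorm p hp).1]
      exact norm_ofReal_le_norm_sub (hPnorm p hp).2 t
    · gcongr
      exact le_max_right _ _

end Coupling

end SuperAdiabatic

theorem theorem6 (U : Set ℂ) (X Z : ℂ → ℂ) (sr : ℝ) (θt : ℝ → ℝ) (B : ℂ → Set ℂ)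
    (τ : ℂ → ℂ) (R : ℝ)
    (hXZ : SuperAdiabatic.AssumptionXZ U X Z sr)
    (hθ : SuperAdiabatic.IsAngle U X Z θt)
    (hB : SuperAdiabatic.IsBranchCutSystem U X Z sr B)
    (hτ : SuperAdiabatic.IsNaturalTime U X Z sr B τ)
    (hR : SuperAdiabatic.IsRadius (SuperAdiabatic.slitDomain U X Z sr B) τ sr R) :
    (SuperAdiabatic.AssumptionR2 (SuperAdiabatic.slitDomain U X Z sr B)
        (SuperAdiabatic.criticalPoints U X Z) τ sr R →
      ContDiffAt ℝ ∞ (SuperAdiabatic.thetaOf U X Z sr θt) (SuperAdiabatic.realTime X Z sr sr) ∧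
      SuperAdiabatic.couplingOf U X Z sr θt ∈
        SuperAdiabatic.FSpace 1 R {SuperAdiabatic.realTime X Z sr sr} ∧
      SuperAdiabatic.Assumption2 (SuperAdiabatic.couplingOf U X Z sr θt) R
        {SuperAdiabatic.realTime X Z sr sr}) ∧
    (∀ s₀ : ℂ,
      SuperAdiabatic.AssumptionR1 (SuperAdiabatic.slitDomain U X Z sr B)
        (SuperAdiabatic.criticalPoints U X Z) τ sr R s₀ →
      ∀ (m : ℤ) (n : ℕ) (ε : ℤ), SuperAdiabatic.HasCriticalForm X Z s₀ m n ε →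
      ∃ t₀ : ℂ, Tendsto τ (𝓝[SuperAdiabatic.slitDomain U X Z sr B] s₀) (𝓝 t₀) ∧
        ∃ a b : ℝ, a < SuperAdiabatic.realTime X Z sr sr ∧
          SuperAdiabatic.realTime X Z sr sr < b ∧
          (∀ t ∈ Icc a b, ContDiffAt ℝ ∞ (SuperAdiabatic.thetaOf U X Z sr θt) t) ∧
          (∃ Δ : ℝ → ℂ,
            (∀ t ∈ Icc a b, SuperAdiabatic.couplingOf U X Z sr θt t =
              SuperAdiabatic.polePair (ε * n / (2 * m + n + 2)) t₀ t + Δ t) ∧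
            ∀ α : ℝ, 0 < α → α < 1 → (2 * (m : ℝ) + n) / (2 * m + n + 2) ≤ α →
              Δ ∈ SuperAdiabatic.FSpace α R (Icc a b)) ∧
          SuperAdiabatic.Assumption1 (SuperAdiabatic.couplingOf U X Z sr θt)
            (SuperAdiabatic.realTime X Z sr sr) R (Icc a b)) := by
  rw [SuperAdiabatic.realTime_self]
  have hR0 := hR.pos
  refine ⟨fun h2 => ?_, fun s₀ h1 m n ε hform => ?_⟩
  · obtain ⟨h3, h4⟩ := SuperAdiabatic.coupling_mem_FSpace_of_R2 hXZ hθ hB hτ hR h2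
    exact ⟨h3, h4, hR0, ⟨0, 0, le_rfl, (Icc_self 0).symm⟩, R, le_rfl, h4⟩
  · obtain ⟨hpos, t₀, ht₀, hre, hnorm, η, hη, hηR, hsmooth, hmain⟩ :=
      SuperAdiabatic.coupling_of_R1 hXZ hθ hB hτ hR h1 hform
    refine ⟨t₀, ht₀, -η, η, by linarith, hη, hsmooth, ⟨_, fun t _ => (add_sub_cancel _ _).symm,
      hmain⟩, hR0, ⟨-η, η, rfl⟩, Icc_subset_Icc (by linarith) (by linarith),
      ⟨by linarith, hη.le⟩, ?_⟩
    -- The lower bound can be zero or negative when `2m + n ≤ 0`; the maximum with `1 / 2` keeps the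
    -- exponent in `(0, 1)`.
    set α : ℝ := max (1 / 2) ((2 * (m : ℝ) + n) / (2 * m + n + 2))
    have hα0 : 0 < α := lt_max_of_lt_left (by norm_num)
    have hα1 : α < 1 := max_lt (by norm_num) (by rw [div_lt_one hpos]; linarith)
    have hα := hmain α hα0 hα1 (le_max_right _ _)
    have him : t₀.im = R ∨ t₀.im = -R := by
      rw [← abs_eq hR0.le, ← hnorm, Complex.norm_def, Complex.normSq_apply, hre, zero_mul, zero_add,
        Real.sqrt_mul_self_eq_abs]
    rcases him with him | him
    -- Here `t₀ = iR`, so bringing the pole pair to the order of `Assumption1`, with `-iR` first,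
    -- changes the sign of the coefficient.
    · refine ⟨-(ε * n / (2 * m + n + 2)), α, hα0, hα1, ?_⟩
      convert hα using 3 with t
      have e1 : t₀ = Complex.I * R := by apply Complex.ext <;> simp [hre, him]
      simp only [SuperAdiabatic.polePair, e1]
      simp
      ring
    · refine ⟨ε * n / (2 * m + n + 2), α, hα0, hα1, ?_⟩
      have e1 : ((0 : ℝ) : ℂ) - Complex.I * R = t₀ := by apply Complex.ext <;> simp [hre, him]
      rw [e1]
      exact hα
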